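/- \textbf{Setting.} Let $I$ be a finite set of $n\ge 2$ agents, agent $i$ having a finite non-empty set $A_i$ of actions. For each action profile $\mathbf a\in\prod_i A_i$ and agent $i$ let $U_i(\mathbf a)$ be a random utility with values a.s. in $[0,1]$, and $M_i(\mathbf a)=\mathbb E[U_i(\mathbf a)]$. Let $\delta=1/m$ with $m\ge1$ an integer. The bins are $[0,\delta),[\delta,2\delta),\dots,[1-\delta,1),\{1\}$; $v^-$ is the lower edge of a bin $v$, $v+k\delta$ is the bin shifted by $k\delta$, bins are ordered naturally, $v'=v\pm\delta$ means $v'\in\{v-\delta,v,v+\delta\}$, and $N_i(\mathbf a)$ is the bin containing $M_i(\mathbf a)$. Let $\tau_0>0$, $c_F\in(0,1)$, let $F(u)\ge0$ be non-increasing in $u\in[0,1]$, and let $G(\bar u,u)\ge0$ be non-decreasing in $\bar u\in[0,1]$ and non-increasing in $u\in[0,1+\delta]$. For bins put $F(v)=F(v^-)$, $G(\bar v,v)=G(\bar v^-,v^-)$. \textbf{The process.} Each agent is either discontent (and then stores nothing) or content, hopeful or watchful with a benchmark action $\bar a$ and a benchmark bin $\bar v$. A state $x\in\mathcal X$ gives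 the state of every agent; $D$ is the state in which all agents are discontent. For $\epsilon\in(0,1)$ put $\tau(\epsilon)=\lceil\tau_0\log(1/\epsilon)\rceil$. One transition of the chain $P^\epsilon$ is as follows. Each agent independently picks an action $a$: a discontent one uniformly in $A_i$; a content one with $\bar v<\{1\}$ plays $\bar a$ with probability $1-\epsilon$ and otherwise a uniformly chosen $a\neq\bar a$; all others play $\bar a$. Each agent observes the bin $v$ of the average of $\tau(\epsilon)$ i.i.d. samples of $U_i(\mathbf a)$, independently across agents. Then, independently: \begin{itemize} \item a discontent agent becomes content with benchmark $(a,v)$ with probability $\min(\epsilon^{F(v)},c_F)$, and else stays discontent; \item a content agent with $a\ne\bar a$ becomes content with benchmark $(a,v)$ with probability $\epsilon^{G(\bar v,v)}$ if $v\ge\bar v+2\delta$, and otherwise keeps its state; \item a content agent with $a=\bar a$ becomes hopeful if $v\ge\bar v+2\delta$, watchful if $v\le\bar v-2\delta$ (same benchmark), and keeps its state if $v=\bar v\pm\delta$; \item a hopeful agent becomes content with benchmark $(a,v)$ if $v\ge\bar v+2\delta$, watchful with the same benchmark if $v\le\bar v-2\delta$, and content with the same benchmark if $v=\bar v\pm\delta$;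 \item a watchful agent becomes hopeful with the same benchmark if $v\ge\bar v+2\delta$, discontent if $v\le\bar v-2\delta$, and content with the same benchmark if $v=\bar v\pm\delta$. \end{itemize} \textbf{Resistance and potential.} A family $X^\epsilon\ge0$ is almost regular with resistance $r\in[0,\infty]$ if, as $\epsilon\to0^+$, $\epsilon^{-r'}X^\epsilon\to0$ for all real $r'<r$ and $\epsilon^{-r'}X^\epsilon\to\infty$ for all real $r'>r$. Let $r(x\to y)$ be the resistance of $P^\epsilon_{x,y}$ and $\mathcal G$ the directed graph on $\mathcal X$ whose edges are the pairs with $r(x\to y)<\infty$. An $x$-tree is an acyclic subgraph of $\mathcal G$ in which every $y\ne x$ has exactly one outgoing edge and $x$ has none; its resistance is the sum of the resistances of its edges. The potential $\gamma(x)$ is the minimal resistance of an $x$-tree ($\infty$ if there is none), and $\mathcal X^\star=\{x\in\mathcal X:\gamma(x)=\min_{\mathcal X}\gamma\}$. \textbf{Sets of states.} Let $x$ be an all-content state with benchmark actions $\bar{\mathbf a}$ and bins $\bar{\mathbf v}$. \begin{itemize} \item $x\in\mathcal C$ (strongly aligned) if $N_i(\bar{\mathbf a})=\bar v_i$ for all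 $i$. \item $x\in\mathcal C_\delta$ (weakly aligned) if for all $i$, $N_i(\bar{\mathbf a})=\bar v_i\pm\delta$ and, unless $U_i(\bar{\mathbf a})$ is deterministic, $M_i(\bar{\mathbf a})\ne\bar v_i^--\delta$. \item $x\in\mathcal E$ if $x\in\mathcal C$ and $N_i(a_i,\bar a_{-i})\le\bar v_i$ for all $i$ and $a_i\neq\bar a_i$; $x\in\mathcal E_\delta$ if $x\in\mathcal C_\delta$ and $N_i(a_i,\bar a_{-i})\le\bar v_i+\delta$ for all $i$ and $a_i\neq\bar a_i$. \item $x\in\mathcal A_\delta$ if $x\in\mathcal C_\delta$ and $\bar v_i=\{1\}$ for all $i$; $x\in\mathcal A$ if moreover $\tilde R(x)=\infty$, where $\tilde R(x)$ is the minimum over all $i$ and all bins $v\neq\bar v_i\pm\delta$ of the resistance of the probability that the average of $\tau(\epsilon)$ i.i.d. samples of $U_i(\bar{\mathbf a})$ lies in $v$. \end{itemize} Put $\tilde W(x)=1-\sum_iF(\bar v_i)$, and \begin{align*} \tilde S_+(x)&=1-\min\{G(\bar v_i,N_i(a_i,\bar a_{-i})+\delta) : i\in I,\ a_i\ne\bar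 a_i,\ N_i(a_i,\bar a_{-i})\ge\bar v_i+\delta\},\\ \tilde S_-(x)&=1-\min\{G(\bar v_i,N_i(a_i,\bar a_{-i})) : i\in I,\ a_i\ne\bar a_i,\ N_i(a_i,\bar a_{-i})\ge\bar v_i+2\delta\}, \end{align*} defined when the respective sets are non-empty. \textbf{Theorem.} Assume: \begin{enumerate} \item ($3\delta$-interdependence) for every action profile $\mathbf a$ and every $\emptyset\subsetneq J\subsetneq I$ there are an agent $i\notin J$ and actions $a'_J$ with $|M_i(a'_J,a_{-J})-M_i(\mathbf a)|\ge3\delta$; \item there are constants $F_0,G_0$ with $F_0+G_0\le1$, $0\le F(u)\le F_0/n$ for all $u\in[0,1]$, and $0\le G(\bar u,u)<G_0$ for all $0\le\bar u<u\le1$; \item $2\tau_0\delta^2\ge1$; \item $\mathcal A=\emptyset$. \end{enumerate} Then all transition probabilities $P^\epsilon_{x,y}$ are almost regular (so that $\gamma$ is well defined), and: \begin{itemize} \item if $\mathcal E\ne\emptyset$, then $\mathcal X^\star\subset\mathcal A_\delta\cup\{x\in\mathcal E_\delta\setminus\mathcal A_\delta:\tilde W(x)\ge\max_{\mathcal E}\tilde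 W\}$; \item if $\mathcal E=\emptyset$, then $\mathcal X^\star\subset\mathcal E_\delta\cup\{x\in\mathcal C_\delta\setminus\mathcal E_\delta:\tilde W(x)-\tilde S_-(x)\ge\max_{\mathcal C}(\tilde W-\tilde S_+)\}$. \end{itemize} -/

import Mathlib

open MeasureTheory Filter Topology
open scoped ENNReal

noncomputable section

/-! ## Almost regular families, rooted trees, potential -/

/-- `X` (a family of non-negative reals indexed by `ε > 0`) is almost regular with resistance
`r ∈ [0, ∞]` as `ε → 0⁺`. -/
def HasResistance (X : ℝ → ℝ) (r : ℝ≥0∞) : Prop :=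
  (∀ r' : ℝ, (r' : EReal) < (r : EReal) →
      Tendsto (fun ε => ε ^ (-r') * X ε) (𝓝[>] 0) (𝓝 0)) ∧
  (∀ r' : ℝ, (r : EReal) < (r' : EReal) →
      Tendsto (fun ε => ε ^ (-r') * X ε) (𝓝[>] 0) atTop)

theorem HasResistance.unique {X : ℝ → ℝ} {r s : ℝ≥0∞} (hr : HasResistance X r)
    (hs : HasResistance X s) : r = s := by
  have key : ∀ {r s : ℝ≥0∞}, HasResistance X r → HasResistance X s → ¬ r < s := by
    intro r s hr hs h
    obtain ⟨q, h1, h2⟩ := EReal.lt_iff_exists_real_btwn.1 (EReal.coe_ennreal_lt_coe_ennreal_iff.2 h)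
    exact not_tendsto_nhds_of_tendsto_atTop (hr.2 q h1) 0 (hs.1 q h2)
  exact le_antisymm (not_lt.1 (key hs hr)) (not_lt.1 (key hr hs))

def AlmostRegular (X : ℝ → ℝ) : Prop := ∃ r : ℝ≥0∞, HasResistance X r

open Classical in
/-- The resistance of an almost regular family (it is unique). -/
def resistance (X : ℝ → ℝ) : ℝ≥0∞ :=
  if h : AlmostRegular X then h.choose else ⊤

/-- `T` is (the edge set of) an `x`-tree of the graph whose edges are the pairs `(y, z)` of finite
resistance `r y z`: an acyclic subgraph in which every vertex other than `x` has exactly one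
outgoing edge, and `x` has none. -/
structure IsRootedTree {X : Type*} (r : X → X → ℝ≥0∞) (x : X) (T : Finset (X × X)) : Prop where
  finite_resistance : ∀ e ∈ T, r e.1 e.2 ≠ ⊤
  out : ∀ y, y ≠ x → ∃! z, (y, z) ∈ T
  root : ∀ z, (x, z) ∉ T
  acyclic : ∀ y, ¬ Relation.TransGen (fun u v => (u, v) ∈ T) y y

/-- The minimal total resistance of an `x`-tree (`∞` if there is none). -/
def potential {X : Type*} (r : X → X → ℝ≥0∞) (x : X) : ℝ≥0∞ :=
  ⨅ (T : Finset (X × X)) (_ : IsRootedTree r x T), ∑ e ∈ T, r e.1 e.2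

/-- The set of vertices of minimum potential. -/
def minPotential {X : Type*} (r : X → X → ℝ≥0∞) : Set X :=
  {x | potential r x = ⨅ y, potential r y}

/-! ## The algorithm -/

/-- State of one agent with action set `α` and bins `0, …, m`. A discontent agent stores no
benchmark; the other moods (content, hopeful, watchful) come with a benchmark action and bin. -/
inductive AgentState (α : Type*) (m : ℕ) where
  | disc : AgentState α m
  | cont : α → Fin (m + 1) → AgentState α m
  | hope : α → Fin (m + 1) → AgentState α m
  | watch : α → Fin (m + 1) → AgentState α m
  deriving DecidableEq

/-- A random game together with the parameters of the algorithm. `law i a` is the distribution of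
the utility of agent `i` under the action profile `a`. The bin width is `δ = 1 / m`. -/
structure Ritel (I : Type*) (A : I → Type*) where
  law : I → (∀ j, A j) → Measure ℝ
  isProb : ∀ i a, IsProbabilityMeasure (law i a)
  bounded : ∀ i a, ∀ᵐ u ∂(law i a), u ∈ Set.Icc (0 : ℝ) 1
  m : ℕ
  m_pos : 0 < m
  τ₀ : ℝ
  τ₀_pos : 0 < τ₀
  cF : ℝ
  cF_mem : cF ∈ Set.Ioo (0 : ℝ) 1
  F : ℝ → ℝ
  F_nonneg : ∀ u ∈ Set.Icc (0 : ℝ) 1, 0 ≤ F u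
  F_anti : AntitoneOn F (Set.Icc 0 1)
  G : ℝ → ℝ → ℝ
  -- the second argument of `G` may be the lower edge `1 + δ` of the bin following `{1}`
  G_nonneg : ∀ w ∈ Set.Icc (0 : ℝ) 1, ∀ u ∈ Set.Icc (0 : ℝ) (1 + 1 / m), 0 ≤ G w u
  G_mono : ∀ u ∈ Set.Icc (0 : ℝ) (1 + 1 / m), MonotoneOn (fun w => G w u) (Set.Icc 0 1)
  G_anti : ∀ w ∈ Set.Icc (0 : ℝ) 1, AntitoneOn (G w) (Set.Icc 0 (1 + 1 / m))

namespace Ritel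

variable {I : Type*} {A : I → Type*} (g : Ritel I A)

def δ : ℝ := 1 / (g.m : ℝ)

/-- Bin number `k` is `[kδ, (k+1)δ)`, bin number `m` being `{1}` (inside `[0,1]`). -/
abbrev Bin : Type := Fin (g.m + 1)

/-- Lower edge of a bin. -/
def low (v : g.Bin) : ℝ := (v : ℕ) * g.δ

/-- The bin of a utility `u ∈ [0,1]`. -/
def binOf (u : ℝ) : g.Bin :=
  ⟨min ⌊u * (g.m : ℝ)⌋₊ g.m, Nat.lt_succ_of_le (min_le_right _ _)⟩

/-- `v' = v ± δ`, that is `v' ∈ {v - δ, v, v + δ}`. -/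
def Near (v' v : g.Bin) : Prop := (v' : ℕ) ≤ v + 1 ∧ (v : ℕ) ≤ v' + 1

/-- Mean utility. -/
def M (i : I) (a : ∀ j, A j) : ℝ := ∫ u, u ∂(g.law i a)

/-- Bin of the mean utility. -/
def N (i : I) (a : ∀ j, A j) : g.Bin := g.binOf (g.M i a)

/-- Length of a period. -/
def τ (ε : ℝ) : ℕ := ⌈g.τ₀ * Real.log (1 / ε)⌉₊

/-- Probability that the empirical mean of `t` i.i.d. samples of the utility of agent `i` under the
profile `a` belongs to bin `v`. -/
def binProb (t : ℕ) (i : I) (a : ∀ j, A j) (v : g.Bin) : ℝ :=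
  (Measure.pi (fun _ : Fin t => g.law i a)).real {u | g.binOf ((∑ k, u k) / (t : ℝ)) = v}

/-- Resistance of observing bin `v`. -/
def obsResistance (i : I) (a : ∀ j, A j) (v : g.Bin) : ℝ≥0∞ :=
  resistance (fun ε => g.binProb (g.τ ε) i a v)

/-- States of the algorithm; the all-discontent state is a single state. -/
abbrev State : Type _ := ∀ i, AgentState (A i) g.m

section Policies

variable {α : Type*} [DecidableEq α]

/-- Action policy: probability that an agent in a given state plays `c`. -/
def actionProb [Fintype α] (ε : ℝ) (s : AgentState α g.m) (c : α) : ℝ :=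
  match s with
  | .disc => 1 / (Fintype.card α : ℝ)
  | .cont b w =>
      if (w : ℕ) < g.m then
        if c = b then 1 - ε else ε / ((Fintype.card α : ℝ) - 1)
      else if c = b then 1 else 0
  | .hope b _ => if c = b then 1 else 0
  | .watch b _ => if c = b then 1 else 0

/-- Point mass at `s`, evaluated at `s'`. -/
def pt (s s' : AgentState α g.m) : ℝ := if s' = s then 1 else 0

/-- Update policy: probability that an agent in state `s` which played `c` and observed bin `v`
moves to state `s'`. -/
def updateProb (ε : ℝ) (s : AgentState α g.m) (c : α) (v : g.Bin) (s' : AgentState α g.m) : ℝ :=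
  match s with
  | .disc =>
      min (ε ^ g.F (g.low v)) g.cF * g.pt (.cont c v) s'
        + (1 - min (ε ^ g.F (g.low v)) g.cF) * g.pt .disc s'
  | .cont b w =>
      if c ≠ b then
        if (w : ℕ) + 2 ≤ v then
          ε ^ g.G (g.low w) (g.low v) * g.pt (.cont c v) s'
            + (1 - ε ^ g.G (g.low w) (g.low v)) * g.pt (.cont b w) s'
        else g.pt (.cont b w) s'
      else
        if (w : ℕ) + 2 ≤ v then g.pt (.hope b w) s'
        else if (v : ℕ) + 2 ≤ w then g.pt (.watch b w) s'
        else g.pt (.cont b w) s'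
  | .hope b w =>
      if (w : ℕ) + 2 ≤ v then g.pt (.cont c v) s'
      else if (v : ℕ) + 2 ≤ w then g.pt (.watch b w) s'
      else g.pt (.cont b w) s'
  | .watch b w =>
      if (w : ℕ) + 2 ≤ v then g.pt (.hope b w) s'
      else if (v : ℕ) + 2 ≤ w then g.pt .disc s'
      else g.pt (.cont b w) s'

end Policies

/-- Transition probability `P^ε_{x,y}` over one full period: the agents choose their actions
independently, observe independent empirical means, and update their states independently. -/
def transition [Fintype I] [DecidableEq I] [∀ i, Fintype (A i)] [∀ i, DecidableEq (A i)]
    (ε : ℝ) (x y : g.State) : ℝ :=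
  ∑ a : (∀ i, A i), (∏ i, g.actionProb ε (x i) (a i)) *
    ∏ i, ∑ v : g.Bin, g.binProb (g.τ ε) i a v * g.updateProb ε (x i) (a i) v (y i)

/-- Resistance of the transition from `x` to `y`. -/
def res [Fintype I] [DecidableEq I] [∀ i, Fintype (A i)] [∀ i, DecidableEq (A i)]
    (x y : g.State) : ℝ≥0∞ :=
  resistance (fun ε => g.transition ε x y)

/-! ## Aligned, equilibrium and optimal states

All these states are all-content, hence given by their benchmark actions and bins. -/

/-- Benchmark actions and benchmark bins. -/
abbrev Bench : Type _ := (∀ i, A i) × (I → g.Bin)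

/-- The all-content state with given benchmarks. -/
def content (b : g.Bench) : g.State := fun i => .cont (b.1 i) (b.2 i)

/-- Strongly aligned states `𝒞`. -/
def strongAligned : Set g.Bench := {b | ∀ i, g.N i b.1 = b.2 i}

/-- Weakly aligned states `𝒞_δ`. -/
def weakAligned : Set g.Bench :=
  {b | ∀ i, g.Near (g.N i b.1) (b.2 i) ∧
    ((¬ ∃ c, g.law i b.1 = Measure.dirac c) → g.M i b.1 ≠ g.low (b.2 i) - g.δ)}

/-- Strongly aligned equilibrium states `ℰ`. -/
def strongEq [DecidableEq I] : Set g.Bench :=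
  {b | b ∈ g.strongAligned ∧
    ∀ i, ∀ c, c ≠ b.1 i → (g.N i (Function.update b.1 i c) : ℕ) ≤ b.2 i}

/-- Weakly aligned `δ`-equilibrium states `ℰ_δ`. -/
def weakEq [DecidableEq I] : Set g.Bench :=
  {b | b ∈ g.weakAligned ∧
    ∀ i, ∀ c, c ≠ b.1 i → (g.N i (Function.update b.1 i c) : ℕ) ≤ b.2 i + 1}

/-- Weakly aligned optimal states `𝒜_δ`: every benchmark bin is `{1}`. -/
def weakOpt : Set g.Bench := {b | b ∈ g.weakAligned ∧ ∀ i, (b.2 i : ℕ) = g.m}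

/-- Noise resistance. -/
def noise (b : g.Bench) : ℝ≥0∞ :=
  ⨅ (i : I) (v : g.Bin) (_ : ¬ g.Near v (b.2 i)), g.obsResistance i b.1 v

/-- Optimal states with infinite noise resistance `𝒜`. -/
def absorbingOpt : Set g.Bench := {b | b ∈ g.weakOpt ∧ g.noise b = ⊤}

/-- Virtual welfare. -/
def vW [Fintype I] (b : g.Bench) : ℝ := 1 - ∑ i, g.F (g.low (b.2 i))

/-- Upper virtual stability (meaningful when `b` is not an equilibrium). -/
def vSplus [DecidableEq I] (b : g.Bench) : ℝ :=
  1 - sInf {t | ∃ i, ∃ c : A i, c ≠ b.1 i ∧ (b.2 i : ℕ) + 1 ≤ g.N i (Function.update b.1 i c) ∧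
    t = g.G (g.low (b.2 i)) (g.low (g.N i (Function.update b.1 i c)) + g.δ)}

/-- Lower virtual stability (meaningful when `b` is not a `δ`-equilibrium). -/
def vSminus [DecidableEq I] (b : g.Bench) : ℝ :=
  1 - sInf {t | ∃ i, ∃ c : A i, c ≠ b.1 i ∧ (b.2 i : ℕ) + 2 ≤ g.N i (Function.update b.1 i c) ∧
    t = g.G (g.low (b.2 i)) (g.low (g.N i (Function.update b.1 i c)))}

/-! ## Assumptions -/

/-- `3δ`-interdependence. -/
def Interdependent3 [Fintype I] [DecidableEq I] : Prop :=
  ∀ (a : ∀ i, A i) (J : Finset I), J.Nonempty → J ≠ Finset.univ →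
    ∃ i ∉ J, ∃ a' : ∀ i, A i, 3 * g.δ ≤ |g.M i (J.piecewise a' a) - g.M i a|

/-- Bounds on the resistance functions. -/
def BoundsFG [Fintype I] : Prop :=
  ∃ F₀ G₀ : ℝ,
    (∀ u ∈ Set.Icc (0 : ℝ) 1, 0 ≤ g.F u ∧ g.F u ≤ F₀ / (Fintype.card I : ℝ)) ∧
    (∀ w ∈ Set.Icc (0 : ℝ) 1, ∀ u ∈ Set.Icc (0 : ℝ) 1, w < u → 0 ≤ g.G w u ∧ g.G w u < G₀) ∧
    F₀ + G₀ ≤ 1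

/-- Noise control. -/
def NoiseControl : Prop := 1 ≤ 2 * g.τ₀ * g.δ ^ 2

end Ritel

end

/-! ## Calculus of resistances -/

/-! The proof is a Freidlin–Wentzell tree computation in which only two quantities survive: the cost
`∑ F` of creating a benchmark and the cost of destroying it.

Resistances first. A bin is an interval, so the probability that an average falls into it is
supermultiplicative in the number of samples. By Fekete (`exists_exponential_rate`) it has an
exponential rate unless it vanishes, and `⌈τ₀ log (1/ε)⌉` samples turn the rate into a power of `ε`.
Every factor of a transition is then almost regular, and a transition costs the minimum, over
actions and observations, of a sum of one-agent costs. The bin of the mean is observed for free; by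
Hoeffding and `2τ₀δ² ≥ 1`, a bin not adjacent to it costs at least 1.

Call the states with benchmarks `b` and no discontent agent the basin of `b`, and let `escape b` be
the least resistance of a path from `content b` out of it. Leaving a basin raises a benchmark bin or
makes an agent discontent, so the sum of the levels drops.

Upper bound (`potential_content_le`): if `b₀` is strongly aligned, build a tree rooted at `content
b₀` by sending the all-discontent state directly to the root at cost `∑ F`, each other weakly
aligned content state along an escape path, and every other state along a zero-resistance path of
decreasing rank. Such paths exist by interdependence and by the definition of weak alignment.

Lower bound (`le_potential`): in any tree the edges starting in a basin that misses the root cost at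
least its escape. The sum of `F` over the current benchmarks never rises along an edge that starts
in a basin, and elsewhere rises by at most the resistance; the tree path from the all-discontent
state to the root thus pays the `∑ F` of the root outside these basins.

Hence a minimiser `content b` satisfies `∑ F(b) + escape b₀ ≤ ∑ F(b₀) + escape b`
(`totalPot_add_escape_le`). The theorem follows from estimates of `escape`: at least 2 at a strong
equilibrium, at least `2 - S₊` at other strongly aligned states, at most 2 below the optimum, and at
most `1 + G` when a deviation gains two bins. -/

theorem exists_add_of_coe_lt_add {r s : ℝ≥0∞} {t : ℝ} (h : (t : EReal) < ((r + s : ℝ≥0∞) : EReal)) :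
    ∃ t₁ t₂ : ℝ, t = t₁ + t₂ ∧ (t₁ : EReal) < (r : EReal) ∧ (t₂ : EReal) < (s : EReal) := by
  induction r with
  | top =>
    refine ⟨t + 1, -1, by ring, EReal.coe_lt_top _, ?_⟩
    exact lt_of_lt_of_le (by norm_cast) (EReal.coe_ennreal_nonneg s)
  | coe r =>
    induction s with
    | top =>
      refine ⟨-1, t + 1, by ring, ?_, EReal.coe_lt_top _⟩
      exact lt_of_lt_of_le (by norm_cast) (EReal.coe_ennreal_nonneg _)
    | coe s =>
      have h' : t < r + s := by
        have : (((r : ℝ≥0∞) + s : ℝ≥0∞) : EReal) = ((r + s : ℝ) : EReal) := by norm_cast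
        rw [this] at h
        exact_mod_cast h
      have e1 : ∀ q : NNReal, ((q : ℝ≥0∞) : EReal) = ((q : ℝ) : EReal) := fun _ => rfl
      refine ⟨r - (r + s - t) / 2, s - (r + s - t) / 2, by ring, ?_, ?_⟩ <;> rw [e1] <;>
        refine EReal.coe_lt_coe_iff.2 ?_ <;> linarith

theorem exists_add_of_add_lt_coe {r s : ℝ≥0∞} {t : ℝ} (h : ((r + s : ℝ≥0∞) : EReal) < (t : EReal)) :
    ∃ t₁ t₂ : ℝ, t = t₁ + t₂ ∧ (r : EReal) < (t₁ : EReal) ∧ (s : EReal) < (t₂ : EReal) := by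
  induction r with
  | top => simp at h
  | coe r =>
    induction s with
    | top => simp at h
    | coe s =>
      have h' : (r + s : ℝ) < t := by
        have : (((r : ℝ≥0∞) + s : ℝ≥0∞) : EReal) = ((r + s : ℝ) : EReal) := by norm_cast
        rw [this] at h
        exact_mod_cast h
      have e1 : ∀ q : NNReal, ((q : ℝ≥0∞) : EReal) = ((q : ℝ) : EReal) := fun _ => rfl
      refine ⟨r + (t - r - s) / 2, s + (t - r - s) / 2, by ring, ?_, ?_⟩ <;> rw [e1] <;>
        refine EReal.coe_lt_coe_iff.2 ?_ <;> linarith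

theorem eventually_pos_nhdsGT_zero : ∀ᶠ ε : ℝ in 𝓝[>] 0, 0 < ε :=
  eventually_mem_nhdsWithin

theorem eventually_lt_one_nhdsGT_zero : ∀ᶠ ε : ℝ in 𝓝[>] 0, ε < 1 :=
  eventually_nhdsWithin_of_eventually_nhds (gt_mem_nhds one_pos)

theorem tendsto_rpow_nhdsGT_zero {p : ℝ} (hp : 0 < p) :
    Tendsto (fun ε : ℝ => ε ^ p) (𝓝[>] 0) (𝓝 0) := by
  have := (Real.continuousAt_rpow_const 0 p (Or.inr hp.le)).tendsto
  rw [Real.zero_rpow hp.ne'] at this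
  exact this.mono_left nhdsWithin_le_nhds

namespace HasResistance

variable {X Y : ℝ → ℝ} {r s : ℝ≥0∞}

theorem resistance_eq (hX : HasResistance X r) : resistance X = r := by
  have h : AlmostRegular X := ⟨r, hX⟩
  rw [resistance, dif_pos h]
  exact h.choose_spec.unique hX

theorem of_eventually_eq_zero (h : ∀ᶠ ε in 𝓝[>] 0, X ε = 0) : HasResistance X ⊤ := by
  refine ⟨fun t _ => ?_, fun t ht => absurd ht (by simp)⟩
  exact tendsto_const_nhds.congr' (h.mono fun ε e => by simp [e])

theorem add (hX : HasResistance X r) (hY : HasResistance Y s)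
    (hX0 : ∀ᶠ ε in 𝓝[>] 0, 0 ≤ X ε) (hY0 : ∀ᶠ ε in 𝓝[>] 0, 0 ≤ Y ε) :
    HasResistance (fun ε => X ε + Y ε) (min r s) := by
  refine ⟨fun t ht => ?_, fun t ht => ?_⟩
  · have h1 := hX.1 t (ht.trans_le (EReal.coe_ennreal_le_coe_ennreal_iff.2 (min_le_left _ _)))
    have h2 := hY.1 t (ht.trans_le (EReal.coe_ennreal_le_coe_ennreal_iff.2 (min_le_right _ _)))
    simpa [mul_add] using h1.add h2
  · rcases min_choice r s with h | h <;> rw [h] at ht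
    · refine tendsto_atTop_mono' _ ?_ (hX.2 t ht)
      filter_upwards [hY0, eventually_pos_nhdsGT_zero] with ε h0 hε
      have := Real.rpow_pos_of_pos hε (-t)
      nlinarith [mul_nonneg this.le h0]
    · refine tendsto_atTop_mono' _ ?_ (hY.2 t ht)
      filter_upwards [hX0, eventually_pos_nhdsGT_zero] with ε h0 hε
      have := Real.rpow_pos_of_pos hε (-t)
      nlinarith [mul_nonneg this.le h0]

theorem mul (hX : HasResistance X r) (hY : HasResistance Y s) :
    HasResistance (fun ε => X ε * Y ε) (r + s) := by
  have key : ∀ t₁ t₂ : ℝ, (fun ε => (ε ^ (-t₁) * X ε) * (ε ^ (-t₂) * Y ε)) =ᶠ[𝓝[>] 0]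
      fun ε => ε ^ (-(t₁ + t₂)) * (X ε * Y ε) := by
    intro t₁ t₂
    filter_upwards [eventually_pos_nhdsGT_zero] with ε hε
    rw [neg_add, Real.rpow_add hε]
    ring
  refine ⟨fun t ht => ?_, fun t ht => ?_⟩
  · obtain ⟨t₁, t₂, rfl, h1, h2⟩ := exists_add_of_coe_lt_add ht
    simpa using ((hX.1 t₁ h1).mul (hY.1 t₂ h2)).congr' (key t₁ t₂)
  · obtain ⟨t₁, t₂, rfl, h1, h2⟩ := exists_add_of_add_lt_coe ht
    exact ((hX.2 t₁ h1).atTop_mul_atTop₀ (hY.2 t₂ h2)).congr' (key t₁ t₂)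

theorem of_le_of_le (hX : HasResistance X r) {c C : ℝ} (hc : 0 < c)
    (hX0 : ∀ᶠ ε in 𝓝[>] 0, 0 ≤ X ε)
    (h1 : ∀ᶠ ε in 𝓝[>] 0, c * X ε ≤ Y ε) (h2 : ∀ᶠ ε in 𝓝[>] 0, Y ε ≤ C * X ε) :
    HasResistance Y r := by
  refine ⟨fun t ht => ?_, fun t ht => ?_⟩
  · have h := (hX.1 t ht).const_mul C
    rw [mul_zero] at h
    refine tendsto_of_tendsto_of_tendsto_of_le_of_le' tendsto_const_nhds h ?_ ?_
    · filter_upwards [h1, hX0, eventually_pos_nhdsGT_zero] with ε e1 e0 hε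
      exact mul_nonneg (Real.rpow_nonneg hε.le _) ((mul_nonneg hc.le e0).trans e1)
    · filter_upwards [h2, eventually_pos_nhdsGT_zero] with ε e2 hε
      nlinarith [mul_le_mul_of_nonneg_left e2 (Real.rpow_nonneg hε.le (-t))]
  · refine tendsto_atTop_mono' _ ?_ ((hX.2 t ht).const_mul_atTop hc)
    filter_upwards [h1, eventually_pos_nhdsGT_zero] with ε e1 hε
    nlinarith [mul_le_mul_of_nonneg_left e1 (Real.rpow_nonneg hε.le (-t))]

theorem rpow {p : ℝ} (hp : 0 ≤ p) : HasResistance (fun ε => ε ^ p) (ENNReal.ofReal p) := by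
  have e : ((ENNReal.ofReal p : ℝ≥0∞) : EReal) = (p : EReal) := by
    rw [EReal.coe_ennreal_ofReal, max_eq_left hp]
  have key : ∀ t : ℝ, (fun ε : ℝ => ε ^ (p - t)) =ᶠ[𝓝[>] 0] fun ε => ε ^ (-t) * ε ^ p := by
    intro t
    filter_upwards [eventually_pos_nhdsGT_zero] with ε hε
    rw [← Real.rpow_add hε]
    ring_nf
  rw [HasResistance, e]
  refine ⟨fun t ht => ?_, fun t ht => ?_⟩
  · exact (tendsto_rpow_nhdsGT_zero (sub_pos.2 (EReal.coe_lt_coe_iff.1 ht))).congr' (key t)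
  · exact (tendsto_rpow_neg_nhdsGT_zero (sub_neg.2 (EReal.coe_lt_coe_iff.1 ht))).congr' (key t)

theorem one : HasResistance (fun _ => 1) 0 := by
  simpa using rpow (le_refl (0 : ℝ))

theorem zero_of_mem_Icc {c C : ℝ} (hc : 0 < c) (h : ∀ᶠ ε in 𝓝[>] 0, c ≤ X ε ∧ X ε ≤ C) :
    HasResistance X 0 :=
  one.of_le_of_le hc (by simp) (by simpa using h.mono fun _ => And.left)
    (by simpa using h.mono fun _ => And.right)

theorem sum {ι : Type*} (t : Finset ι) {X : ι → ℝ → ℝ} {r : ι → ℝ≥0∞}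
    (hX : ∀ i ∈ t, HasResistance (X i) (r i)) (h0 : ∀ i ∈ t, ∀ᶠ ε in 𝓝[>] 0, 0 ≤ X i ε) :
    HasResistance (fun ε => ∑ i ∈ t, X i ε) (t.inf r) := by
  classical
  induction t using Finset.induction_on with
  | empty => exact of_eventually_eq_zero (by simp)
  | insert i t hi ih =>
    simp only [Finset.sum_insert hi, Finset.inf_insert]
    refine (hX i (by simp)).add (ih (fun j hj => hX j (by simp [hj]))
      (fun j hj => h0 j (by simp [hj]))) (h0 i (by simp)) ?_
    have : ∀ᶠ ε in 𝓝[>] 0, ∀ j ∈ t, 0 ≤ X j ε :=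
      (eventually_all_finset t).2 fun j hj => h0 j (by simp [hj])
    exact this.mono fun ε h => Finset.sum_nonneg h

theorem prod {ι : Type*} (t : Finset ι) {X : ι → ℝ → ℝ} {r : ι → ℝ≥0∞}
    (hX : ∀ i ∈ t, HasResistance (X i) (r i)) :
    HasResistance (fun ε => ∏ i ∈ t, X i ε) (∑ i ∈ t, r i) := by
  classical
  induction t using Finset.induction_on with
  | empty => simpa using one
  | insert i t hi ih =>
    simp only [Finset.prod_insert hi, Finset.sum_insert hi]
    exact (hX i (by simp)).mul (ih fun j hj => hX j (by simp [hj]))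

theorem ofReal_le (hX : HasResistance X r) {p : ℝ} (hp : 0 ≤ p)
    (h : ∀ᶠ ε in 𝓝[>] 0, X ε ≤ ε ^ p) : ENNReal.ofReal p ≤ r := by
  by_contra! hlt
  obtain ⟨q, h1, h2⟩ := EReal.lt_iff_exists_real_btwn.1 (EReal.coe_ennreal_lt_coe_ennreal_iff.2 hlt)
  refine not_tendsto_nhds_of_tendsto_atTop (tendsto_atTop_mono' _ ?_ (hX.2 q h1)) 0
    ((rpow hp).1 q h2)
  filter_upwards [h, eventually_pos_nhdsGT_zero] with ε e hε
  exact mul_le_mul_of_nonneg_left e (Real.rpow_nonneg hε.le _)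

/-- Dominating every positive power of `ε` suffices, so factors of order `1 / log (1/ε)` are
harmless. -/
theorem eq_zero (hX : HasResistance X r)
    (h : ∀ q : ℝ, 0 < q → ∀ᶠ ε in 𝓝[>] 0, ε ^ q ≤ X ε) : r = 0 := by
  by_contra h0
  obtain ⟨q, h1, h2⟩ := EReal.lt_iff_exists_real_btwn.1
    (EReal.coe_ennreal_lt_coe_ennreal_iff.2 (pos_iff_ne_zero.2 h0))
  have hq : 0 < q := by simpa using h1
  have h3 := hX.1 q h2
  refine absurd (le_of_tendsto_of_tendsto tendsto_const_nhds h3 (f := fun _ => (1 : ℝ)) ?_)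
    (by norm_num)
  filter_upwards [h q hq, eventually_pos_nhdsGT_zero] with ε e hε
  calc (1 : ℝ) = ε ^ (-q) * ε ^ q := by rw [← Real.rpow_add hε]; simp
    _ ≤ _ := mul_le_mul_of_nonneg_left e (Real.rpow_nonneg hε.le _)

end HasResistance

/-! ## Rooted trees and potentials -/

section Trees

variable {X : Type*} {r : X → X → ℝ≥0∞}

/-- A tree becomes a parent map with a strictly decreasing height, here the number of vertices
reachable from `y`. This form allows induction along the path to the root and local surgery. -/
theorem IsRootedTree.exists_parent [Fintype X] [DecidableEq X] {x : X} {T : Finset (X × X)}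
    (hT : IsRootedTree r x T) :
    ∃ (f : X → X) (h : X → ℕ), (∀ y, y ≠ x → h (f y) < h y) ∧ (∀ y, y ≠ x → r y (f y) ≠ ⊤) ∧
      ∑ e ∈ T, r e.1 e.2 = ∑ y ∈ Finset.univ.erase x, r y (f y) := by
  classical
  have hex : ∀ y, ∃ z, y ≠ x → (y, z) ∈ T := fun y => by
    by_cases hy : y = x
    · exact ⟨y, fun h => absurd hy h⟩
    · obtain ⟨z, hz, -⟩ := hT.out y hy
      exact ⟨z, fun _ => hz⟩
  choose f hf using hex
  refine ⟨f, fun y => (Finset.univ.filter fun u =>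
    Relation.TransGen (fun u v => (u, v) ∈ T) y u).card, fun y hy => ?_,
    fun y hy => hT.finite_resistance _ (hf y hy), ?_⟩
  · refine Finset.card_lt_card ⟨fun u hu => ?_, fun hsub => ?_⟩
    · simp only [Finset.mem_filter, Finset.mem_univ, true_and] at hu ⊢
      exact Relation.TransGen.head (hf y hy) hu
    · have : f y ∈ Finset.univ.filter fun u => Relation.TransGen (fun u v => (u, v) ∈ T) y u := by
        simpa using Relation.TransGen.single (r := fun u v => (u, v) ∈ T) (hf y hy)
      have := hsub this
      simp only [Finset.mem_filter, Finset.mem_univ, true_and] at this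
      exact hT.acyclic _ this
  · refine (Finset.sum_bij' (fun y _ => (y, f y)) (fun e _ => e.1) ?_ ?_ ?_ ?_ ?_).symm
    · intro y hy
      exact hf y (Finset.ne_of_mem_erase hy)
    · rintro ⟨y, z⟩ he
      simp only [Finset.mem_erase, Finset.mem_univ, and_true]
      rintro rfl
      exact hT.root _ he
    · intro y _
      rfl
    · rintro ⟨y, z⟩ he
      have hy : y ≠ x := by
        rintro rfl
        exact hT.root _ he
      exact Prod.ext rfl ((hT.out y hy).unique (hf y hy) he)
    · intro y _
      rfl

theorem potential_le_of_parent [Fintype X] [DecidableEq X] {x : X} (f : X → X) (h : X → ℕ)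
    (hf : ∀ y, y ≠ x → h (f y) < h y) :
    potential r x ≤ ∑ y ∈ Finset.univ.erase x, r y (f y) := by
  -- With an infinite edge the parent map does not define a tree, but the bound is then trivial.
  by_cases htop : ∃ y ∈ Finset.univ.erase x, r y (f y) = ⊤
  · obtain ⟨y, hy, e⟩ := htop
    rw [ENNReal.sum_eq_top.2 ⟨y, hy, e⟩]
    exact le_top
  push Not at htop
  have hmem : ∀ y z, (y, z) ∈ (Finset.univ.erase x).image (fun y => (y, f y)) ↔ y ≠ x ∧ z = f y := by
    intro y z
    simp only [Finset.mem_image, Finset.mem_erase, Finset.mem_univ, and_true, Prod.mk.injEq]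
    constructor
    · rintro ⟨u, hu, rfl, rfl⟩
      exact ⟨hu, rfl⟩
    · rintro ⟨hy, rfl⟩
      exact ⟨y, hy, rfl, rfl⟩
  have htree : IsRootedTree r x ((Finset.univ.erase x).image fun y => (y, f y)) := by
    refine ⟨?_, fun y hy => ⟨f y, (hmem _ _).2 ⟨hy, rfl⟩, fun z hz => ((hmem _ _).1 hz).2⟩,
      fun z hz => ((hmem _ _).1 hz).1 rfl, fun y hy => ?_⟩
    · rintro ⟨y, z⟩ he
      obtain ⟨hy, rfl⟩ := (hmem _ _).1 he
      exact htop y (by simpa using hy)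
    · have : ∀ u v, Relation.TransGen (fun u v => (u, v) ∈
          (Finset.univ.erase x).image fun y => (y, f y)) u v → h v < h u := by
        intro u v huv
        induction huv with
        | single e =>
          obtain ⟨h1, rfl⟩ := (hmem _ _).1 e
          exact hf _ h1
        | tail _ e ih =>
          obtain ⟨h1, rfl⟩ := (hmem _ _).1 e
          exact (hf _ h1).trans ih
      exact lt_irrefl _ (this y y hy)
  refine (iInf₂_le _ htree).trans (le_of_eq ?_)
  exact Finset.sum_image fun a _ b _ hab => (Prod.ext_iff.1 hab).1

/-- `PathCost r S y c`: some path from `y` to the set `S` has total resistance `c`. -/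
inductive PathCost (r : X → X → ℝ≥0∞) (S : Set X) : X → ℝ≥0∞ → Prop
  | nil {y : X} : y ∈ S → PathCost r S y 0
  | cons {y z : X} {c : ℝ≥0∞} : PathCost r S z c → PathCost r S y (r y z + c)

theorem PathCost.mono {S S' : Set X} (hS : S ⊆ S') {y : X} {c : ℝ≥0∞} (h : PathCost r S y c) :
    PathCost r S' y c := by
  induction h with
  | nil h => exact .nil (hS h)
  | cons _ ih => exact .cons ih

theorem PathCost.single {S : Set X} {y z : X} (hz : z ∈ S) : PathCost r S y (r y z) := by
  simpa using PathCost.cons (r := r) (y := y) (PathCost.nil (r := r) hz)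

/-- A partial tree on `S`, rooted at `o`, of total resistance at most `c`. -/
def PartialTree [DecidableEq X] (r : X → X → ℝ≥0∞) (o : X) (S : Finset X) (c : ℝ≥0∞) : Prop :=
  o ∈ S ∧ ∃ (f : X → X) (h : X → ℕ), (∀ y ∈ S, y ≠ o → f y ∈ S ∧ h (f y) < h y) ∧
    ∑ y ∈ S.erase o, r y (f y) ≤ c

/-- Grow the tree backwards along the path, skipping each vertex already attached; the edges added
are among those of the path. -/
theorem PartialTree.extend [DecidableEq X] {o : X} {S : Finset X} {c q : ℝ≥0∞} {y : X}
    (hS : PartialTree r o S c) (hp : PathCost r (S : Set X) y q) :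
    ∃ S', S ⊆ S' ∧ y ∈ S' ∧ PartialTree r o S' (c + q) := by
  induction hp with
  | nil h => exact ⟨S, subset_rfl, h, by simpa using hS⟩
  | @cons y z q _ ih =>
    obtain ⟨S', hSS, hz, ho, f, h, hf, hc⟩ := ih
    by_cases hy : y ∈ S'
    · refine ⟨S', hSS, hy, ho, f, h, hf, hc.trans ?_⟩
      gcongr
      exact le_add_self
    have hyo : y ≠ o := fun e => hy (e ▸ ho)
    have hne : ∀ u ∈ S', u ≠ y := fun u hu e => hy (e ▸ hu)
    refine ⟨insert y S', hSS.trans (Finset.subset_insert _ _), Finset.mem_insert_self _ _,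
      Finset.mem_insert_of_mem ho, Function.update f y z, Function.update h y (h z + 1), ?_, ?_⟩
    · intro u hu huo
      rcases Finset.mem_insert.1 hu with rfl | hu
      · rw [Function.update_self, Function.update_self, Function.update_of_ne (hne z hz)]
        exact ⟨Finset.mem_insert_of_mem hz, Nat.lt_succ_self _⟩
      · obtain ⟨h1, h2⟩ := hf u hu huo
        rw [Function.update_of_ne (hne u hu), Function.update_of_ne (hne u hu),
          Function.update_of_ne (hne _ h1)]
        exact ⟨Finset.mem_insert_of_mem h1, h2⟩
    · rw [Finset.erase_insert_of_ne hyo,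
        Finset.sum_insert (fun h => hy (Finset.mem_of_mem_erase h)), Function.update_self]
      rw [Finset.sum_congr rfl fun u hu => by
        rw [Function.update_of_ne (hne u (Finset.mem_of_mem_erase hu))]]
      calc r y z + _ ≤ r y z + (c + q) := by gcongr
        _ = c + (r y z + q) := by ring

/-- Attach the vertices in order of increasing rank. The path of `y` ends at the root or at a vertex
of smaller rank, hence in the tree already built, and adds at most `w y` to its cost. -/
theorem potential_le_sum_of_path [Fintype X] [DecidableEq X] (o : X) (rk : X → ℕ) (w : X → ℝ≥0∞)
    (hw : ∀ y, y ≠ o → ∃ c ≤ w y, PathCost r {u | u = o ∨ rk u < rk y} y c) :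
    potential r o ≤ ∑ y ∈ Finset.univ.erase o, w y := by
  have key : ∀ n : ℕ, ∃ S : Finset X, (∀ u, rk u < n → u ∈ S) ∧
      PartialTree r o S (∑ y ∈ (Finset.univ.erase o).filter (fun y => rk y < n), w y) := by
    intro n
    induction n with
    | zero =>
      refine ⟨{o}, by simp, by simp, id, fun _ => 0, ?_, by simp⟩
      intro y hy hyo
      exact absurd (Finset.mem_singleton.1 hy) hyo
    | succ n ih =>
      obtain ⟨S, hS, hT⟩ := ih
      have step : ∀ U : Finset X, (∀ u ∈ U, rk u = n ∧ u ≠ o) → ∃ S' : Finset X, S ⊆ S' ∧ U ⊆ S' ∧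
          PartialTree r o S' ((∑ y ∈ (Finset.univ.erase o).filter (fun y => rk y < n), w y) +
            ∑ y ∈ U, w y) := by
        intro U
        induction U using Finset.induction_on with
        | empty => exact fun _ => ⟨S, subset_rfl, by simp, by simpa using hT⟩
        | insert u U hu ihU =>
          intro hU
          obtain ⟨S', h1, h2, h3⟩ := ihU fun v hv => hU v (Finset.mem_insert_of_mem hv)
          obtain ⟨hun, huo⟩ := hU u (Finset.mem_insert_self _ _)
          obtain ⟨c, hc, hp⟩ := hw u huo
          obtain ⟨S'', h4, h5, ho, f, h, hf, hc'⟩ := h3.extend (hp.mono (S' := S') (by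
            rintro v (rfl | hv)
            · exact h3.1
            · exact h1 (hS v (hun ▸ hv))))
          refine ⟨S'', h1.trans h4, Finset.insert_subset h5 (h2.trans h4), ho, f, h, hf,
            hc'.trans ?_⟩
          rw [Finset.sum_insert hu, add_comm (w u), ← add_assoc]
          gcongr
      obtain ⟨S', h1, h2, h3⟩ := step ((Finset.univ.erase o).filter fun y => rk y = n) (by
        intro u hu
        simp only [Finset.mem_filter, Finset.mem_erase, Finset.mem_univ, and_true] at hu
        exact ⟨hu.2, hu.1⟩)
      refine ⟨S', fun u hu => ?_, ?_⟩
      · rcases Nat.lt_succ_iff_lt_or_eq.1 hu with hlt | heq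
        · exact h1 (hS u hlt)
        · by_cases huo : u = o
          · exact huo ▸ h3.1
          · exact h2 (by simp [heq, huo])
      · rw [← Finset.sum_union] at h3
        · convert h3 using 2
          ext u
          simp only [Finset.mem_filter, Finset.mem_union, Nat.lt_succ_iff_lt_or_eq]
          tauto
        · exact Finset.disjoint_filter.2 fun u _ h h' => by omega
  obtain ⟨S, hS, -, f, h, hf, hc⟩ := key (Finset.univ.sup rk + 1)
  have hSu : ∀ u, u ∈ S := fun u => hS u (Nat.lt_succ_of_le (Finset.le_sup (Finset.mem_univ u)))
  have : S = Finset.univ := Finset.eq_univ_of_forall hSu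
  subst this
  refine (potential_le_of_parent f h fun y hy => (hf y (hSu y) hy).2).trans (hc.trans ?_)
  exact Finset.sum_le_sum_of_subset (Finset.filter_subset _ _)

/-- The minimal resistance of a path from `y` to `S`. -/
noncomputable def distTo (r : X → X → ℝ≥0∞) (S : Set X) (y : X) : ℝ≥0∞ := sInf {c | PathCost r S y c}

theorem distTo_le {S : Set X} {y : X} {c : ℝ≥0∞} (h : PathCost r S y c) : distTo r S y ≤ c :=
  sInf_le h

theorem distTo_of_mem {S : Set X} {y : X} (h : y ∈ S) : distTo r S y = 0 :=
  le_antisymm (distTo_le (.nil h)) bot_le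

theorem exists_pathCost_le {S : Set X} {y : X} (h : distTo r S y ≠ ⊤) {η : ℝ≥0∞} (hη : η ≠ 0) :
    ∃ c ≤ distTo r S y + η, PathCost r S y c := by
  obtain ⟨c, hc, hlt⟩ := sInf_lt_iff.1 (ENNReal.lt_add_right h hη)
  exact ⟨c, hlt.le, hc⟩

theorem distTo_le_add {S : Set X} (y z : X) : distTo r S y ≤ r y z + distTo r S z := by
  by_cases h : distTo r S z = ⊤
  · simp [h]
  refine ENNReal.le_of_forall_pos_le_add fun η hη _ => ?_
  obtain ⟨c, hc, hp⟩ := exists_pathCost_le h (η := η) (by simpa using hη.ne')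
  calc distTo r S y ≤ r y z + c := distTo_le (.cons hp)
    _ ≤ r y z + (distTo r S z + η) := by gcongr
    _ = _ := by ring

/-- Weak duality for shortest paths: the decrease of `ψ` along an edge is paid by its resistance. -/
theorem le_distTo {S : Set X} {ψ : X → ℝ≥0∞} (h0 : ∀ y ∈ S, ψ y = 0)
    (h : ∀ y ∉ S, ∀ z, ψ y ≤ r y z + ψ z) (y : X) : ψ y ≤ distTo r S y := by
  refine le_sInf fun c hc => ?_
  induction hc with
  | nil hy => rw [h0 _ hy]
  | @cons y z c _ ih =>
    by_cases hy : y ∈ S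
    · rw [h0 _ hy]
      exact bot_le
    · exact (h y hy z).trans (by gcongr)

/-- The tree path from `y` to `x ∉ B` must leave `B`, and until then it uses distinct edges starting
in `B`. -/
theorem distTo_compl_le_sum [DecidableEq X] {x : X} {f : X → X} {h : X → ℕ}
    (hf : ∀ y, y ≠ x → h (f y) < h y) {B : Finset X} (hx : x ∉ B) (y : X) :
    distTo r (B : Set X)ᶜ y ≤ ∑ u ∈ B, r u (f u) := by
  suffices H : ∀ n y, h y = n → distTo r (B : Set X)ᶜ y ≤ ∑ u ∈ B.filter (fun u => h u ≤ n), r u (f u)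
    from (H _ y rfl).trans (Finset.sum_le_sum_of_subset (Finset.filter_subset _ _))
  intro n
  induction n using Nat.strong_induction_on with
  | _ n ih =>
    rintro y rfl
    by_cases hy : y ∈ B
    · have hlt := hf y fun e => hx (e ▸ hy)
      calc distTo r (B : Set X)ᶜ y ≤ r y (f y) + distTo r (B : Set X)ᶜ (f y) := distTo_le_add _ _
        _ ≤ r y (f y) + ∑ u ∈ B.filter (fun u => h u ≤ h (f y)), r u (f u) := by
            gcongr
            exact ih _ hlt _ rfl
        _ = ∑ u ∈ insert y (B.filter (fun u => h u ≤ h (f y))), r u (f u) := by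
            rw [Finset.sum_insert]
            simp [hlt]
        _ ≤ _ := by
            refine Finset.sum_le_sum_of_subset fun u hu => ?_
            rcases Finset.mem_insert.1 hu with rfl | hu
            · simp [hy]
            · rw [Finset.mem_filter] at hu ⊢
              exact ⟨hu.1, hu.2.trans hlt.le⟩
    · rw [distTo_of_mem (by simpa using hy)]
      exact bot_le

/-- Along the tree path from `y` to the root, `φ` can rise only at vertices of `V`, by at most the
resistance of the edge used there. -/
theorem le_add_sum_of_parent [DecidableEq X] {x : X} {f : X → X} {h : X → ℕ}
    (hf : ∀ y, y ≠ x → h (f y) < h y) {V : Finset X} {φ : X → ℝ≥0∞}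
    (hV : ∀ y ∈ V, φ (f y) ≤ φ y + r y (f y))
    (hV' : ∀ y, y ∉ V → y ≠ x → φ (f y) ≤ φ y) (y : X) :
    φ x ≤ φ y + ∑ u ∈ V, r u (f u) := by
  suffices H : ∀ n y, h y = n → φ x ≤ φ y + ∑ u ∈ V.filter (fun u => h u ≤ n), r u (f u) by
    refine (H _ y rfl).trans ?_
    gcongr
    exact Finset.filter_subset _ _
  intro n
  induction n using Nat.strong_induction_on with
  | _ n ih =>
    rintro y rfl
    by_cases hyx : y = x
    · rw [hyx]
      exact le_self_add
    have hlt := hf y hyx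
    have h1 := ih _ hlt _ rfl
    by_cases hy : y ∈ V
    · calc φ x ≤ φ (f y) + ∑ u ∈ V.filter (fun u => h u ≤ h (f y)), r u (f u) := h1
        _ ≤ φ y + r y (f y) + ∑ u ∈ V.filter (fun u => h u ≤ h (f y)), r u (f u) := by
            gcongr
            exact hV y hy
        _ = φ y + ∑ u ∈ insert y (V.filter (fun u => h u ≤ h (f y))), r u (f u) := by
            rw [Finset.sum_insert, add_assoc]
            simp [hlt]
        _ ≤ _ := by
            gcongr
            intro u hu
            rcases Finset.mem_insert.1 hu with rfl | hu
            · simp [hy]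
            · rw [Finset.mem_filter] at hu ⊢
              exact ⟨hu.1, hu.2.trans hlt.le⟩
    · refine h1.trans ?_
      gcongr 2
      · exact hV' y hy hyx
      · intro u hu
        rw [Finset.mem_filter] at hu ⊢
        exact ⟨hu.1, hu.2.trans hlt.le⟩

/-- The edges of a tree are split by their starting point. Those starting in `B k` pay for an exit
from `B k`; the remaining ones pay for the whole increase of `φ` from `o` to `x`, since `φ` does not
increase on edges starting in some `B k`. No edge is charged twice. -/
theorem add_sum_distTo_le_potential [Fintype X] [DecidableEq X] {ι : Type*} (x o : X)
    (Z : Finset ι) (B : ι → Finset X) (z : ι → X)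
    (hB : (Z : Set ι).PairwiseDisjoint B) (hx : ∀ k ∈ Z, x ∉ B k) (φ : X → ℝ≥0∞) (ho : φ o = 0)
    (hφ : ∀ u v, φ v ≤ φ u + r u v)
    (hφB : ∀ k ∈ Z, ∀ u ∈ B k, ∀ v, r u v ≠ ⊤ → φ v ≤ φ u) :
    φ x + ∑ k ∈ Z, distTo r (B k : Set X)ᶜ (z k) ≤ potential r x := by
  refine le_iInf₂ fun T hT => ?_
  obtain ⟨f, h, hf, hfin, hsum⟩ := hT.exists_parent
  rw [hsum]
  have hU : Z.biUnion B ⊆ Finset.univ.erase x := by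
    intro u hu
    obtain ⟨k, hk, huk⟩ := Finset.mem_biUnion.1 hu
    simp only [Finset.mem_erase, Finset.mem_univ, and_true]
    rintro rfl
    exact hx k hk huk
  rw [← Finset.sum_sdiff hU, Finset.sum_biUnion hB]
  refine add_le_add ?_ (Finset.sum_le_sum fun k hk => distTo_compl_le_sum hf (hx k hk) _)
  have := le_add_sum_of_parent hf (r := r) (V := Finset.univ.erase x \ Z.biUnion B) (φ := φ)
    (fun y _ => hφ _ _) (fun y hy hyx => ?_) o
  · simpa [ho] using this
  · have : y ∈ Z.biUnion B := by
      by_contra hne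
      exact hy (by simp only [Finset.mem_sdiff, Finset.mem_erase, Finset.mem_univ]; tauto)
    obtain ⟨k, hk, huk⟩ := Finset.mem_biUnion.1 this
    exact hφB k hk y huk _ (hfin y hyx)

/-- Re-rooting: in a `y`-tree delete the edge out of `z`, which costs at least `q`, and add the free
edge from `y` to `z`. -/
theorem potential_add_le_potential [Fintype X] [DecidableEq X] {y z : X} (hyz : y ≠ z)
    (h0 : r y z = 0) {q : ℝ≥0∞} (hq : ∀ w, w ≠ z → q ≤ r z w) :
    potential r z + q ≤ potential r y := by
  refine le_iInf₂ fun T hT => ?_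
  obtain ⟨f, h, hf, -, hsum⟩ := hT.exists_parent
  rw [hsum]
  have hz : z ∈ Finset.univ.erase y := by simp [hyz.symm]
  have hfz : f z ≠ z := fun e => by
    have := hf z hyz.symm
    rw [e] at this
    exact lt_irrefl _ this
  rw [← Finset.sum_erase_add _ _ hz]
  refine add_le_add ?_ (hq _ hfz)
  refine (potential_le_of_parent (Function.update f y z)
    -- Vertices whose path met `z` now stop there, and those that reached `y` continue to `z`;
    -- placing `z` and `y` below all others keeps the heights decreasing.
    (fun u => if u = z then 0 else if u = y then 1 else h u + 2) ?_).trans ?_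
  · intro u hu
    by_cases huy : u = y
    · subst huy
      simp [hyz]
    · have := hf u huy
      simp only [Function.update_of_ne huy, hu, huy, if_false]
      split_ifs <;> omega
  · have hy : y ∈ Finset.univ.erase z := by simp [hyz]
    rw [← Finset.sum_erase_add _ _ hy, Function.update_self, h0, add_zero, Finset.erase_right_comm]
    refine le_of_eq (Finset.sum_congr rfl fun u hu => ?_)
    rw [Function.update_of_ne]
    rintro rfl
    simp at hu

end Trees

/-! ## Empirical means of i.i.d. samples -/

section Samples

open ProbabilityTheory

/-- Law of the sum of `t` i.i.d. samples of `μ`. -/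
noncomputable def sumLaw (μ : Measure ℝ) (t : ℕ) : Measure ℝ :=
  (Measure.pi fun _ : Fin t => μ).map fun u => ∑ k, u k

/-- Probability that the mean of `t` i.i.d. samples of `μ` lies in `J`. -/
noncomputable def avgProb (μ : Measure ℝ) (t : ℕ) (J : Set ℝ) : ℝ :=
  (Measure.pi fun _ : Fin t => μ).real {u | (∑ k, u k) / (t : ℝ) ∈ J}

variable {μ : Measure ℝ}

theorem avgProb_eq {t : ℕ} {J : Set ℝ} (hJ : MeasurableSet J) :
    avgProb μ t J = (sumLaw μ t).real {s | s / (t : ℝ) ∈ J} := by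
  have hm : MeasurableSet {s : ℝ | s / (t : ℝ) ∈ J} := measurableSet_preimage (by fun_prop) hJ
  rw [sumLaw, map_measureReal_apply (by fun_prop) hm]
  rfl

theorem avgProb_nonneg {t : ℕ} {J : Set ℝ} : 0 ≤ avgProb μ t J := measureReal_nonneg

variable [IsProbabilityMeasure μ]

instance (t : ℕ) : IsProbabilityMeasure (sumLaw μ t) :=
  Measure.isProbabilityMeasure_map (by fun_prop)

theorem sumLaw_zero : sumLaw μ 0 = Measure.dirac 0 := by
  simp [sumLaw]

theorem sumLaw_succ (t : ℕ) : sumLaw μ (t + 1) = μ ∗ sumLaw μ t := by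
  have h := measurePreserving_piFinSuccAbove (fun _ : Fin (t + 1) => μ) 0
  have e : (fun u : Fin (t + 1) → ℝ => ∑ k, u k) =
      ((fun x : ℝ × ℝ => x.1 + x.2) ∘ Prod.map id (fun u : Fin t → ℝ => ∑ k, u k)) ∘
        (MeasurableEquiv.piFinSuccAbove (fun _ : Fin (t + 1) => ℝ) 0) := by
    ext u
    simp [Fin.sum_univ_succ, MeasurableEquiv.piFinSuccAbove, Fin.tail]
  rw [sumLaw, e, ← Measure.map_map (by fun_prop) (by fun_prop), h.map_eq,
    ← Measure.map_map (by fun_prop) (by fun_prop), Measure.conv]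
  congr 1
  rw [← Measure.map_prod_map _ _ (by fun_prop) (by fun_prop), Measure.map_id]
  rfl

theorem sumLaw_add (s t : ℕ) : sumLaw μ (s + t) = sumLaw μ s ∗ sumLaw μ t := by
  induction s with
  | zero => rw [sumLaw_zero, zero_add, Measure.dirac_zero_conv]
  | succ s ih => rw [add_right_comm, sumLaw_succ, ih, sumLaw_succ, Measure.conv_assoc]

theorem mul_le_sumLaw_add {s t : ℕ} {A B C : Set ℝ} (h : ∀ a ∈ A, ∀ b ∈ B, a + b ∈ C) :
    sumLaw μ s A * sumLaw μ t B ≤ sumLaw μ (s + t) C := by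
  rw [sumLaw_add, ← Measure.prod_prod, Measure.conv]
  refine (measure_mono ?_).trans (Measure.le_map_apply (by fun_prop) C)
  rintro ⟨a, b⟩ ⟨ha, hb⟩
  exact h a ha b hb

theorem avgProb_le_one {t : ℕ} {J : Set ℝ} : avgProb μ t J ≤ 1 := measureReal_le_one

/-- If two independent blocks both have their average in the interval `J`, so does the
concatenation, its average being a convex combination of the two. -/
theorem avgProb_mul_le {J : Set ℝ} (hJ : J.OrdConnected) {s t : ℕ} (hs : 0 < s) (ht : 0 < t) :
    avgProb μ s J * avgProb μ t J ≤ avgProb μ (s + t) J := by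
  rw [avgProb_eq hJ.measurableSet, avgProb_eq hJ.measurableSet, avgProb_eq hJ.measurableSet,
    Measure.real, Measure.real, Measure.real, ← ENNReal.toReal_mul]
  refine ENNReal.toReal_mono (measure_ne_top _ _) (mul_le_sumLaw_add ?_)
  intro a ha b hb
  have hs' : (0 : ℝ) < s := by exact_mod_cast hs
  have ht' : (0 : ℝ) < t := by exact_mod_cast ht
  have := hJ.convex (𝕜 := ℝ) ha hb (a := s / (s + t)) (b := t / (s + t)) (by positivity)
    (by positivity) (by field_simp)
  simp only [smul_eq_mul] at this
  have e : (a + b) / ((s + t : ℕ) : ℝ) = s / (s + t) * (a / s) + t / (s + t) * (b / t) := by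
    push_cast
    field_simp
  rw [Set.mem_ofPred_eq, e]
  exact this

theorem ae_pi_forall {P : ℝ → Prop} (h : ∀ᵐ u ∂μ, P u) (t : ℕ) :
    ∀ᵐ u ∂(Measure.pi fun _ : Fin t => μ), ∀ k, P (u k) :=
  ae_all_iff.2 fun k => (measurePreserving_eval (fun _ : Fin t => μ) k).quasiMeasurePreserving.ae h

theorem sumLaw_Icc_pos {a b : ℝ} (h : 0 < μ (Set.Icc a b)) (t : ℕ) :
    0 < sumLaw μ t (Set.Icc (t * a) (t * b)) := by
  induction t with
  | zero => simp [sumLaw_zero]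
  | succ t ih =>
    refine (ENNReal.mul_pos ih.ne' ?_).trans_le
      (mul_le_sumLaw_add (s := t) (t := 1) (B := Set.Icc a b) ?_)
    · rw [show (1 : ℕ) = 0 + 1 from rfl, sumLaw_succ, sumLaw_zero, Measure.conv_dirac_zero]
      exact h.ne'
    · rintro x ⟨h1, h2⟩ y ⟨h3, h4⟩
      push_cast
      constructor <;> linarith

/-- If `J` itself is charged, supermultiplicativity gives positivity. Otherwise, if `μ` charges only
one side of `J`, no average can lie in `J`; if it charges both sides, mixing samples from the two
sides in the right proportion reaches an interior point of `J`. -/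
theorem avgProb_eq_zero_or_eventually_pos {J : Set ℝ} (hJ : J.OrdConnected)
    (hint : (interior J).Nonempty) :
    (∀ t, 0 < t → avgProb μ t J = 0) ∨ ∀ᶠ t in atTop, 0 < avgProb μ t J := by
  by_cases hJ0 : μ J = 0
  swap
  · right
    have h1 : 0 < avgProb μ 1 J := by
      rw [avgProb_eq hJ.measurableSet, show (1 : ℕ) = 0 + 1 from rfl, sumLaw_succ, sumLaw_zero,
        Measure.conv_dirac_zero]
      simpa [Measure.real, ENNReal.toReal_pos_iff] using pos_iff_ne_zero.2 hJ0
    have : ∀ t, 0 < avgProb μ (t + 1) J := by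
      intro t
      induction t with
      | zero => exact h1
      | succ t ih => exact (mul_pos ih h1).trans_le (avgProb_mul_le hJ t.succ_pos one_pos)
    filter_upwards [eventually_ge_atTop 1] with t ht
    obtain ⟨t, rfl⟩ := Nat.exists_eq_add_of_le' ht
    exact this t
  have hout : ∀ᵐ u ∂μ, u ∉ J := measure_eq_zero_iff_ae_notMem.1 hJ0
  have hside : ∀ u ∉ J, (∀ j ∈ J, u < j) ∨ ∀ j ∈ J, j < u := by
    intro u hu
    by_contra! hcon
    obtain ⟨⟨j, hj, hju⟩, k, hk, huk⟩ := hcon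
    exact hu (hJ.out hj hk ⟨hju, huk⟩)
  by_cases hlo : μ {u | ∀ j ∈ J, u < j} = 0
  · left
    intro t ht
    have : Nonempty (Fin t) := ⟨⟨0, ht⟩⟩
    have ht' : (0 : ℝ) < t := by exact_mod_cast ht
    rw [avgProb, measureReal_eq_zero_iff, measure_eq_zero_iff_ae_notMem]
    have := ae_pi_forall (hout.and (measure_eq_zero_iff_ae_notMem.1 hlo)) t
    filter_upwards [this] with u hu hmem
    -- All samples lie above `J`, so an average in `J` would be smaller than each sample.
    have hgt : ∀ k, (∑ k, u k) / (t : ℝ) < u k := fun k =>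
      ((hside _ (hu k).1).resolve_left (hu k).2) _ hmem
    have := Finset.sum_lt_sum_of_nonempty (s := (Finset.univ : Finset (Fin t)))
      Finset.univ_nonempty fun k _ => hgt k
    simp only [Finset.sum_const, Finset.card_univ, Fintype.card_fin, nsmul_eq_mul] at this
    rw [mul_div_cancel₀ _ ht'.ne'] at this
    exact lt_irrefl _ this
  by_cases hhi : μ {u | ∀ j ∈ J, j < u} = 0
  · left
    intro t ht
    have : Nonempty (Fin t) := ⟨⟨0, ht⟩⟩
    have ht' : (0 : ℝ) < t := by exact_mod_cast ht
    rw [avgProb, measureReal_eq_zero_iff, measure_eq_zero_iff_ae_notMem]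
    have := ae_pi_forall (hout.and (measure_eq_zero_iff_ae_notMem.1 hhi)) t
    filter_upwards [this] with u hu hmem
    have hgt : ∀ k, u k < (∑ k, u k) / (t : ℝ) := fun k =>
      ((hside _ (hu k).1).resolve_right (hu k).2) _ hmem
    have := Finset.sum_lt_sum_of_nonempty (s := (Finset.univ : Finset (Fin t)))
      Finset.univ_nonempty fun k _ => hgt k
    simp only [Finset.sum_const, Finset.card_univ, Fintype.card_fin, nsmul_eq_mul] at this
    rw [mul_div_cancel₀ _ ht'.ne'] at this
    exact lt_irrefl _ this
  right
  obtain ⟨x₀, hx₀⟩ := hint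
  obtain ⟨ρ, hρ, hball⟩ := Metric.isOpen_iff.1 isOpen_interior x₀ hx₀
  have hx₀J := interior_subset hx₀
  obtain ⟨c, hc, hcpos⟩ := exists_mem_forall_mem_nhdsWithin_pos_measure hlo
  obtain ⟨d, hd, hdpos⟩ := exists_mem_forall_mem_nhdsWithin_pos_measure hhi
  have hcx : c < x₀ := hc _ hx₀J
  have hdx : x₀ < d := hd _ hx₀J
  have hη : 0 < ρ / 2 := by positivity
  have hc1 := hcpos _ (mem_nhdsWithin_of_mem_nhds (Icc_mem_nhds (by linarith : c - ρ / 2 < c)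
    (by linarith : c < c + ρ / 2)))
  have hd1 := hdpos _ (mem_nhdsWithin_of_mem_nhds (Icc_mem_nhds (by linarith : d - ρ / 2 < d)
    (by linarith : d < d + ρ / 2)))
  have hlarge : ∀ᶠ t : ℕ in atTop, 2 * (d - c) / ρ < t :=
    tendsto_natCast_atTop_atTop.eventually_gt_atTop _
  filter_upwards [hlarge, eventually_gt_atTop 0] with t htl ht
  have ht' : (0 : ℝ) < t := by exact_mod_cast ht
  have hdc : 0 < d - c := by linarith
  -- `θ` is the proportion of samples near `d` for which the mixture averages `x₀`. Taking `⌊tθ⌋` of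
  -- them shifts the sum by at most `d - c < tρ/2`, and the windows of radius `ρ/2` contribute at
  -- most `tρ/2`.
  set θ := (x₀ - c) / (d - c) with hθ
  have hθ0 : 0 ≤ θ := div_nonneg (by linarith) hdc.le
  have hθ1 : θ ≤ 1 := (div_le_one hdc).2 (by linarith)
  have hθe : θ * (d - c) = x₀ - c := div_mul_cancel₀ _ hdc.ne'
  have hb1 : (⌊t * θ⌋₊ : ℝ) ≤ t * θ := Nat.floor_le (by positivity)
  have hb2 : t * θ < ⌊t * θ⌋₊ + 1 := Nat.lt_floor_add_one _
  have hbt : ⌊t * θ⌋₊ ≤ t := by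
    have : (⌊t * θ⌋₊ : ℝ) ≤ t := hb1.trans (by nlinarith)
    exact_mod_cast this
  obtain ⟨a, ha⟩ := Nat.exists_eq_add_of_le' hbt
  set b := ⌊t * θ⌋₊ with hb
  rw [avgProb_eq hJ.measurableSet, Measure.real, ENNReal.toReal_pos_iff]
  refine ⟨?_, measure_lt_top _ _⟩
  have hpos := ENNReal.mul_pos (sumLaw_Icc_pos hc1 a).ne' (sumLaw_Icc_pos hd1 b).ne'
  refine hpos.trans_le ?_
  have hab : (t : ℝ) = a + b := by exact_mod_cast ha
  refine (mul_le_sumLaw_add (C := {s | s / (t : ℝ) ∈ J}) ?_).trans_eq (by rw [← ha])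
  rintro x ⟨hx1, hx2⟩ y ⟨hy1, hy2⟩
  change (x + y) / (t : ℝ) ∈ J
  refine interior_subset (hball ?_)
  rw [Metric.mem_ball, Real.dist_eq, abs_lt]
  have h3 : 2 * (d - c) < t * ρ := by
    rwa [div_lt_iff₀ hρ] at htl
  have e1 : (b : ℝ) * (d - c) ≤ t * (x₀ - c) := by
    rw [← hθe, ← mul_assoc]
    exact mul_le_mul_of_nonneg_right hb1 hdc.le
  have e2 : t * (x₀ - c) < (b + 1) * (d - c) := by
    rw [← hθe, ← mul_assoc]
    exact mul_lt_mul_of_pos_right hb2 hdc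
  have e3 : (t : ℝ) * x₀ = a * x₀ + b * x₀ := by rw [hab]; ring
  have e4 : (t : ℝ) * (x₀ - c) = t * x₀ - a * c - b * c := by rw [hab]; ring
  have e5 : (t : ℝ) * ρ = a * ρ + b * ρ := by rw [hab]; ring
  constructor
  · rw [lt_sub_iff_add_lt, lt_div_iff₀ ht']
    nlinarith
  · rw [sub_lt_iff_lt_add, div_lt_iff₀ ht']
    nlinarith

end Samples

/-! ### Exponential rates, Hoeffding bounds and anti-concentration of averages. -/

section Rates

open ProbabilityTheory

theorem HasResistance.of_rpow_bounds {X : ℝ → ℝ} {R : ℝ} (hR : 0 ≤ R)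
    (h0 : ∀ᶠ ε in 𝓝[>] 0, 0 ≤ X ε) (h1 : ∀ᶠ ε in 𝓝[>] 0, X ε ≤ ε ^ R)
    (h2 : ∀ R', R < R' → ∃ c, 0 < c ∧ ∀ᶠ ε in 𝓝[>] 0, c * ε ^ R' ≤ X ε) :
    HasResistance X (ENNReal.ofReal R) := by
  refine ⟨fun t ht => ?_, fun t ht => ?_⟩
  · refine tendsto_of_tendsto_of_tendsto_of_le_of_le' tendsto_const_nhds
      ((HasResistance.rpow hR).1 t ht) ?_ ?_
    · filter_upwards [h0, eventually_pos_nhdsGT_zero] with ε e hε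
      exact mul_nonneg (Real.rpow_nonneg hε.le _) e
    · filter_upwards [h1, eventually_pos_nhdsGT_zero] with ε e hε
      exact mul_le_mul_of_nonneg_left e (Real.rpow_nonneg hε.le _)
  · obtain ⟨q, hq1, hq2⟩ := EReal.lt_iff_exists_real_btwn.1 ht
    have hRq : R < q := by
      rw [EReal.coe_ennreal_ofReal, max_eq_left hR] at hq1
      exact EReal.coe_lt_coe_iff.1 hq1
    have hq0 : 0 ≤ q := hR.trans hRq.le
    obtain ⟨c, hc, hcX⟩ := h2 q hRq
    refine tendsto_atTop_mono' _ ?_ (((HasResistance.rpow hq0).2 t (by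
      rw [EReal.coe_ennreal_ofReal, max_eq_left hq0]
      exact hq2)).const_mul_atTop hc)
    filter_upwards [hcX, eventually_pos_nhdsGT_zero] with ε e hε
    have := mul_le_mul_of_nonneg_left e (Real.rpow_nonneg hε.le (-t))
    linarith

/-- Fekete's lemma for a supermultiplicative sequence. -/
theorem exists_exponential_rate {p : ℕ → ℝ} (h1 : ∀ t, p t ≤ 1) (h0 : ∀ t, 0 ≤ p t)
    (hmul : ∀ s t, 0 < s → 0 < t → p s * p t ≤ p (s + t)) (hpos : ∀ᶠ t in atTop, 0 < p t) :
    ∃ I : ℝ, 0 ≤ I ∧ (∀ t, 0 < t → p t ≤ Real.exp (-(I * t))) ∧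
      ∀ I', I < I' → ∃ c, 0 < c ∧ ∀ᶠ t : ℕ in atTop, c * Real.exp (-(I' * t)) ≤ p t := by
  obtain ⟨T, hT⟩ := eventually_atTop.1 hpos
  -- The rate is the infimum of `-log (p s) / s`. The upper bound then holds for every `t`; for the
  -- lower bound, blocks of a nearly optimal length `s` are concatenated.
  let A : Set ℝ := {x | ∃ s : ℕ, 0 < s ∧ 0 < p s ∧ x = -Real.log (p s) / s}
  have hAnn : ∀ x ∈ A, 0 ≤ x := by
    rintro x ⟨s, hs, hp, rfl⟩
    have := Real.log_nonpos hp.le (h1 s)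
    exact div_nonneg (by linarith) (by positivity)
  have hA : A.Nonempty := ⟨_, T + 1, T.succ_pos, hT _ (Nat.le_succ T), rfl⟩
  have hbdd : BddBelow A := ⟨0, hAnn⟩
  refine ⟨sInf A, Real.sInf_nonneg hAnn, fun t ht => ?_, fun I' hI' => ?_⟩
  · rcases (h0 t).eq_or_lt with h | h
    · rw [← h]
      positivity
    · have ht' : (0 : ℝ) < t := by exact_mod_cast ht
      have := csInf_le hbdd ⟨t, ht, h, rfl⟩
      rw [le_div_iff₀ ht'] at this
      rw [← Real.log_le_iff_le_exp h]
      linarith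
  · obtain ⟨x, ⟨s, hs, hps, rfl⟩, hlt⟩ := exists_lt_of_csInf_lt hA hI'
    have hI0 : 0 ≤ I' := (Real.sInf_nonneg hAnn).trans hI'.le
    have hs' : (0 : ℝ) < s := by exact_mod_cast hs
    have hps' : Real.exp (-(I' * s)) ≤ p s := by
      rw [div_lt_iff₀ hs'] at hlt
      rw [← Real.le_log_iff_exp_le hps]
      linarith
    -- The remainders are taken in `T + 1, …, T + s` rather than `0, …, s - 1`, so that `p` is
    -- positive there.
    have hne : (Finset.range s).Nonempty := ⟨0, Finset.mem_range.2 hs⟩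
    let c := (Finset.range s).inf' hne fun j => p (T + 1 + j)
    have hc : 0 < c := by
      rw [Finset.lt_inf'_iff]
      exact fun j _ => hT _ (by omega)
    refine ⟨c, hc, ?_⟩
    have key : ∀ q j, j < s → c * Real.exp (-(I' * (q * s : ℕ))) ≤ p (q * s + (T + 1 + j)) := by
      intro q j hj
      induction q with
      | zero => simpa using Finset.inf'_le (fun j => p (T + 1 + j)) (Finset.mem_range.2 hj)
      | succ q ih =>
        have e : (q + 1) * s + (T + 1 + j) = s + (q * s + (T + 1 + j)) := by ring
        rw [e]
        refine le_trans ?_ (hmul s _ hs (by omega))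
        have e2 : c * Real.exp (-(I' * ((q + 1) * s : ℕ))) =
            Real.exp (-(I' * s)) * (c * Real.exp (-(I' * (q * s : ℕ)))) := by
          rw [mul_left_comm, ← Real.exp_add]
          push_cast
          ring_nf
        rw [e2]
        exact mul_le_mul hps' ih (by positivity) hps.le
    filter_upwards [eventually_ge_atTop (T + 1)] with t ht
    have hj : (t - (T + 1)) % s < s := Nat.mod_lt _ hs
    have hdecomp : t = (t - (T + 1)) / s * s + (T + 1 + (t - (T + 1)) % s) := by
      have := Nat.div_add_mod (t - (T + 1)) s
      rw [mul_comm] at this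
      omega
    have h3 := key ((t - (T + 1)) / s) _ hj
    rw [← hdecomp] at h3
    refine le_trans ?_ h3
    refine mul_le_mul_of_nonneg_left (Real.exp_le_exp.2 ?_) hc.le
    have : ((t - (T + 1)) / s * s : ℕ) ≤ t := (Nat.div_mul_le_self _ _).trans (Nat.sub_le _ _)
    have : (((t - (T + 1)) / s * s : ℕ) : ℝ) ≤ t := by exact_mod_cast this
    nlinarith

variable {τ₀ : ℝ}

/-- Number of samples at noise level `ε`. -/
noncomputable abbrev numSamples (τ₀ ε : ℝ) : ℕ := ⌈τ₀ * Real.log (1 / ε)⌉₊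

theorem tendsto_numSamples (hτ : 0 < τ₀) : Tendsto (numSamples τ₀) (𝓝[>] 0) atTop := by
  have h1 : Tendsto (fun ε : ℝ => τ₀ * Real.log (1 / ε)) (𝓝[>] 0) atTop := by
    refine Tendsto.const_mul_atTop hτ (Real.tendsto_log_atTop.comp ?_)
    exact (tendsto_inv_nhdsGT_zero (𝕜 := ℝ)).congr fun ε => (one_div ε).symm
  exact tendsto_nat_ceil_atTop.comp h1

theorem exp_neg_numSamples_le {I : ℝ} (hI : 0 ≤ I) {ε : ℝ} (hε : 0 < ε) :
    Real.exp (-(I * numSamples τ₀ ε)) ≤ ε ^ (τ₀ * I) := by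
  rw [Real.rpow_def_of_pos hε]
  refine Real.exp_le_exp.2 ?_
  have h1 : τ₀ * Real.log (1 / ε) ≤ numSamples τ₀ ε := Nat.le_ceil _
  rw [one_div, Real.log_inv] at h1
  nlinarith

/-- The ceiling adds at most one sample, whence the factor `exp (-I)`. -/
theorem rpow_le_exp_neg_numSamples (hτ : 0 < τ₀) {I : ℝ} (hI : 0 ≤ I) {ε : ℝ} (hε : 0 < ε)
    (hε1 : ε < 1) : Real.exp (-I) * ε ^ (τ₀ * I) ≤ Real.exp (-(I * numSamples τ₀ ε)) := by
  rw [Real.rpow_def_of_pos hε, ← Real.exp_add]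
  refine Real.exp_le_exp.2 ?_
  have h0 : 0 < Real.log (1 / ε) := Real.log_pos (by rw [lt_div_iff₀ hε]; linarith)
  have h1 : (numSamples τ₀ ε : ℝ) < τ₀ * Real.log (1 / ε) + 1 := Nat.ceil_lt_add_one (by positivity)
  rw [one_div, Real.log_inv] at h1
  nlinarith

theorem almostRegular_of_supermultiplicative (hτ : 0 < τ₀) {p : ℕ → ℝ} (h1 : ∀ t, p t ≤ 1)
    (h0 : ∀ t, 0 ≤ p t) (hmul : ∀ s t, 0 < s → 0 < t → p s * p t ≤ p (s + t))
    (hpos : (∀ t, 0 < t → p t = 0) ∨ ∀ᶠ t in atTop, 0 < p t) :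
    AlmostRegular fun ε => p (numSamples τ₀ ε) := by
  have htend := tendsto_numSamples hτ
  rcases hpos with hz | hpos
  · exact ⟨⊤, .of_eventually_eq_zero
      ((htend.eventually (eventually_gt_atTop 0)).mono fun ε h => hz _ h)⟩
  obtain ⟨I, hI, hup, hlo⟩ := exists_exponential_rate h1 h0 hmul hpos
  refine ⟨ENNReal.ofReal (τ₀ * I), .of_rpow_bounds (by positivity)
    (Eventually.of_forall fun _ => h0 _) ?_ ?_⟩
  · filter_upwards [htend.eventually (eventually_gt_atTop 0), eventually_pos_nhdsGT_zero]
      with ε ht hε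
    exact (hup _ ht).trans (exp_neg_numSamples_le hI hε)
  · intro R' hR'
    have hI' : I < R' / τ₀ := by rw [lt_div_iff₀ hτ]; linarith
    obtain ⟨c, hc, hev⟩ := hlo _ hI'
    refine ⟨c * Real.exp (-(R' / τ₀)), by positivity, ?_⟩
    filter_upwards [htend.eventually hev, eventually_pos_nhdsGT_zero, eventually_lt_one_nhdsGT_zero]
      with ε h hε hε1
    refine le_trans ?_ h
    have := rpow_le_exp_neg_numSamples hτ (hI.trans hI'.le) hε hε1
    rw [mul_div_cancel₀ _ hτ.ne'] at this
    rw [mul_assoc]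
    exact mul_le_mul_of_nonneg_left this hc.le

/-- The number of samples is only logarithmic in `1/ε`, so its inverse beats every positive power of
`ε`. -/
theorem eventually_rpow_le_div_numSamples (hτ : 0 < τ₀) {c : ℝ} (hc : 0 < c) {q : ℝ} (hq : 0 < q) :
    ∀ᶠ ε in 𝓝[>] 0, ε ^ q ≤ c / numSamples τ₀ ε := by
  have hI : 0 < q / (2 * τ₀) := by positivity
  have h2 := Real.tendsto_pow_mul_exp_neg_atTop_nhds_zero 1
  have h3 : Tendsto (fun t : ℕ => q / (2 * τ₀) * (t : ℝ)) atTop atTop :=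
    (tendsto_natCast_atTop_atTop (R := ℝ)).const_mul_atTop hI
  have h4 := (h2.comp h3).comp (tendsto_numSamples hτ)
  have hc' : 0 < c * (q / (2 * τ₀)) * Real.exp (-(q / (2 * τ₀))) := by positivity
  filter_upwards [h4.eventually (gt_mem_nhds hc'), eventually_pos_nhdsGT_zero,
    eventually_lt_one_nhdsGT_zero, (tendsto_numSamples hτ).eventually (eventually_gt_atTop 0)]
    with ε e hε hε1 ht
  simp only [Function.comp_apply, pow_one] at e
  have ht' : (0 : ℝ) < numSamples τ₀ ε := by exact_mod_cast ht
  have h6 := rpow_le_exp_neg_numSamples hτ hI.le hε hε1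
  have e2 : τ₀ * (q / (2 * τ₀)) = q / 2 := by field_simp
  rw [e2] at h6
  rw [le_div_iff₀ ht']
  have h7 : ε ^ q ≤ ε ^ (q / 2) :=
    Real.rpow_le_rpow_of_exponent_ge hε hε1.le (by linarith)
  have h8 := Real.exp_pos (-(q / (2 * τ₀)))
  have h9 : Real.exp (-(q / (2 * τ₀))) * (ε ^ (q / 2) * numSamples τ₀ ε * (q / (2 * τ₀))) <
      Real.exp (-(q / (2 * τ₀))) * (c * (q / (2 * τ₀))) := by
    calc _ = Real.exp (-(q / (2 * τ₀))) * ε ^ (q / 2) * (q / (2 * τ₀) * numSamples τ₀ ε) := by ring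
      _ ≤ Real.exp (-(q / (2 * τ₀) * numSamples τ₀ ε)) * (q / (2 * τ₀) * numSamples τ₀ ε) :=
          mul_le_mul_of_nonneg_right h6 (by positivity)
      _ < _ := by linarith
  have h10 := lt_of_mul_lt_mul_left h9 h8.le
  have h11 := lt_of_mul_lt_mul_right h10 hI.le
  nlinarith

variable {μ : Measure ℝ} [IsProbabilityMeasure μ]

/-- Hoeffding's lemma for an interval of length 1; the variance proxy `1/4` produces the exponent
`2x²t` below. -/
theorem hasSubgaussianMGF_eval (hμ : ∀ᵐ u ∂μ, u ∈ Set.Icc (0 : ℝ) 1) (t : ℕ) (k : Fin t) :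
    HasSubgaussianMGF (fun u : Fin t → ℝ => u k - ∫ x, x ∂μ) ((1 / 2) ^ 2)
      (Measure.pi fun _ : Fin t => μ) := by
  have hmp := measurePreserving_eval (fun _ : Fin t => μ) k
  have h := hasSubgaussianMGF_of_mem_Icc (μ := Measure.pi fun _ : Fin t => μ)
    (X := fun u : Fin t → ℝ => u k) (a := 0) (b := 1) hmp.aemeasurable
    (hmp.quasiMeasurePreserving.ae hμ)
  rw [integral_eval] at h
  simpa using h

theorem iIndepFun_eval_sub (t : ℕ) (c : ℝ) :
    iIndepFun (fun (k : Fin t) (u : Fin t → ℝ) => u k - c) (Measure.pi fun _ : Fin t => μ) :=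
  iIndepFun_pi (X := fun _ x => x - c) fun _ => by fun_prop

theorem avgProb_ge_le (hμ : ∀ᵐ u ∂μ, u ∈ Set.Icc (0 : ℝ) 1) {x : ℝ} (hx : 0 ≤ x) (t : ℕ) :
    avgProb μ t (Set.Ici (∫ u, u ∂μ + x)) ≤ Real.exp (-(2 * x ^ 2 * t)) := by
  rcases t.eq_zero_or_pos with rfl | ht
  · simpa using avgProb_le_one
  have ht' : (0 : ℝ) < t := by exact_mod_cast ht
  have h := HasSubgaussianMGF.measure_sum_ge_le_of_iIndepFun (s := Finset.univ)
    (iIndepFun_eval_sub (μ := μ) t (∫ u, u ∂μ)) (fun k _ => hasSubgaussianMGF_eval hμ t k)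
    (ε := t * x) (by positivity)
  have e : {u : Fin t → ℝ | t * x ≤ ∑ k, (u k - ∫ u, u ∂μ)} =
      {u | (∑ k, u k) / (t : ℝ) ∈ Set.Ici (∫ u, u ∂μ + x)} := by
    ext u
    simp only [Set.mem_ofPred_eq, Set.mem_Ici, le_div_iff₀ ht', Finset.sum_sub_distrib,
      Finset.sum_const, Finset.card_univ, Fintype.card_fin, nsmul_eq_mul]
    constructor <;> intro <;> linarith
  rw [e] at h
  refine h.trans (le_of_eq ?_)
  congr 1
  simp
  field_simp

theorem avgProb_le_le (hμ : ∀ᵐ u ∂μ, u ∈ Set.Icc (0 : ℝ) 1) {x : ℝ} (hx : 0 ≤ x) (t : ℕ) :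
    avgProb μ t (Set.Iic (∫ u, u ∂μ - x)) ≤ Real.exp (-(2 * x ^ 2 * t)) := by
  rcases t.eq_zero_or_pos with rfl | ht
  · simpa using avgProb_le_one
  have ht' : (0 : ℝ) < t := by exact_mod_cast ht
  have h := HasSubgaussianMGF.measure_sum_ge_le_of_iIndepFun (s := Finset.univ)
    (X := fun (k : Fin t) (u : Fin t → ℝ) => -(u k - ∫ u, u ∂μ))
    ((iIndepFun_eval_sub (μ := μ) t (∫ u, u ∂μ)).comp (fun _ x => -x) (fun _ => measurable_neg))
    (fun k _ => (hasSubgaussianMGF_eval hμ t k).neg)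
    (ε := t * x) (by positivity)
  have e : {u : Fin t → ℝ | t * x ≤ ∑ k, -(u k - ∫ u, u ∂μ)} =
      {u | (∑ k, u k) / (t : ℝ) ∈ Set.Iic (∫ u, u ∂μ - x)} := by
    ext u
    simp only [Set.mem_ofPred_eq, Set.mem_Iic, div_le_iff₀ ht', Finset.sum_sub_distrib,
      Finset.sum_neg_distrib,
      Finset.sum_const, Finset.card_univ, Fintype.card_fin, nsmul_eq_mul]
    constructor <;> intro <;> linarith
  rw [e] at h
  refine h.trans (le_of_eq ?_)
  congr 1
  simp
  field_simp

theorem integral_mem_Icc (hμ : ∀ᵐ u ∂μ, u ∈ Set.Icc (0 : ℝ) 1) :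
    ∫ u, u ∂μ ∈ Set.Icc (0 : ℝ) 1 :=
  ⟨integral_nonneg_of_ae (hμ.mono fun _ h => h.1), by
    have hi : Integrable (fun u : ℝ => u) μ := by
      refine Integrable.of_bound (by fun_prop) 1 (hμ.mono fun u h => ?_)
      rw [Real.norm_eq_abs, abs_le]
      constructor <;> linarith [h.1, h.2]
    simpa using integral_mono_ae hi (integrable_const 1) (hμ.mono fun _ h => h.2)⟩

/-- A centred sum of `t` bounded samples is of either sign with probability at least of order
`1 / t`; `σ = 1` and `σ = -1` select the sign. -/
theorem variance_div_le_measureReal (hμ : ∀ᵐ u ∂μ, u ∈ Set.Icc (0 : ℝ) 1) {t : ℕ} (ht : 0 < t)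
    {σ : ℝ} (hσ : σ ^ 2 = 1) :
    variance id μ / 2 / t ≤ (Measure.pi fun _ : Fin t => μ).real
      {u | 0 < σ * (∑ k, u k - t * ∫ x, x ∂μ)} := by
  set π := Measure.pi fun _ : Fin t => μ with hπ
  have ht' : (0 : ℝ) < t := by exact_mod_cast ht
  have hmp := fun k => measurePreserving_eval (fun _ : Fin t => μ) k
  set m := ∫ x, x ∂μ with hm
  have hm01 : m ∈ Set.Icc (0 : ℝ) 1 := integral_mem_Icc hμ
  have hall : ∀ᵐ u ∂π, ∀ k, u k ∈ Set.Icc (0 : ℝ) 1 := ae_pi_forall hμ t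
  have hLp : ∀ k : Fin t, MemLp (fun u : Fin t → ℝ => u k) 2 π := fun k => by
    refine MemLp.of_bound (measurable_pi_apply k).aestronglyMeasurable 1 (hall.mono fun u h => ?_)
    rw [Real.norm_eq_abs, abs_le]
    constructor <;> linarith [(h k).1, (h k).2]
  have hint : ∀ k : Fin t, Integrable (fun u : Fin t → ℝ => u k) π := fun k =>
    (hLp k).integrable one_le_two
  have hE : ∫ u, (∑ k : Fin t, fun u : Fin t → ℝ => u k) u ∂π = t * m := by
    simp only [Finset.sum_apply]
    rw [integral_finsetSum _ fun k _ => hint k]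
    simp [hπ, integral_eval, hm]
  have hvar : variance (∑ k : Fin t, fun u : Fin t → ℝ => u k) π = t * variance id μ := by
    rw [IndepFun.variance_sum (fun k _ => hLp k)]
    · have : ∀ k : Fin t, variance (fun u : Fin t → ℝ => u k) π = variance id μ := fun k => by
        rw [← (hmp k).map_eq, variance_map (by fun_prop) (hmp k).aemeasurable]
        rfl
      simp [this]
    · intro i _ j _ hij
      exact (iIndepFun_pi (μ := fun _ : Fin t => μ) (X := fun _ x => x)
        fun _ => by fun_prop).indepFun hij
  rw [variance_eq_integral (by fun_prop), hE] at hvar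
  set W : (Fin t → ℝ) → ℝ := fun u => ∑ k, u k - t * m with hW
  have hWb : ∀ᵐ u ∂π, |W u| ≤ t := by
    filter_upwards [hall] with u hu
    have h1 : 0 ≤ ∑ k, u k := Finset.sum_nonneg fun k _ => (hu k).1
    have h2 : ∑ k, u k ≤ t := by
      simpa using Finset.sum_le_sum fun k (_ : k ∈ Finset.univ) => (hu k).2
    rw [abs_le]
    constructor <;> simp only [hW] <;> nlinarith [hm01.1, hm01.2]
  have hWm : Measurable W := by fun_prop
  have hWi : Integrable W π := .of_bound (by fun_prop) t (hWb.mono fun u h => by simpa using h)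
  have hW0 : ∫ u, W u ∂π = 0 := by
    simp only [hW]
    rw [integral_sub (integrable_finsetSum _ fun k _ => hint k) (integrable_const _)]
    simp only [Finset.sum_apply] at hE
    rw [hE]
    simp
  have hS : MeasurableSet {u | 0 < σ * W u} := measurableSet_lt (by fun_prop) (by fun_prop)
  -- With `X = σW` and `|X| ≤ t`, both signs give `X² ≤ 2t²·1_{X > 0} - tX`. Since `W` has mean zero
  -- and variance `t Var μ`, integration yields `t Var μ ≤ 2t² P(X > 0)`.
  have hineq : ∀ᵐ u ∂π, W u ^ 2 ≤
      2 * (t : ℝ) ^ 2 * Set.indicator {u | 0 < σ * W u} 1 u - t * σ * W u := by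
    filter_upwards [hWb] with u hu
    have e : W u ^ 2 = (σ * W u) ^ 2 := by rw [mul_pow, hσ, one_mul]
    have hb : |σ * W u| ≤ t := by
      rw [abs_mul, show |σ| = 1 by rw [← sq_eq_sq₀ (abs_nonneg σ) zero_le_one]; simpa using hσ]
      simpa using hu
    rw [abs_le] at hb
    rw [e, mul_assoc]
    by_cases h : 0 < σ * W u
    · rw [Set.indicator_of_mem (by exact h)]
      simp only [Pi.one_apply]
      nlinarith
    · rw [Set.indicator_of_notMem (by exact h)]
      nlinarith
  have h1 := integral_mono_ae (μ := π) ?_ ?_ hineq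
  · rw [integral_sub ?_ (hWi.const_mul _), integral_const_mul, integral_const_mul, hW0,
      integral_indicator_one hS] at h1
    · have h2 : ∫ u, W u ^ 2 ∂π = t * variance id μ := by
        rw [← hvar]
        refine integral_congr_ae (ae_of_all _ fun u => ?_)
        simp [hW]
      rw [h2] at h1
      rw [div_le_iff₀ ht', div_le_iff₀ two_pos]
      refine le_of_mul_le_mul_left ?_ ht'
      linarith
    · exact ((integrable_const (1 : ℝ)).indicator hS).const_mul _
  · refine .of_bound (by fun_prop) ((t : ℝ) ^ 2) (hWb.mono fun u h => ?_)
    rw [Real.norm_eq_abs, abs_pow]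
    exact pow_le_pow_left₀ (abs_nonneg _) h 2
  · exact (((integrable_const (1 : ℝ)).indicator hS).const_mul _).sub (hWi.const_mul _)

theorem variance_div_le_avgProb_gt (hμ : ∀ᵐ u ∂μ, u ∈ Set.Icc (0 : ℝ) 1) {t : ℕ} (ht : 0 < t) :
    variance id μ / 2 / t ≤ avgProb μ t (Set.Ioi (∫ u, u ∂μ)) := by
  have ht' : (0 : ℝ) < t := by exact_mod_cast ht
  refine (variance_div_le_measureReal hμ ht (σ := 1) (by norm_num)).trans (le_of_eq ?_)
  rw [avgProb]
  congr 1
  ext u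
  simp only [Set.mem_ofPred_eq, Set.mem_Ioi, lt_div_iff₀ ht']
  constructor <;> intro <;> linarith

theorem variance_div_le_avgProb_lt (hμ : ∀ᵐ u ∂μ, u ∈ Set.Icc (0 : ℝ) 1) {t : ℕ} (ht : 0 < t) :
    variance id μ / 2 / t ≤ avgProb μ t (Set.Iio (∫ u, u ∂μ)) := by
  have ht' : (0 : ℝ) < t := by exact_mod_cast ht
  refine (variance_div_le_measureReal hμ ht (σ := -1) (by norm_num)).trans (le_of_eq ?_)
  rw [avgProb]
  congr 1
  ext u
  simp only [Set.mem_ofPred_eq, Set.mem_Iio, div_lt_iff₀ ht']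
  constructor <;> intro <;> linarith

theorem eq_dirac_of_variance_eq_zero (hμ : ∀ᵐ u ∂μ, u ∈ Set.Icc (0 : ℝ) 1)
    (h : variance id μ = 0) : μ = Measure.dirac (∫ u, u ∂μ) := by
  have hLp : MemLp (id : ℝ → ℝ) 2 μ := by
    refine MemLp.of_bound (by fun_prop) 1 (hμ.mono fun u h => ?_)
    rw [Real.norm_eq_abs, abs_le]
    constructor <;> simp only [id] <;> linarith [h.1, h.2]
  have h1 : evariance id μ = 0 := by rw [← hLp.ofReal_variance_eq, h, ENNReal.ofReal_zero]
  have h2 := (evariance_eq_zero_iff (by fun_prop)).1 h1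
  calc μ = μ.map id := Measure.map_id.symm
    _ = μ.map fun _ => ∫ u, u ∂μ := Measure.map_congr h2
    _ = _ := by rw [Measure.map_const]; simp

end Rates

theorem AlmostRegular.hasResistance {X : ℝ → ℝ} (h : AlmostRegular X) :
    HasResistance X (resistance X) := by
  obtain ⟨r, hr⟩ := h
  rwa [hr.resistance_eq]

section AvgProb

variable {μ : Measure ℝ} [IsProbabilityMeasure μ]

theorem avgProb_sub_le {t : ℕ} {A B J : Set ℝ} (h : A ⊆ J ∪ B) :
    avgProb μ t A - avgProb μ t B ≤ avgProb μ t J := by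
  rw [sub_le_iff_le_add]
  refine (measureReal_mono (fun u hu => ?_)).trans (measureReal_union_le _ _)
  exact h hu

theorem avgProb_mono {t : ℕ} {A J : Set ℝ} (h : A ⊆ J) : avgProb μ t A ≤ avgProb μ t J :=
  measureReal_mono fun _ hu => h hu

theorem ae_avg_dirac (c : ℝ) {t : ℕ} (ht : 0 < t) :
    ∀ᵐ u ∂(Measure.pi fun _ : Fin t => Measure.dirac c), (∑ k, u k) / (t : ℝ) = c := by
  have ht' : (t : ℝ) ≠ 0 := by exact_mod_cast ht.ne'
  have h : ∀ᵐ u ∂(Measure.dirac c), u = c := by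
    rw [ae_dirac_eq]
    exact Filter.eventually_pure.2 rfl
  filter_upwards [ae_pi_forall h t] with u hu
  simp [hu, ht']

theorem avgProb_dirac_of_notMem {c : ℝ} {J : Set ℝ} (hc : c ∉ J) {t : ℕ} (ht : 0 < t) :
    avgProb (Measure.dirac c) t J = 0 := by
  rw [avgProb, measureReal_eq_zero_iff, measure_eq_zero_iff_ae_notMem]
  filter_upwards [ae_avg_dirac c ht] with u hu hmem
  exact hc (by simpa [hu] using hmem)

theorem avgProb_dirac_of_mem {c : ℝ} {J : Set ℝ} (hc : c ∈ J) {t : ℕ} (ht : 0 < t) :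
    avgProb (Measure.dirac c) t J = 1 := by
  have h : {u : Fin t → ℝ | (∑ k, u k) / (t : ℝ) ∈ J} =ᵐ[Measure.pi fun _ : Fin t => Measure.dirac c]
      Set.univ := by
    rw [eventuallyEq_univ]
    filter_upwards [ae_avg_dirac c ht] with u hu
    simpa [hu] using hc
  rw [avgProb, measureReal_congr h, probReal_univ]

end AvgProb

/-- The exponential term is a positive power of `ε`, negligible against `c / t` with `t` of order
`log (1/ε)`. -/
theorem HasResistance.eq_zero_of_avg {p : ℕ → ℝ} {τ₀ : ℝ} (hτ : 0 < τ₀) {r : ℝ≥0∞}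
    (hr : HasResistance (fun ε => p (numSamples τ₀ ε)) r) {c x : ℝ} (hc : 0 < c) (hx : 0 < x)
    (h : ∀ t : ℕ, 0 < t → c / t - Real.exp (-(2 * x ^ 2 * t)) ≤ p t) : r = 0 := by
  refine hr.eq_zero fun q hq => ?_
  filter_upwards [eventually_rpow_le_div_numSamples hτ (half_pos hc) hq,
    eventually_rpow_le_div_numSamples hτ (half_pos hc) (q := τ₀ * (2 * x ^ 2)) (by positivity),
    eventually_pos_nhdsGT_zero, (tendsto_numSamples hτ).eventually (eventually_gt_atTop 0)]
    with ε h1 h2 hε ht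
  have h3 := exp_neg_numSamples_le (τ₀ := τ₀) (I := 2 * x ^ 2) (by positivity) hε
  have h4 := h _ ht
  have h5 : c / 2 / (numSamples τ₀ ε : ℝ) + c / 2 / numSamples τ₀ ε = c / numSamples τ₀ ε := by ring
  linarith

/-! ### Bins and the resistance of observing them. -/

namespace Ritel

variable {I : Type*} {A : I → Type*} (g : Ritel I A)

theorem m_pos' : (0 : ℝ) < g.m := by exact_mod_cast g.m_pos

theorem δ_pos : 0 < g.δ := one_div_pos.2 g.m_pos'

theorem m_mul_δ : (g.m : ℝ) * g.δ = 1 := by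
  rw [δ, mul_one_div_cancel g.m_pos'.ne']

theorem binOf_val (u : ℝ) : (g.binOf u : ℕ) = min ⌊u * (g.m : ℝ)⌋₊ g.m := rfl

theorem binOf_mono : Monotone g.binOf := fun u w h => by
  rw [Fin.le_def, binOf_val, binOf_val]
  have := Nat.floor_mono (mul_le_mul_of_nonneg_right h g.m_pos'.le)
  omega

theorem le_of_lt_binOf {u : ℝ} {k : ℕ} (hk : 0 < k) (h : k ≤ (g.binOf u : ℕ)) :
    (k : ℝ) * g.δ ≤ u := by
  rw [binOf_val] at h
  have h1 : k ≤ ⌊u * (g.m : ℝ)⌋₊ := by omega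
  have h2 := (Nat.le_floor_iff' hk.ne').1 h1
  rw [δ, mul_one_div, div_le_iff₀ g.m_pos']
  exact h2

theorem lt_of_binOf_lt {u : ℝ} {k : ℕ} (hk : k ≤ g.m) (h : (g.binOf u : ℕ) < k) :
    u < (k : ℝ) * g.δ := by
  rw [binOf_val] at h
  have h1 : ⌊u * (g.m : ℝ)⌋₊ < k := by omega
  have h2 := Nat.lt_of_floor_lt h1
  rw [δ, mul_one_div, lt_div_iff₀ g.m_pos']
  exact h2

theorem lt_binOf_of_le {u : ℝ} {k : ℕ} (hk : k ≤ g.m) (h : (k : ℝ) * g.δ ≤ u) :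
    k ≤ (g.binOf u : ℕ) :=
  not_lt.1 fun hlt => absurd (g.lt_of_binOf_lt hk hlt) (not_lt.2 h)

theorem binOf_lt_of_lt {u : ℝ} {k : ℕ} (hk : 0 < k) (h : u < (k : ℝ) * g.δ) :
    (g.binOf u : ℕ) < k :=
  not_le.1 fun hle => absurd (g.le_of_lt_binOf hk hle) (not_le.2 h)

theorem ordConnected_bin (v : g.Bin) : {u | g.binOf u = v}.OrdConnected :=
  (Set.ordConnected_singleton (a := v)).preimage_mono g.binOf_mono

/-- `binOf` clamps outside `[0,1]`, so even the bin written `{1}` is the half-line `[1, ∞)` and has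
interior. -/
theorem interior_bin_nonempty (v : g.Bin) : (interior {u | g.binOf u = v}).Nonempty := by
  have hsub : Set.Ioo ((v : ℕ) * g.δ) (((v : ℕ) + 1 : ℕ) * g.δ) ⊆ {u | g.binOf u = v} := by
    rintro u ⟨h1, h2⟩
    have h3 := g.lt_binOf_of_le (Nat.lt_succ_iff.1 v.2) h1.le
    have h4 := g.binOf_lt_of_lt (Nat.succ_pos _) h2
    exact Fin.ext (by omega)
  have := interior_maximal hsub isOpen_Ioo
  refine Set.Nonempty.mono this (Set.nonempty_Ioo.2 ?_)
  push_cast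
  nlinarith [g.δ_pos]

theorem almostRegular_binProb (i : I) (a : ∀ j, A j) (v : g.Bin) :
    AlmostRegular fun ε => g.binProb (g.τ ε) i a v := by
  have := g.isProb i a
  exact almostRegular_of_supermultiplicative g.τ₀_pos
    (p := fun t => avgProb (g.law i a) t {u | g.binOf u = v}) (fun _ => avgProb_le_one)
    (fun _ => avgProb_nonneg) (fun s t hs ht => avgProb_mul_le (g.ordConnected_bin v) hs ht)
    (avgProb_eq_zero_or_eventually_pos (g.ordConnected_bin v) (g.interior_bin_nonempty v))

theorem hasResistance_binProb (i : I) (a : ∀ j, A j) (v : g.Bin) :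
    HasResistance (fun ε => g.binProb (g.τ ε) i a v) (g.obsResistance i a v) :=
  (g.almostRegular_binProb i a v).hasResistance

theorem binProb_nonneg (t : ℕ) (i : I) (a : ∀ j, A j) (v : g.Bin) : 0 ≤ g.binProb t i a v :=
  measureReal_nonneg

theorem M_mem_Icc (i : I) (a : ∀ j, A j) : g.M i a ∈ Set.Icc (0 : ℝ) 1 := by
  have := g.isProb i a
  exact integral_mem_Icc (g.bounded i a)

theorem low_N_le (i : I) (a : ∀ j, A j) : g.low (g.N i a) ≤ g.M i a := by
  rw [low]
  rcases Nat.eq_zero_or_pos (g.N i a : ℕ) with h | h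
  · rw [h]
    simpa using (g.M_mem_Icc i a).1
  · exact g.le_of_lt_binOf h le_rfl

theorem lt_low_N_add (i : I) (a : ∀ j, A j) : g.M i a < g.low (g.N i a) + g.δ := by
  have e : g.low (g.N i a) + g.δ = ((g.N i a : ℕ) + 1 : ℕ) * g.δ := by
    rw [low]
    push_cast
    ring
  rw [e]
  by_cases h : (g.N i a : ℕ) + 1 ≤ g.m
  · exact g.lt_of_binOf_lt h (Nat.lt_succ_self _)
  · have h1 : (g.N i a : ℕ) = g.m := by have := (g.N i a).2; omega
    rw [h1]
    push_cast
    have := g.m_mul_δ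
    nlinarith [(g.M_mem_Icc i a).2, g.δ_pos]

theorem low_le_low_add {v w : g.Bin} {k : ℕ} (h : (v : ℕ) ≤ w + k) :
    g.low v ≤ g.low w + k * g.δ := by
  rw [low, low, ← add_mul]
  exact mul_le_mul_of_nonneg_right (by exact_mod_cast h) g.δ_pos.le

theorem low_add_le_low {v w : g.Bin} {k : ℕ} (h : (v : ℕ) + k ≤ w) :
    g.low v + k * g.δ ≤ g.low w := by
  rw [low, low, ← add_mul]
  exact mul_le_mul_of_nonneg_right (by exact_mod_cast h) g.δ_pos.le

theorem ofReal_le_obsResistance_of_ge {i : I} {a : ∀ j, A j} {v : g.Bin} {x : ℝ} (hx : 0 ≤ x)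
    (h : ∀ u, g.binOf u = v → g.M i a + x ≤ u) :
    ENNReal.ofReal (g.τ₀ * (2 * x ^ 2)) ≤ g.obsResistance i a v := by
  have := g.isProb i a
  have hτ := g.τ₀_pos
  refine (g.hasResistance_binProb i a v).ofReal_le (by positivity) ?_
  filter_upwards [eventually_pos_nhdsGT_zero] with ε hε
  exact (avgProb_mono (μ := g.law i a) fun u hu => h u hu).trans
    ((avgProb_ge_le (g.bounded i a) hx _).trans (exp_neg_numSamples_le (by positivity) hε))

theorem ofReal_le_obsResistance_of_le {i : I} {a : ∀ j, A j} {v : g.Bin} {x : ℝ} (hx : 0 ≤ x)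
    (h : ∀ u, g.binOf u = v → u ≤ g.M i a - x) :
    ENNReal.ofReal (g.τ₀ * (2 * x ^ 2)) ≤ g.obsResistance i a v := by
  have := g.isProb i a
  have hτ := g.τ₀_pos
  refine (g.hasResistance_binProb i a v).ofReal_le (by positivity) ?_
  filter_upwards [eventually_pos_nhdsGT_zero] with ε hε
  exact (avgProb_mono (μ := g.law i a) fun u hu => h u hu).trans
    ((avgProb_le_le (g.bounded i a) hx _).trans (exp_neg_numSamples_le (by positivity) hε))

theorem low_le_of_binOf_eq {u : ℝ} {v : g.Bin} (hv : 0 < (v : ℕ)) (h : g.binOf u = v) :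
    g.low v ≤ u :=
  g.le_of_lt_binOf hv (by rw [h])

theorem lt_low_add_of_binOf_eq {u : ℝ} {v : g.Bin} (hv : (v : ℕ) < g.m) (h : g.binOf u = v) :
    u < g.low v + g.δ := by
  have e : g.low v + g.δ = ((v : ℕ) + 1 : ℕ) * g.δ := by
    rw [low]
    push_cast
    ring
  rw [e]
  exact g.lt_of_binOf_lt hv (by rw [h]; exact Nat.lt_succ_self _)

theorem bin_le (v : g.Bin) : (v : ℕ) ≤ g.m := Nat.lt_succ_iff.1 v.2

/-- A bin that is not a neighbour of the bin of the mean is at distance at least `δ` from the mean,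
so Hoeffding gives resistance at least `2τ₀δ²`. -/
theorem one_le_obsResistance (hR : g.NoiseControl) {i : I} {a : ∀ j, A j} {v : g.Bin}
    (h : ¬ g.Near v (g.N i a)) : 1 ≤ g.obsResistance i a v := by
  have h1 : (1 : ℝ≥0∞) ≤ ENNReal.ofReal (g.τ₀ * (2 * g.δ ^ 2)) := by
    rw [← ENNReal.ofReal_one]
    refine ENNReal.ofReal_le_ofReal ?_
    have : 1 ≤ 2 * g.τ₀ * g.δ ^ 2 := hR
    linarith
  refine h1.trans ?_
  have hlo := g.low_N_le i a
  have hhi := g.lt_low_N_add i a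
  rcases lt_or_ge (g.N i a : ℕ) (v : ℕ) with hlt | hge
  · have h2 : (g.N i a : ℕ) + 2 ≤ v := by
      by_contra hcon
      exact h ⟨by omega, by omega⟩
    refine g.ofReal_le_obsResistance_of_ge g.δ_pos.le fun u hu => ?_
    have h3 := g.low_le_of_binOf_eq (by omega) hu
    have h4 := g.low_add_le_low h2
    push_cast at h4
    linarith
  · have h2 : (v : ℕ) + 2 ≤ g.N i a := by
      by_contra hcon
      exact h ⟨by omega, by omega⟩
    refine g.ofReal_le_obsResistance_of_le g.δ_pos.le fun u hu => ?_
    have h3 := g.lt_low_add_of_binOf_eq (by have := g.bin_le (g.N i a); omega) hu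
    have h4 := g.low_add_le_low h2
    push_cast at h4
    linarith

theorem M_eq_of_dirac {i : I} {a : ∀ j, A j} {c : ℝ} (h : g.law i a = Measure.dirac c) :
    g.M i a = c := by
  rw [M, h]
  simp

/-- The hypotheses put the mean at positive distance from every bin not near `w`. Above, the edge
`low w + 2δ` is never reached; below, `low w - δ` is the upper edge of the bin `w - 2`, excluded by
`hM` in the random case, while a deterministic utility never leaves its half-open bin. -/
theorem obsResistance_pos {i : I} {a : ∀ j, A j} {v w : g.Bin}
    (hw : g.Near (g.N i a) w)
    (hM : (¬ ∃ c, g.law i a = Measure.dirac c) → g.M i a ≠ g.low w - g.δ)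
    (h : ¬ g.Near v w) : 0 < g.obsResistance i a v := by
  have hτ := g.τ₀_pos
  have hlo := g.low_N_le i a
  have hhi := g.lt_low_N_add i a
  rcases lt_or_ge (w : ℕ) (v : ℕ) with hlt | hge
  · have h2 : (w : ℕ) + 2 ≤ v := by
      by_contra hcon
      exact h ⟨by omega, by omega⟩
    have h3 := g.low_add_le_low h2
    have h4 := g.low_le_low_add (k := 1) hw.1
    push_cast at h3 h4
    have hx : 0 < g.low v - g.M i a := by linarith
    refine lt_of_lt_of_le (ENNReal.ofReal_pos.2 (by positivity))
      (g.ofReal_le_obsResistance_of_ge hx.le fun u hu => ?_)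
    have := g.low_le_of_binOf_eq (by omega) hu
    linarith
  · have h2 : (v : ℕ) + 2 ≤ w := by
      by_contra hcon
      exact h ⟨by omega, by omega⟩
    have h3 := g.low_add_le_low h2
    have h4 := g.low_le_low_add (k := 1) hw.2
    push_cast at h3 h4
    have hv : (v : ℕ) < g.m := by have := g.bin_le w; omega
    by_cases hd : ∃ c, g.law i a = Measure.dirac c
    · obtain ⟨c, hc⟩ := hd
      have hcM := g.M_eq_of_dirac hc
      have hnot : c ∉ {u | g.binOf u = v} := fun hu => by
        have := g.lt_low_add_of_binOf_eq hv hu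
        linarith
      have : HasResistance (fun ε => g.binProb (g.τ ε) i a v) ⊤ := by
        refine .of_eventually_eq_zero ?_
        filter_upwards [(tendsto_numSamples hτ).eventually (eventually_gt_atTop 0)] with ε ht
        have := avgProb_dirac_of_notMem hnot ht
        rw [← hc] at this
        exact this
      rw [obsResistance, this.resistance_eq]
      exact ENNReal.zero_lt_top
    · have h5 := hM hd
      have h6 : g.low w - g.δ < g.M i a := lt_of_le_of_ne (by linarith) (Ne.symm h5)
      have hx : 0 < g.M i a - (g.low v + g.δ) := by linarith
      refine lt_of_lt_of_le (ENNReal.ofReal_pos.2 (by positivity))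
        (g.ofReal_le_obsResistance_of_le hx.le fun u hu => ?_)
      have := g.lt_low_add_of_binOf_eq hv hu
      linarith

theorem variance_pos_of_not_dirac {i : I} {a : ∀ j, A j}
    (hd : ¬ ∃ c, g.law i a = Measure.dirac c) :
    0 < ProbabilityTheory.variance id (g.law i a) := by
  have := g.isProb i a
  refine lt_of_le_of_ne (ProbabilityTheory.variance_nonneg _ _) fun h => hd ⟨_,
    eq_dirac_of_variance_eq_zero (g.bounded i a) h.symm⟩

/-- The mean may be the lower edge of its bin, so concentration alone does not suffice: the average
exceeds the mean with probability of order `1/t`, and passes the upper edge only with exponentially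
small probability. -/
theorem obsResistance_N (i : I) (a : ∀ j, A j) : g.obsResistance i a (g.N i a) = 0 := by
  have := g.isProb i a
  have hτ := g.τ₀_pos
  have hr := g.hasResistance_binProb i a (g.N i a)
  by_cases hd : ∃ c, g.law i a = Measure.dirac c
  · obtain ⟨c, hc⟩ := hd
    have hcM := g.M_eq_of_dirac hc
    have hmem : c ∈ {u | g.binOf u = g.N i a} := by
      rw [← hcM]
      rfl
    refine hr.eq_zero fun q hq => ?_
    filter_upwards [(tendsto_numSamples hτ).eventually (eventually_gt_atTop 0),
      eventually_pos_nhdsGT_zero, eventually_lt_one_nhdsGT_zero] with ε ht hε hε1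
    have := avgProb_dirac_of_mem hmem ht
    rw [← hc] at this
    exact (Real.rpow_le_one hε.le hε1.le hq.le).trans_eq this.symm
  · have hvar := g.variance_pos_of_not_dirac hd
    have hx : 0 < g.low (g.N i a) + g.δ - g.M i a := by linarith [g.lt_low_N_add i a]
    refine HasResistance.eq_zero_of_avg hτ
      (p := fun t => avgProb (g.law i a) t {u | g.binOf u = g.N i a}) hr (half_pos hvar) hx
      fun t ht => ?_
    have h1 := variance_div_le_avgProb_gt (g.bounded i a) ht
    have h2 := avgProb_ge_le (g.bounded i a) hx.le t
    refine (sub_le_sub h1 h2).trans (avgProb_sub_le fun u hu => ?_)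
    by_cases hu2 : u < g.low (g.N i a) + g.δ
    · left
      refine Fin.ext (le_antisymm (Nat.lt_succ_iff.1 (g.binOf_lt_of_lt (Nat.succ_pos _) ?_)) ?_)
      · rw [low] at hu2
        push_cast
        linarith
      · exact Fin.le_def.1 (g.binOf_mono (le_of_lt hu))
    · right
      have : g.low (g.N i a) + g.δ ≤ u := not_lt.1 hu2
      change g.M i a + _ ≤ u
      linarith

/-- Converse of `obsResistance_pos`. If the bin of the mean is not near `w`, it is the witness.
Otherwise a random utility has mean exactly at the upper edge of the bin `w - 2`, and fluctuations
below the mean reach that bin for free. -/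
theorem exists_obsResistance_eq_zero {i : I} {a : ∀ j, A j} {w : g.Bin}
    (h : ¬ (g.Near (g.N i a) w ∧
      ((¬ ∃ c, g.law i a = Measure.dirac c) → g.M i a ≠ g.low w - g.δ))) :
    ∃ v, ¬ g.Near v w ∧ g.obsResistance i a v = 0 := by
  by_cases hw : g.Near (g.N i a) w
  swap
  · exact ⟨_, hw, g.obsResistance_N i a⟩
  have hP := g.isProb i a
  have hτ := g.τ₀_pos
  have hδ := g.δ_pos
  obtain ⟨hd, hM⟩ : (¬ ∃ c, g.law i a = Measure.dirac c) ∧ g.M i a = g.low w - g.δ := by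
    by_contra hcon
    exact h ⟨hw, fun h1 h2 => hcon ⟨h1, h2⟩⟩
  have hvar := g.variance_pos_of_not_dirac hd
  -- Nonnegative samples cannot fall below a zero mean, while positive variance forces them to do
  -- so. Hence `w ≥ 2` and the bin `w - 2` exists.
  have hM0 : 0 < g.M i a := by
    refine lt_of_le_of_ne (g.M_mem_Icc i a).1 fun h0 => ?_
    have h1 := variance_div_le_avgProb_lt (g.bounded i a) one_pos
    have h2 : avgProb (g.law i a) 1 (Set.Iio (g.M i a)) = 0 := by
      rw [avgProb, measureReal_eq_zero_iff, measure_eq_zero_iff_ae_notMem]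
      filter_upwards [ae_pi_forall (g.bounded i a) 1] with u hu hmem
      have := (hu 0).1
      simp [← h0] at hmem
      linarith
    have h3 : ProbabilityTheory.variance id (g.law i a) / 2 / (1 : ℕ) ≤ 0 := h1.trans_eq h2
    simp at h3
    linarith
  have hw2 : 2 ≤ (w : ℕ) := by
    by_contra hlt
    have : (w : ℕ) ≤ 1 := by omega
    have : ((w : ℕ) : ℝ) ≤ 1 := by exact_mod_cast this
    rw [low] at hM
    nlinarith
  have hvw : (w : ℕ) - 2 < g.m + 1 := by have := g.bin_le w; omega
  refine ⟨⟨(w : ℕ) - 2, hvw⟩, fun hn => ?_, ?_⟩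
  · have := hn.2
    simp at this
    omega
  set v : g.Bin := ⟨(w : ℕ) - 2, hvw⟩ with hv
  have hvv : (v : ℕ) + 2 = w := by simp [hv]; omega
  have hlow : g.low v + 2 * g.δ = g.low w := by
    rw [low, low, ← hvv]
    push_cast
    ring
  refine HasResistance.eq_zero_of_avg hτ
    (p := fun t => avgProb (g.law i a) t {u | g.binOf u = v}) (g.hasResistance_binProb i a v)
    (half_pos hvar) hδ fun t ht => ?_
  have h1 := variance_div_le_avgProb_lt (g.bounded i a) ht
  have h2 := avgProb_le_le (g.bounded i a) hδ.le t
  refine (sub_le_sub h1 h2).trans (avgProb_sub_le fun u hu => ?_)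
  have hu' : u < g.M i a := hu
  by_cases hu2 : g.M i a - g.δ < u
  · left
    refine Fin.ext (le_antisymm (Nat.lt_succ_iff.1 (g.binOf_lt_of_lt (Nat.succ_pos _) ?_))
      (g.lt_binOf_of_le (g.bin_le v) ?_))
    · rw [low] at hlow
      push_cast
      linarith
    · rw [low] at hlow
      linarith
  · right
    exact not_lt.1 hu2

end Ritel

/-! ## Resistances of the transitions -/

instance {α : Type*} [Finite α] {m : ℕ} : Finite (AgentState α m) := by
  let code : AgentState α m → Option (Fin 3 × α × Fin (m + 1)) := fun s => match s with
    | .disc => none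
    | .cont b w => some (0, b, w)
    | .hope b w => some (1, b, w)
    | .watch b w => some (2, b, w)
  refine Finite.of_injective code fun s s' h => ?_
  cases s <;> cases s' <;> simp_all [code]

namespace Ritel

variable {I : Type*} {A : I → Type*} (g : Ritel I A)

theorem low_mem_Icc (v : g.Bin) : g.low v ∈ Set.Icc (0 : ℝ) 1 := by
  have h1 : ((v : ℕ) : ℝ) ≤ g.m := by exact_mod_cast g.bin_le v
  have := g.m_mul_δ
  rw [low]
  exact ⟨mul_nonneg (Nat.cast_nonneg _) g.δ_pos.le, by nlinarith [g.δ_pos]⟩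

theorem low_mem_Icc' (v : g.Bin) : g.low v ∈ Set.Icc (0 : ℝ) (1 + 1 / g.m) :=
  ⟨(g.low_mem_Icc v).1, (g.low_mem_Icc v).2.trans (le_add_of_nonneg_right g.δ_pos.le)⟩

theorem F_low_nonneg (v : g.Bin) : 0 ≤ g.F (g.low v) := g.F_nonneg _ (g.low_mem_Icc v)

theorem G_low_nonneg (w v : g.Bin) : 0 ≤ g.G (g.low w) (g.low v) :=
  g.G_nonneg _ (g.low_mem_Icc w) _ (g.low_mem_Icc' v)

section Policies

variable {α : Type*} [DecidableEq α]

/-- Resistance of playing `c` in state `s`. -/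
def actRes (s : AgentState α g.m) (c : α) : ℝ≥0∞ :=
  match s with
  | .disc => 0
  | .cont b w => if c = b then 0 else if (w : ℕ) < g.m then 1 else ⊤
  | .hope b _ => if c = b then 0 else ⊤
  | .watch b _ => if c = b then 0 else ⊤

/-- Resistance of a point mass. -/
def ptRes (s s' : AgentState α g.m) : ℝ≥0∞ := if s' = s then 0 else ⊤

open Classical in
/-- Resistance of updating the state `s` to `s'` after playing `c` and observing bin `v`. -/
noncomputable def updRes (s : AgentState α g.m) (c : α) (v : g.Bin) (s' : AgentState α g.m) : ℝ≥0∞ :=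
  match s with
  | .disc => min (ENNReal.ofReal (g.F (g.low v)) + g.ptRes (.cont c v) s') (0 + g.ptRes .disc s')
  | .cont b w =>
      if c ≠ b then
        if (w : ℕ) + 2 ≤ v then
          min (ENNReal.ofReal (g.G (g.low w) (g.low v)) + g.ptRes (.cont c v) s')
            -- If `G = 0` the improvement is accepted surely, so refusing it has infinite
            -- resistance.
            ((if g.G (g.low w) (g.low v) = 0 then ⊤ else 0) + g.ptRes (.cont b w) s')
        else g.ptRes (.cont b w) s'
      else
        if (w : ℕ) + 2 ≤ v then g.ptRes (.hope b w) s'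
        else if (v : ℕ) + 2 ≤ w then g.ptRes (.watch b w) s'
        else g.ptRes (.cont b w) s'
  | .hope b w =>
      if (w : ℕ) + 2 ≤ v then g.ptRes (.cont c v) s'
      else if (v : ℕ) + 2 ≤ w then g.ptRes (.watch b w) s'
      else g.ptRes (.cont b w) s'
  | .watch b w =>
      if (w : ℕ) + 2 ≤ v then g.ptRes (.hope b w) s'
      else if (v : ℕ) + 2 ≤ w then g.ptRes .disc s'
      else g.ptRes (.cont b w) s'

theorem hasResistance_pt (s s' : AgentState α g.m) :
    HasResistance (fun _ => g.pt s s') (g.ptRes s s') := by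
  by_cases h : s' = s
  · simpa [pt, ptRes, h] using HasResistance.one
  · simpa [pt, ptRes, h] using
      HasResistance.of_eventually_eq_zero (X := fun _ => 0) (Eventually.of_forall fun _ => rfl)

theorem pt_nonneg (s s' : AgentState α g.m) : 0 ≤ g.pt s s' := by
  rw [pt]
  split_ifs <;> norm_num

theorem hasResistance_actionProb [Fintype α] (s : AgentState α g.m) (c : α) :
    HasResistance (fun ε => g.actionProb ε s c) (g.actRes s c) := by
  have h1 : HasResistance (fun _ => (1 : ℝ)) 0 := .one
  have h0 : HasResistance (fun _ => (0 : ℝ)) ⊤ :=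
    .of_eventually_eq_zero (Eventually.of_forall fun _ => rfl)
  cases s with
  | disc =>
    have : 0 < 1 / (Fintype.card α : ℝ) := by
      have : 0 < Fintype.card α := Fintype.card_pos_iff.2 ⟨c⟩
      positivity
    exact .zero_of_mem_Icc this (Eventually.of_forall fun _ => ⟨le_rfl, le_rfl⟩)
  | cont b w =>
    by_cases hc : c = b <;> by_cases hw : (w : ℕ) < g.m <;> simp only [actionProb, actRes, hc, hw,
      if_true, if_false]
    · refine .zero_of_mem_Icc (c := 1 / 2) (C := 1) (by norm_num) ?_
      filter_upwards [eventually_pos_nhdsGT_zero, eventually_nhdsWithin_of_eventually_nhds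
        (gt_mem_nhds (show (0 : ℝ) < 1 / 2 by norm_num))] with ε h h'
      constructor <;> linarith
    · exact h1
    · have hcard : 1 < Fintype.card α := Fintype.one_lt_card_iff.2 ⟨c, b, hc⟩
      have hcard' : (0 : ℝ) < (Fintype.card α : ℝ) - 1 := by
        have : (1 : ℝ) < Fintype.card α := by exact_mod_cast hcard
        linarith
      have := HasResistance.rpow (zero_le_one (α := ℝ))
      simp only [Real.rpow_one, ENNReal.ofReal_one] at this
      refine this.of_le_of_le (c := 1 / ((Fintype.card α : ℝ) - 1))
        (C := 1 / ((Fintype.card α : ℝ) - 1)) (by positivity)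
        (eventually_pos_nhdsGT_zero.mono fun _ h => h.le) ?_ ?_ <;>
      exact Eventually.of_forall fun ε => le_of_eq (by ring)
    · exact h0
  | hope b w =>
    by_cases hc : c = b <;> simp only [actionProb, actRes, hc, if_true, if_false]
    exacts [h1, h0]
  | watch b w =>
    by_cases hc : c = b <;> simp only [actionProb, actRes, hc, if_true, if_false]
    exacts [h1, h0]

theorem actionProb_nonneg [Fintype α] {ε : ℝ} (h0 : 0 < ε) (h1 : ε < 1) (s : AgentState α g.m)
    (c : α) : 0 ≤ g.actionProb ε s c := by
  have hcard : (0 : ℝ) ≤ (Fintype.card α : ℝ) - 1 := by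
    have : 1 ≤ Fintype.card α := Fintype.card_pos_iff.2 ⟨c⟩
    have : (1 : ℝ) ≤ Fintype.card α := by exact_mod_cast this
    linarith
  cases s <;> simp only [actionProb] <;> (try split_ifs) <;> positivity

theorem hasResistance_one_sub_rpow (p : ℝ) (hp : 0 ≤ p) [Decidable (p = 0)] :
    HasResistance (fun ε => 1 - ε ^ p) (if p = 0 then ⊤ else 0) := by
  split_ifs with h
  · subst h
    exact .of_eventually_eq_zero (by simp)
  · have hp' : 0 < p := lt_of_le_of_ne hp (Ne.symm h)
    refine .zero_of_mem_Icc (c := 1 / 2) (C := 1) (by norm_num) ?_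
    filter_upwards [eventually_pos_nhdsGT_zero, (tendsto_rpow_nhdsGT_zero hp').eventually
      (gt_mem_nhds (show (0 : ℝ) < 1 / 2 by norm_num))] with ε h h'
    have := Real.rpow_nonneg h.le p
    constructor <;> linarith

theorem hasResistance_min_rpow (p : ℝ) (hp : 0 ≤ p) :
    HasResistance (fun ε => min (ε ^ p) g.cF) (ENNReal.ofReal p) := by
  obtain ⟨hc0, hc1⟩ := g.cF_mem
  refine (HasResistance.rpow hp).of_le_of_le (c := g.cF) (C := 1) hc0 ?_ ?_ ?_
  · exact eventually_pos_nhdsGT_zero.mono fun ε h => Real.rpow_nonneg h.le p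
  · filter_upwards [eventually_pos_nhdsGT_zero, eventually_lt_one_nhdsGT_zero] with ε h h'
    have h1 := Real.rpow_nonneg h.le p
    have h2 := Real.rpow_le_one h.le h'.le hp
    exact le_min (by nlinarith) (by nlinarith)
  · exact Eventually.of_forall fun ε => by simp

theorem hasResistance_one_sub_min_rpow (p : ℝ) :
    HasResistance (fun ε => 1 - min (ε ^ p) g.cF) 0 := by
  obtain ⟨hc0, hc1⟩ := g.cF_mem
  refine .zero_of_mem_Icc (c := 1 - g.cF) (C := 1) (by linarith) ?_
  filter_upwards [eventually_pos_nhdsGT_zero] with ε h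
  have h1 : 0 ≤ min (ε ^ p) g.cF := le_min (Real.rpow_nonneg h.le p) hc0.le
  have h2 : min (ε ^ p) g.cF ≤ g.cF := min_le_right _ _
  constructor <;> linarith

theorem hasResistance_updateProb (s : AgentState α g.m) (c : α) (v : g.Bin)
    (s' : AgentState α g.m) :
    HasResistance (fun ε => g.updateProb ε s c v s') (g.updRes s c v s') := by
  have hpt := fun s => g.hasResistance_pt s s'
  have hpt0 := fun s => g.pt_nonneg s s'
  obtain ⟨hc0, hc1⟩ := g.cF_mem
  cases s with
  | disc =>
    refine ((g.hasResistance_min_rpow _ (g.F_low_nonneg v)).mul (hpt _)).add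
      ((g.hasResistance_one_sub_min_rpow _).mul (hpt _)) ?_ ?_
    · filter_upwards [eventually_pos_nhdsGT_zero] with ε h
      exact mul_nonneg (le_min (Real.rpow_nonneg h.le _) hc0.le) (hpt0 _)
    · filter_upwards [eventually_pos_nhdsGT_zero] with ε h
      exact mul_nonneg (by linarith [min_le_right (ε ^ g.F (g.low v)) g.cF]) (hpt0 _)
  | cont b w =>
    simp only [updateProb, updRes]
    split_ifs with h1 h2 h3 h4 h5
    · refine ((HasResistance.rpow (g.G_low_nonneg w v)).mul (hpt _)).add
        (HasResistance.mul ?_ (hpt _)) ?_ ?_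
      · convert hasResistance_one_sub_rpow _ (g.G_low_nonneg w v)
        simp [h3]
      · filter_upwards [eventually_pos_nhdsGT_zero] with ε h
        exact mul_nonneg (Real.rpow_nonneg h.le _) (hpt0 _)
      · filter_upwards [eventually_pos_nhdsGT_zero, eventually_lt_one_nhdsGT_zero] with ε h h'
        exact mul_nonneg (by linarith [Real.rpow_le_one h.le h'.le (g.G_low_nonneg w v)]) (hpt0 _)
    · refine ((HasResistance.rpow (g.G_low_nonneg w v)).mul (hpt _)).add
        (HasResistance.mul ?_ (hpt _)) ?_ ?_
      · convert hasResistance_one_sub_rpow _ (g.G_low_nonneg w v)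
        simp [h3]
      · filter_upwards [eventually_pos_nhdsGT_zero] with ε h
        exact mul_nonneg (Real.rpow_nonneg h.le _) (hpt0 _)
      · filter_upwards [eventually_pos_nhdsGT_zero, eventually_lt_one_nhdsGT_zero] with ε h h'
        exact mul_nonneg (by linarith [Real.rpow_le_one h.le h'.le (g.G_low_nonneg w v)]) (hpt0 _)
    all_goals exact hpt _
  | hope b w =>
    simp only [updateProb, updRes]
    split_ifs <;> exact hpt _
  | watch b w =>
    simp only [updateProb, updRes]
    split_ifs <;> exact hpt _

theorem updateProb_nonneg {ε : ℝ} (h0 : 0 < ε) (h1 : ε < 1) (s : AgentState α g.m) (c : α)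
    (v : g.Bin) (s' : AgentState α g.m) : 0 ≤ g.updateProb ε s c v s' := by
  have hpt0 := fun s => g.pt_nonneg s s'
  obtain ⟨hc0, hc1⟩ := g.cF_mem
  cases s with
  | disc =>
    exact add_nonneg (mul_nonneg (le_min (Real.rpow_nonneg h0.le _) hc0.le) (hpt0 _))
      (mul_nonneg (by linarith [min_le_right (ε ^ g.F (g.low v)) g.cF]) (hpt0 _))
  | cont b w =>
    simp only [updateProb]
    split_ifs
    · exact add_nonneg (mul_nonneg (Real.rpow_nonneg h0.le _) (hpt0 _))
        (mul_nonneg (by linarith [Real.rpow_le_one h0.le h1.le (g.G_low_nonneg w v)]) (hpt0 _))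
    all_goals exact hpt0 _
  | hope b w =>
    simp only [updateProb]
    split_ifs <;> exact hpt0 _
  | watch b w =>
    simp only [updateProb]
    split_ifs <;> exact hpt0 _

end Policies

variable [Fintype I] [DecidableEq I] [∀ i, Fintype (A i)] [∀ i, DecidableEq (A i)]

/-- Resistance of moving from `x` to `y` through the action profile `a` and observations `v`. -/
noncomputable def stepCost (x : g.State) (a : ∀ i, A i) (v : I → g.Bin) (y : g.State) : ℝ≥0∞ :=
  ∑ i, (g.actRes (x i) (a i) + g.obsResistance i a (v i) + g.updRes (x i) (a i) (v i) (y i))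

theorem hasResistance_transition (x y : g.State) :
    HasResistance (fun ε => g.transition ε x y)
      (Finset.univ.inf fun a : ∀ i, A i => (∑ i, g.actRes (x i) (a i)) +
        ∑ i, Finset.univ.inf fun v : g.Bin =>
          (g.obsResistance i a v + g.updRes (x i) (a i) v (y i))) := by
  have hpos : ∀ᶠ ε : ℝ in 𝓝[>] 0, 0 < ε ∧ ε < 1 :=
    eventually_pos_nhdsGT_zero.and eventually_lt_one_nhdsGT_zero
  refine HasResistance.sum _ (fun a _ => ?_) (fun a _ => ?_)
  · refine (HasResistance.prod _ fun i _ => g.hasResistance_actionProb _ _).mul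
      (HasResistance.prod _ fun i _ => HasResistance.sum _
        (fun v _ => (g.hasResistance_binProb i a v).mul (g.hasResistance_updateProb _ _ _ _))
        fun v _ => ?_)
    filter_upwards [hpos] with ε h
    exact mul_nonneg (g.binProb_nonneg _ _ _ _) (g.updateProb_nonneg h.1 h.2 _ _ _ _)
  · filter_upwards [hpos] with ε h
    exact mul_nonneg (Finset.prod_nonneg fun i _ => g.actionProb_nonneg h.1 h.2 _ _)
      (Finset.prod_nonneg fun i _ => Finset.sum_nonneg fun v _ =>
        mul_nonneg (g.binProb_nonneg _ _ _ _) (g.updateProb_nonneg h.1 h.2 _ _ _ _))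

theorem res_le_stepCost (x y : g.State) (a : ∀ i, A i) (v : I → g.Bin) :
    g.res x y ≤ g.stepCost x a v y := by
  rw [res, (g.hasResistance_transition x y).resistance_eq]
  refine (Finset.inf_le (Finset.mem_univ a)).trans ?_
  simp only [stepCost, add_assoc]
  rw [Finset.sum_add_distrib]
  gcongr
  exact Finset.inf_le (Finset.mem_univ (v _))

theorem exists_res_eq_stepCost [∀ i, Nonempty (A i)] (x y : g.State) :
    ∃ a v, g.res x y = g.stepCost x a v y := by
  rw [res, (g.hasResistance_transition x y).resistance_eq]
  obtain ⟨a, -, ha⟩ := Finset.exists_mem_eq_inf (Finset.univ : Finset (∀ i, A i))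
    Finset.univ_nonempty (fun a : ∀ i, A i => (∑ i, g.actRes (x i) (a i)) +
        ∑ i, Finset.univ.inf fun v : g.Bin =>
          (g.obsResistance i a v + g.updRes (x i) (a i) v (y i)))
  have hv : ∀ i, ∃ v : g.Bin, (Finset.univ.inf fun v : g.Bin =>
      (g.obsResistance i a v + g.updRes (x i) (a i) v (y i))) =
        g.obsResistance i a v + g.updRes (x i) (a i) v (y i) := fun i => by
    obtain ⟨v, -, hv⟩ := Finset.exists_mem_eq_inf (Finset.univ : Finset g.Bin)
      Finset.univ_nonempty (fun v => g.obsResistance i a v + g.updRes (x i) (a i) v (y i))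
    exact ⟨v, hv⟩
  choose v hv using hv
  refine ⟨a, v, ha.trans ?_⟩
  simp only [stepCost, hv, Finset.sum_add_distrib, add_assoc]

end Ritel

/-! ## Benchmarks -/

namespace AgentState

variable {α : Type*} {m : ℕ}

/-- The benchmark action and bin stored by an agent. -/
def bench : AgentState α m → Option (α × Fin (m + 1))
  | .disc => none
  | .cont b w => some (b, w)
  | .hope b w => some (b, w)
  | .watch b w => some (b, w)

/-- A quantity that decreases when the benchmark bin rises or the agent becomes discontent. -/
def level : AgentState α m → ℕ
  | .disc => 0
  -- The value is at least 1 for every bin, so becoming discontent is always a strict drop.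
  | .cont _ w => m + 1 - w
  | .hope _ w => m + 1 - w
  | .watch _ w => m + 1 - w

theorem bench_eq_none {s : AgentState α m} : s.bench = none ↔ s = .disc := by
  cases s <;> simp [bench]

theorem level_of_bench {s : AgentState α m} {b : α} {w : Fin (m + 1)} (h : s.bench = some (b, w)) :
    s.level = m + 1 - w := by
  cases s <;> simp_all [bench, level]

/-- The state of an agent that did not experiment, observed bin `v` and, if it was discontent,
remained so. -/
def next (s : AgentState α m) (v : Fin (m + 1)) : AgentState α m :=
  match s with
  | .disc => .disc
  | .cont b w =>
      if (w : ℕ) + 2 ≤ v then .hope b w else if (v : ℕ) + 2 ≤ w then .watch b w else .cont b w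
  | .hope b w =>
      if (w : ℕ) + 2 ≤ v then .cont b v else if (v : ℕ) + 2 ≤ w then .watch b w else .cont b w
  | .watch b w =>
      if (w : ℕ) + 2 ≤ v then .hope b w else if (v : ℕ) + 2 ≤ w then .disc else .cont b w

theorem level_next_le (s : AgentState α m) (v : Fin (m + 1)) : (s.next v).level ≤ s.level := by
  cases s <;> simp only [next] <;> (try split_ifs) <;>
    simp only [level, le_refl, zero_le]
  omega

/-- Repeating the same bad or good observation at most twice suffices from any mood: down through
watchful to discontent, up through hopeful to a higher benchmark. -/
theorem level_next_lt_or (s : AgentState α m) {b : α} {v w : Fin (m + 1)}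
    (hs : s.bench = some (b, w)) (h : ¬ ((v : ℕ) ≤ w + 1 ∧ (w : ℕ) ≤ v + 1)) :
    (s.next v).level < s.level ∨ ((s.next v).next v).level < s.level := by
  have hv := v.2
  have hw := w.2
  rcases lt_or_ge (v : ℕ) w with hlt | hge
  · have h1 : ¬ ((w : ℕ) + 2 ≤ v) := by omega
    have h2 : (v : ℕ) + 2 ≤ w := by omega
    cases s
    · simp [bench] at hs
    all_goals
      obtain ⟨rfl, rfl⟩ : _ = b ∧ _ = w := by simpa [bench] using hs
      simp only [next, level, if_neg h1, if_pos h2]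
      omega
  · have h1 : (w : ℕ) + 2 ≤ v := by omega
    cases s
    · simp [bench] at hs
    all_goals
      obtain ⟨rfl, rfl⟩ : _ = b ∧ _ = w := by simpa [bench] using hs
      simp only [next, level, if_pos h1]
      omega

theorem next_of_near {s : AgentState α m} {b : α} {v w : Fin (m + 1)}
    (hs : s.bench = some (b, w)) (h : (v : ℕ) ≤ w + 1 ∧ (w : ℕ) ≤ v + 1) :
    s.next v = .cont b w := by
  have h1 : ¬ ((w : ℕ) + 2 ≤ v) := by omega
  have h2 : ¬ ((v : ℕ) + 2 ≤ w) := by omega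
  cases s
  · simp [bench] at hs
  all_goals
    obtain ⟨rfl, rfl⟩ : _ = b ∧ _ = w := by simpa [bench] using hs
    simp only [next, if_neg h1, if_neg h2]

/-- Playing `c` is not an experiment. -/
def Compat (c : α) (s : AgentState α m) : Prop := ∀ b w, s.bench = some (b, w) → c = b

theorem Compat.next {c : α} {s : AgentState α m} (h : Compat c s) (v : Fin (m + 1)) :
    Compat c (s.next v) := by
  intro b w hs
  cases s <;> simp only [AgentState.next] at hs
  · simp [bench] at hs
  all_goals
    rename_i b' w'
    have := h b' w' rfl
    subst this
    split_ifs at hs <;> simp_all [bench]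

end AgentState

/-! ### Costs and acceptance potential of one agent. -/

namespace Ritel

open AgentState

variable {I : Type*} {A : I → Type*} (g : Ritel I A)

section Agent

variable {α : Type*}

/-- Resistance of becoming content with the present benchmark bin. -/
noncomputable def pot (s : AgentState α g.m) : ℝ≥0∞ :=
  match s with
  | .disc => 0
  | .cont _ w => ENNReal.ofReal (g.F (g.low w))
  | .hope _ w => ENNReal.ofReal (g.F (g.low w))
  | .watch _ w => ENNReal.ofReal (g.F (g.low w))

theorem pot_of_bench {s : AgentState α g.m} {b : α} {w : g.Bin} (h : s.bench = some (b, w)) :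
    g.pot s = ENNReal.ofReal (g.F (g.low w)) := by
  cases s <;> simp_all [bench, pot]

theorem pot_le_of_level_le {s s' : AgentState α g.m} {b : α} {w : g.Bin}
    (hs : s.bench = some (b, w)) (h : s'.level ≤ s.level) : g.pot s' ≤ g.pot s := by
  rw [g.pot_of_bench hs]
  rw [level_of_bench hs] at h
  rcases hs' : s'.bench with _ | ⟨b', w'⟩
  · rw [bench_eq_none.1 hs']
    exact bot_le
  · rw [level_of_bench hs'] at h
    rw [g.pot_of_bench hs']
    have hw := w.2
    have hw' := w'.2
    have h1 : (w : ℕ) + 0 ≤ w' := by omega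
    have h2 := g.low_add_le_low h1
    simp only [Nat.cast_zero, zero_mul, add_zero] at h2
    exact ENNReal.ofReal_le_ofReal (g.F_anti (g.low_mem_Icc w) (g.low_mem_Icc w') h2)

variable [DecidableEq α]

theorem actRes_of_compat {c : α} {s : AgentState α g.m} (h : Compat c s) : g.actRes s c = 0 := by
  cases s <;> simp only [actRes]
  all_goals
    rename_i b w
    rw [if_pos (h b w rfl)]

theorem updRes_next {c : α} {s : AgentState α g.m} (h : Compat c s) (v : g.Bin) :
    g.updRes s c v (s.next v) = 0 := by
  cases s <;> simp only [updRes, next]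
  · simp [ptRes]
  all_goals
    rename_i b w
    have := h b w rfl
    subst this
    (try simp only [ne_eq, not_true_eq_false, if_false])
    split_ifs <;> simp [ptRes]

theorem one_le_actRes {c : α} {s : AgentState α g.m} {b : α} {w : g.Bin}
    (hs : s.bench = some (b, w)) (hc : c ≠ b) : 1 ≤ g.actRes s c := by
  cases s <;> simp_all [bench, actRes]
  split_ifs <;> simp

theorem ptRes_ne_top {s s' : AgentState α g.m} (h : g.ptRes s s' ≠ ⊤) : s' = s := by
  by_contra hne
  simp [ptRes, hne] at h

theorem eq_next_of_updRes_ne_top {b : α} {w : g.Bin} {s : AgentState α g.m}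
    (hs : s.bench = some (b, w)) {v : g.Bin}
    {s' : AgentState α g.m} (h : g.updRes s b v s' ≠ ⊤) : s' = s.next v := by
  cases s
  · simp [bench] at hs
  all_goals
    obtain ⟨rfl, rfl⟩ : _ = b ∧ _ = w := by simpa [bench] using hs
    simp only [updRes, ne_eq, not_true_eq_false, if_false, AgentState.next] at h ⊢
    split_ifs at h ⊢ <;> exact g.ptRes_ne_top h

theorem updRes_experiment {b c : α} (hc : c ≠ b) {w v : g.Bin} {s' : AgentState α g.m}
    (h : g.updRes (.cont b w) c v s' ≠ ⊤) :
    s' = .cont b w ∨ s' = .cont c v ∧ (w : ℕ) + 2 ≤ v ∧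
      ENNReal.ofReal (g.G (g.low w) (g.low v)) ≤ g.updRes (.cont b w) c v s' := by
  by_cases h0 : s' = .cont b w
  · exact Or.inl h0
  right
  simp only [updRes, ne_eq, hc, not_false_eq_true, if_true] at h ⊢
  by_cases h1 : (w : ℕ) + 2 ≤ v
  · simp only [h1, if_true] at h ⊢
    have e : g.ptRes (.cont b w) s' = ⊤ := by simp [ptRes, h0]
    simp only [e, add_top, min_top_right] at h ⊢
    exact ⟨g.ptRes_ne_top fun e' => h (by rw [e', add_top]), trivial, le_self_add⟩
  · simp only [h1, if_false] at h
    exact absurd (g.ptRes_ne_top h) h0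

/-- A benchmark is lost only by becoming discontent, by a hopeful agent adopting a bin at least two
higher, or by an accepted experiment, which also gains two bins. -/
theorem level_lt_or_bench_eq {s s' : AgentState α g.m} {c b : α} {w v : g.Bin}
    (hs : s.bench = some (b, w)) (ha : g.actRes s c ≠ ⊤) (h : g.updRes s c v s' ≠ ⊤) :
    s'.level < s.level ∨ s'.bench = s.bench := by
  have hv := v.2
  have hw := w.2
  by_cases hc : c = b
  · subst hc
    rw [g.eq_next_of_updRes_ne_top hs h]
    cases s <;> simp only [AgentState.next] <;> (try split_ifs) <;>
      simp_all [bench, level]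
    omega
  · cases s with
    | disc => simp [bench] at hs
    | cont b' w' =>
      obtain ⟨rfl, rfl⟩ : b' = b ∧ w' = w := by simpa [bench] using hs
      rcases g.updRes_experiment hc h with rfl | ⟨rfl, h1, -⟩
      · exact Or.inr rfl
      · left
        simp only [level]
        omega
    | hope b' w' =>
      obtain ⟨rfl, rfl⟩ : b' = b ∧ w' = w := by simpa [bench] using hs
      simp [actRes, hc] at ha
    | watch b' w' =>
      obtain ⟨rfl, rfl⟩ : b' = b ∧ w' = w := by simpa [bench] using hs
      simp [actRes, hc] at ha

theorem pot_le_of_nondisc {s s' : AgentState α g.m} {c b : α} {w v : g.Bin}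
    (hs : s.bench = some (b, w)) (ha : g.actRes s c ≠ ⊤) (h : g.updRes s c v s' ≠ ⊤) :
    g.pot s' ≤ g.pot s := by
  rcases g.level_lt_or_bench_eq hs ha h with h1 | h1
  · exact g.pot_le_of_level_le hs h1.le
  · rw [hs] at h1
    rw [g.pot_of_bench hs, g.pot_of_bench h1]

/-- Only a discontent agent can raise its `pot`, and it pays exactly `F` of the accepted bin; for
the others the bin does not fall and `F` is non-increasing. -/
theorem pot_le_add {s s' : AgentState α g.m} {c : α} {v : g.Bin} {q : ℝ≥0∞} :
    g.pot s' ≤ g.pot s + (g.actRes s c + q + g.updRes s c v s') := by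
  by_cases ha : g.actRes s c = ⊤
  · simp [ha]
  by_cases hu : g.updRes s c v s' = ⊤
  · simp [hu]
  rcases hs : s.bench with _ | ⟨b, w⟩
  · obtain rfl := bench_eq_none.1 hs
    refine le_trans ?_ (le_add_left le_add_self)
    simp only [updRes, zero_add]
    refine le_min ?_ ?_
    · by_cases e : s' = .cont c v
      · simp [e, pot]
      · simp [ptRes, e]
    · by_cases e : s' = .disc
      · simp [e, pot]
      · simp [ptRes, e]
  · exact (g.pot_le_of_nondisc hs ha hu).trans le_self_add

end Agent

end Ritel

/-! ### Basins, ranks and zero-resistance descents. -/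

namespace Ritel

open AgentState

variable {I : Type*} {A : I → Type*} (g : Ritel I A)

/-- The states without discontent agent and with given benchmarks. -/
def basin (b : g.Bench) : Set g.State := {y | ∀ i, (y i).bench = some (b.1 i, b.2 i)}

theorem content_mem_basin (b : g.Bench) : g.content b ∈ g.basin b := fun _ => rfl

theorem eq_of_mem_basin {b b' : g.Bench} {y : g.State} (h : y ∈ g.basin b) (h' : y ∈ g.basin b') :
    b = b' := by
  have : ∀ i, b.1 i = b'.1 i ∧ b.2 i = b'.2 i := fun i => by
    have := (h i).symm.trans (h' i)
    simpa using this
  exact Prod.ext (funext fun i => (this i).1) (funext fun i => (this i).2)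

theorem level_eq_of_mem_basin {b : g.Bench} {y : g.State} (hy : y ∈ g.basin b) (i : I) :
    (y i).level = (g.content b i).level := by
  rw [level_of_bench (hy i)]
  rfl

/-- The state in which all agents are discontent. -/
def allDisc : g.State := fun _ => .disc

/-- Being near `w` confines the mean to the half-open interval `[low w - δ, low w + 2δ)`; two of its
points differ by strictly less than `3δ`. -/
theorem not_near_of_dist {i : I} {a a' : ∀ j, A j} {w : g.Bin}
    (h : 3 * g.δ ≤ |g.M i a' - g.M i a|) (h1 : g.Near (g.N i a) w) : ¬ g.Near (g.N i a') w := by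
  intro h2
  have e1 := g.low_le_low_add (k := 1) h1.1
  have e2 := g.low_le_low_add (k := 1) h1.2
  have e3 := g.low_le_low_add (k := 1) h2.1
  have e4 := g.low_le_low_add (k := 1) h2.2
  push_cast at e1 e2 e3 e4
  have := g.low_N_le i a
  have := g.low_N_le i a'
  have := g.lt_low_N_add i a
  have := g.lt_low_N_add i a'
  rcases le_abs.1 h with h | h <;> linarith

theorem strongAligned_subset_weakAligned : g.strongAligned ⊆ g.weakAligned := by
  intro b hb i
  have h := hb i
  refine ⟨?_, fun _ hM => ?_⟩
  · rw [h]
    exact ⟨Nat.le_succ _, Nat.le_succ _⟩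
  · have := g.low_N_le i b.1
    rw [h] at this
    linarith [g.δ_pos]

section Total

variable [Fintype I]

/-- Sum of the levels of the agents. -/
def total (y : g.State) : ℕ := ∑ i, (y i).level

/-- Sum of the acceptance resistances of the agents. -/
noncomputable def totalPot (y : g.State) : ℝ≥0∞ := ∑ i, g.pot (y i)

theorem total_of_mem_basin {b : g.Bench} {y : g.State} (h : y ∈ g.basin b) :
    g.total y = g.total (g.content b) :=
  Finset.sum_congr rfl fun i _ => by rw [level_of_bench (h i)]; rfl

open Classical in
/-- The rank by which the states are attached to a tree. -/
noncomputable def rank (y : g.State) : ℕ :=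
  -- Doubling lets a drop of `total` outweigh the tie-break, which places an aligned content state
  -- below the rest of its basin.
  2 * g.total y + if ∃ b ∈ g.weakAligned, y = g.content b then 0 else 1

theorem rank_lt_of_total_lt {y z : g.State} (h : g.total z < g.total y) : g.rank z < g.rank y := by
  rw [rank, rank]
  split_ifs <;> omega

end Total

variable [Fintype I] [DecidableEq I]

theorem sum_obsResistance_update (a : ∀ i, A i) (i : I) (v : g.Bin) :
    ∑ j, g.obsResistance j a (Function.update (fun j => g.N j a) i v j) =
      g.obsResistance i a v := by
  rw [Finset.sum_eq_single i]
  · rw [Function.update_self]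
  · intro j _ hj
    rw [Function.update_of_ne hj, g.obsResistance_N]
  · simp

variable [∀ i, Fintype (A i)] [∀ i, DecidableEq (A i)]

theorem res_step_le {y : g.State} {a : ∀ i, A i} (h : ∀ i, Compat (a i) (y i)) (v : I → g.Bin) :
    g.res y (fun i => (y i).next (v i)) ≤ ∑ i, g.obsResistance i a (v i) := by
  refine (g.res_le_stepCost _ _ a v).trans (le_of_eq ?_)
  exact Finset.sum_congr rfl fun i _ => by
    rw [g.actRes_of_compat (h i), g.updRes_next (h i), zero_add, add_zero]

/-- Agent `i` observes `v` once or twice while all others observe the bins of their means for free;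
no level rises and that of `i` drops. -/
theorem exists_path_total_lt {y : g.State} {a : ∀ i, A i} (h : ∀ i, Compat (a i) (y i)) {i : I}
    {b : A i} {w v : g.Bin} (hi : (y i).bench = some (b, w)) (hv : ¬ g.Near v w) :
    ∃ c ≤ 2 * g.obsResistance i a v, PathCost g.res {u | g.total u < g.total y} y c := by
  set V : I → g.Bin := Function.update (fun j => g.N j a) i v with hV
  have hVi : V i = v := by simp [hV]
  set y₁ : g.State := fun j => (y j).next (V j) with hy₁
  set y₂ : g.State := fun j => (y₁ j).next (V j) with hy₂
  have h₁ : g.res y y₁ ≤ g.obsResistance i a v := by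
    rw [← g.sum_obsResistance_update a i v]
    exact g.res_step_le h V
  have h₂ : g.res y₁ y₂ ≤ g.obsResistance i a v := by
    rw [← g.sum_obsResistance_update a i v]
    exact g.res_step_le (fun j => (h j).next _) V
  have hle₁ : ∀ j, (y₁ j).level ≤ (y j).level := fun j => level_next_le _ _
  have hle₂ : ∀ j, (y₂ j).level ≤ (y j).level := fun j => (level_next_le _ _).trans (hle₁ j)
  rcases level_next_lt_or (y i) hi hv with hlt | hlt
  · refine ⟨g.res y y₁, h₁.trans (le_mul_of_one_le_left' one_le_two), .single ?_⟩
    refine Finset.sum_lt_sum (fun j _ => hle₁ j) ⟨i, Finset.mem_univ i, ?_⟩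
    simpa [hy₁, hVi] using hlt
  · refine ⟨g.res y y₁ + g.res y₁ y₂, by rw [two_mul]; exact add_le_add h₁ h₂, .cons (.single ?_)⟩
    refine Finset.sum_lt_sum (fun j _ => hle₂ j) ⟨i, Finset.mem_univ i, ?_⟩
    simpa [hy₂, hy₁, hVi] using hlt

theorem res_to_content {b : g.Bench} (hb : b ∈ g.weakAligned) {y : g.State} (hy : y ∈ g.basin b) :
    g.res y (g.content b) = 0 := by
  have hc : ∀ i, Compat (b.1 i) (y i) := fun i b' w' h => by
    rw [hy i] at h
    simp only [Option.some.injEq, Prod.mk.injEq] at h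
    exact h.1
  have h := g.res_step_le hc fun i => g.N i b.1
  have e : (fun i => (y i).next (g.N i b.1)) = g.content b :=
    funext fun i => next_of_near (hy i) (hb i).1
  rw [e] at h
  simpa [g.obsResistance_N] using h

variable [∀ i, Nonempty (A i)]

theorem exists_agent_costs {y z : g.State} (h : g.res y z ≠ ⊤) :
    ∃ a : ∀ i, A i, ∃ v : I → g.Bin, ∀ i, g.actRes (y i) (a i) ≠ ⊤ ∧
      g.updRes (y i) (a i) (v i) (z i) ≠ ⊤ := by
  obtain ⟨a, v, e⟩ := g.exists_res_eq_stepCost y z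
  refine ⟨a, v, fun i => ?_⟩
  rw [e, stepCost, ENNReal.sum_ne_top] at h
  have := h i (Finset.mem_univ i)
  rw [ENNReal.add_ne_top, ENNReal.add_ne_top] at this
  exact ⟨this.1.1, this.2⟩

theorem total_lt_of_exit {b : g.Bench} {y z : g.State} (hy : y ∈ g.basin b) (hz : z ∉ g.basin b)
    (h : g.res y z ≠ ⊤) : g.total z < g.total y := by
  obtain ⟨a, v, hav⟩ := g.exists_agent_costs h
  have hstep := fun i => g.level_lt_or_bench_eq (hy i) (hav i).1 (hav i).2
  obtain ⟨i, hi⟩ : ∃ i, (z i).bench ≠ some (b.1 i, b.2 i) := by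
    by_contra! hcon
    exact hz hcon
  refine Finset.sum_lt_sum (fun j _ => ?_) ⟨i, Finset.mem_univ i, ?_⟩
  · rcases hstep j with h1 | h1
    · exact h1.le
    · rw [hy j] at h1
      rw [level_of_bench h1, level_of_bench (hy j)]
  · rcases hstep i with h1 | h1
    · exact h1
    · exact absurd (h1.trans (hy i)) hi

theorem totalPot_le_add (y z : g.State) : g.totalPot z ≤ g.totalPot y + g.res y z := by
  obtain ⟨a, v, e⟩ := g.exists_res_eq_stepCost y z
  rw [e, totalPot, totalPot, stepCost, ← Finset.sum_add_distrib]
  exact Finset.sum_le_sum fun i _ => g.pot_le_add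

theorem totalPot_le_of_mem_basin {b : g.Bench} {y z : g.State} (hy : y ∈ g.basin b)
    (h : g.res y z ≠ ⊤) : g.totalPot z ≤ g.totalPot y := by
  obtain ⟨a, v, hav⟩ := g.exists_agent_costs h
  exact Finset.sum_le_sum fun i _ => g.pot_le_of_nondisc (hy i) (hav i).1 (hav i).2

/-- With some but not all agents discontent, these change their actions freely, and interdependence
moves the mean of another agent by `3δ`: before or after the move its observation is not near its
benchmark. With none discontent, either the benchmarks are aligned and the moods relax to content,
or misalignment supplies a free observation that is not near. -/
theorem exists_path_rank_lt (hinter : g.Interdependent3) {y : g.State} (hyD : y ≠ g.allDisc)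
    (hy : ¬ ∃ b ∈ g.weakAligned, y = g.content b) :
    PathCost g.res {u | g.rank u < g.rank y} y 0 := by
  classical
  have conv : ∀ {a : ∀ i, A i} (_ : ∀ i, Compat (a i) (y i)) {i : I} {b : A i} {w v : g.Bin}
      (_ : (y i).bench = some (b, w)) (_ : ¬ g.Near v w) (_ : g.obsResistance i a v = 0),
      PathCost g.res {u | g.rank u < g.rank y} y 0 := by
    intro a ha i b w v hi hv h0
    obtain ⟨c, hc, hp⟩ := g.exists_path_total_lt ha hi hv
    rw [h0, mul_zero, nonpos_iff_eq_zero] at hc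
    rw [hc] at hp
    exact hp.mono fun u hu => g.rank_lt_of_total_lt hu
  let a : ∀ i, A i := fun i => match (y i).bench with
    | none => Classical.arbitrary _
    | some p => p.1
  have ha : ∀ i, Compat (a i) (y i) := fun i b w h => by simp [a, h]
  by_cases hdisc : ∃ i, y i = .disc
  · set J : Finset I := Finset.univ.filter fun i => y i = .disc with hJ
    have hJ1 : J.Nonempty := by
      obtain ⟨i, hi⟩ := hdisc
      exact ⟨i, by simp [hJ, hi]⟩
    have hJ2 : J ≠ Finset.univ := fun e => hyD (funext fun i => by
      have : i ∈ J := e ▸ Finset.mem_univ i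
      simpa [hJ, allDisc] using this)
    obtain ⟨i, hiJ, a', ha'⟩ := hinter a J hJ1 hJ2
    have hcomp : ∀ j, Compat (J.piecewise a' a j) (y j) := fun j => by
      by_cases hj : j ∈ J
      · have : y j = .disc := by simpa [hJ] using hj
        intro b w h
        simp [this, bench] at h
      · rw [Finset.piecewise_eq_of_notMem _ _ _ hj]
        exact ha j
    obtain ⟨⟨b, w⟩, hbw⟩ : ∃ p, (y i).bench = some p := by
      rcases h : (y i).bench with _ | p
      · exact absurd (by simpa [hJ] using bench_eq_none.1 h) hiJ
      · exact ⟨p, rfl⟩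
    by_cases hn : g.Near (g.N i a) w
    · exact conv hcomp hbw (g.not_near_of_dist ha' hn) (g.obsResistance_N _ _)
    · exact conv ha hbw hn (g.obsResistance_N _ _)
  · have hb : ∀ i, ∃ p, (y i).bench = some p := fun i => by
      rcases h : (y i).bench with _ | p
      · exact absurd ⟨i, bench_eq_none.1 h⟩ hdisc
      · exact ⟨p, rfl⟩
    choose p hp using hb
    set b : g.Bench := (fun i => (p i).1, fun i => (p i).2) with hbdef
    have hyb : y ∈ g.basin b := hp
    have hab : a = b.1 := funext fun i => by simp [a, hp, hbdef]
    by_cases hw : b ∈ g.weakAligned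
    · rw [← g.res_to_content hw hyb]
      refine .single ?_
      have h1 : ∃ b' ∈ g.weakAligned, g.content b = g.content b' := ⟨b, hw, rfl⟩
      change g.rank _ < g.rank _
      rw [rank, rank, g.total_of_mem_basin hyb, if_pos h1, if_neg hy]
      exact Nat.lt_succ_self _
    · obtain ⟨i, hi⟩ : ∃ i, ¬ (g.Near (g.N i b.1) (b.2 i) ∧
          ((¬ ∃ c, g.law i b.1 = Measure.dirac c) → g.M i b.1 ≠ g.low (b.2 i) - g.δ)) := by
        by_contra hcon
        exact hw fun i => by_contra fun h => hcon ⟨i, h⟩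
      obtain ⟨v, hv, h0⟩ := g.exists_obsResistance_eq_zero hi
      rw [← hab] at h0
      exact conv ha (hyb i) hv h0

/-- The path is cut at its first exit, where `total` drops by `total_lt_of_exit`. -/
theorem exists_path_of_exit {b : g.Bench} {y : g.State} {c : ℝ≥0∞}
    (h : PathCost g.res (g.basin b)ᶜ y c) (hc : c ≠ ⊤) (hy : y ∈ g.basin b) :
    ∃ c' ≤ c, PathCost g.res {u | g.total u < g.total (g.content b)} y c' := by
  induction h with
  | nil h => exact absurd hy h
  | @cons y z c _ ih =>
    rw [ENNReal.add_ne_top] at hc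
    by_cases hz : z ∈ g.basin b
    · obtain ⟨c', hc', hp⟩ := ih hc.2 hz
      exact ⟨g.res y z + c', by gcongr, .cons hp⟩
    · refine ⟨g.res y z, le_self_add, .single ?_⟩
      change g.total _ < _
      rw [← g.total_of_mem_basin hy]
      exact g.total_lt_of_exit hy hz hc.1

end Ritel

/-! ### Escape resistance of a basin. -/

namespace Ritel

open AgentState

variable {I : Type*} {A : I → Type*} (g : Ritel I A)
variable [Fintype I] [DecidableEq I] [∀ i, Fintype (A i)] [∀ i, DecidableEq (A i)]

/-- Minimal resistance of a path that leaves the benchmarks `b`. -/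
noncomputable def escape (b : g.Bench) : ℝ≥0∞ := distTo g.res (g.basin b)ᶜ (g.content b)

/-! ### Upper bounds on the escape resistance -/

theorem res_experiment_le {y : g.State} {a : ∀ i, A i} {i : I} {c : A i} {b : A i} {w : g.Bin}
    (hy : ∀ j, j ≠ i → Compat (a j) (y j)) (hyi : y i = .cont b w) (hw : (w : ℕ) < g.m)
    (s : AgentState (A i) g.m) :
    g.res y (Function.update (fun j => (y j).next (g.N j (Function.update a i c))) i s) ≤
      1 + g.updRes (.cont b w) c (g.N i (Function.update a i c)) s := by
  refine (g.res_le_stepCost _ _ (Function.update a i c)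
    fun j => g.N j (Function.update a i c)).trans ?_
  rw [stepCost, ← Finset.add_sum_erase _ _ (Finset.mem_univ i)]
  rw [Finset.sum_eq_zero]
  · rw [add_zero, g.obsResistance_N, add_zero, Function.update_self, Function.update_self, hyi]
    gcongr
    simp only [actRes, hw, if_true]
    split_ifs <;> simp
  · intro j hj
    have hji := Finset.ne_of_mem_erase hj
    rw [g.obsResistance_N, Function.update_of_ne hji, Function.update_of_ne hji,
      g.actRes_of_compat (hy j hji), g.updRes_next (hy j hji)]
    simp

theorem escape_le_one_add {b : g.Bench} {i : I} {c : A i} (hc : c ≠ b.1 i)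
    (h : (b.2 i : ℕ) + 2 ≤ g.N i (Function.update b.1 i c)) :
    g.escape b ≤ 1 + ENNReal.ofReal (g.G (g.low (b.2 i))
      (g.low (g.N i (Function.update b.1 i c)))) := by
  have hw : (b.2 i : ℕ) < g.m := by
    have := g.bin_le (g.N i (Function.update b.1 i c))
    omega
  have h1 := g.res_experiment_le (y := g.content b) (a := b.1) (i := i) (c := c)
    (b := b.1 i) (w := b.2 i) (fun j _ b' w' hb => by
      simp only [content, bench, Option.some.injEq, Prod.mk.injEq] at hb
      exact hb.1) rfl hw (.cont c (g.N i (Function.update b.1 i c)))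
  refine (distTo_le (.single fun hmem => ?_)).trans (h1.trans ?_)
  · have := hmem i
    simp only [Function.update_self, bench, Option.some.injEq, Prod.mk.injEq] at this
    exact hc this.1
  · gcongr
    simp only [updRes, ne_eq, hc, not_false_eq_true, if_true, h]
    exact (min_le_left _ _).trans (by simp [ptRes])

/-- An agent below the top bin experiments twice at cost 1 each. By interdependence its deviation
moves the mean of some other agent `j` by `3δ`, so two observations make `j` lose its benchmark. -/
theorem escape_le_two [Nontrivial I] (hinter : g.Interdependent3) {b : g.Bench}
    (hb : b ∈ g.weakAligned) (hopt : b ∉ g.weakOpt) : g.escape b ≤ 2 := by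
  obtain ⟨i, hi⟩ : ∃ i, (b.2 i : ℕ) ≠ g.m := by
    by_contra! hcon
    exact hopt ⟨hb, hcon⟩
  have hw : (b.2 i : ℕ) < g.m := lt_of_le_of_ne (g.bin_le _) hi
  obtain ⟨j, hj, a', ha'⟩ := hinter b.1 {i} (Finset.singleton_nonempty i) (fun e => by
    obtain ⟨k, hk⟩ := exists_ne i
    exact hk (Finset.mem_singleton.1 (e ▸ Finset.mem_univ k)))
  have hji : j ≠ i := fun e => hj (by simp [e])
  rw [Finset.piecewise_singleton] at ha'
  set c := a' i with hc
  set p := Function.update b.1 i c with hp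
  have hcb : c ≠ b.1 i := fun e => by
    rw [hp, e, Function.update_eq_self, sub_self, abs_zero] at ha'
    linarith [g.δ_pos]
  have hnear := g.not_near_of_dist ha' (hb j).1
  have hcompat : ∀ k, Compat (b.1 k) (g.content b k) := fun k b' w' hb => by
    simp only [content, bench, Option.some.injEq, Prod.mk.injEq] at hb
    exact hb.1
  -- The experimenter must be able to refuse the new action in order to repeat it. If it cannot,
  -- acceptance is free and the first experiment already leaves the basin.
  by_cases hacc : (b.2 i : ℕ) + 2 ≤ g.N i p ∧ g.G (g.low (b.2 i)) (g.low (g.N i p)) = 0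
  · refine (g.escape_le_one_add hcb hacc.1).trans ?_
    rw [← hp, hacc.2]
    simp
  have hupd : g.updRes (.cont (b.1 i) (b.2 i)) c (g.N i p) (.cont (b.1 i) (b.2 i)) = 0 := by
    simp only [updRes, ne_eq, hcb, not_false_eq_true, if_true]
    split_ifs with h1 h2
    · exact absurd ⟨h1, h2⟩ hacc
    · simp [ptRes]
    · simp [ptRes]
  set y₁ : g.State := Function.update (fun k => (g.content b k).next (g.N k p)) i
    (.cont (b.1 i) (b.2 i)) with hy₁
  set y₂ : g.State := Function.update (fun k => (y₁ k).next (g.N k p)) i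
    (.cont (b.1 i) (b.2 i)) with hy₂
  have h₁ : g.res (g.content b) y₁ ≤ 1 := by
    have := g.res_experiment_le (y := g.content b) (a := b.1) (c := c)
      (fun k _ => hcompat k) rfl hw (.cont (b.1 i) (b.2 i))
    rwa [hupd, add_zero] at this
  have h₂ : g.res y₁ y₂ ≤ 1 := by
    have := g.res_experiment_le (y := y₁) (a := b.1) (i := i) (c := c) (b := b.1 i) (w := b.2 i)
      (fun k hk => by
        rw [hy₁, Function.update_of_ne hk]
        exact (hcompat k).next _) (by rw [hy₁, Function.update_self]) hw
      (.cont (b.1 i) (b.2 i))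
    rwa [hupd, add_zero] at this
  have hy₁j : y₁ j = (g.content b j).next (g.N j p) := by rw [hy₁, Function.update_of_ne hji]
  have hy₂j : y₂ j = ((g.content b j).next (g.N j p)).next (g.N j p) := by
    rw [hy₂, Function.update_of_ne hji, hy₁j]
  rcases level_next_lt_or (g.content b j) (g.content_mem_basin b j) hnear with hlt | hlt
  · refine (distTo_le (.single (z := y₁) fun hmem => ?_)).trans (h₁.trans one_le_two)
    have := g.level_eq_of_mem_basin hmem j
    rw [hy₁j] at this
    exact hlt.ne this
  · refine (distTo_le (.cons (z := y₁) (.single (z := y₂) fun hmem => ?_))).trans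
      ((add_le_add h₁ h₂).trans (by norm_num))
    have := g.level_eq_of_mem_basin hmem j
    rw [hy₂j] at this
    exact hlt.ne this

/-- At an optimal state no agent experiments, and noise is the only way out; its resistance is
finite because `𝒜` is empty. -/
theorem escape_ne_top [Nontrivial I] (hinter : g.Interdependent3) (hA : g.absorbingOpt = ∅)
    {b : g.Bench} (hb : b ∈ g.weakAligned) : g.escape b ≠ ⊤ := by
  by_cases hopt : b ∈ g.weakOpt
  · have hn : g.noise b ≠ ⊤ := fun h => by
      have : b ∈ g.absorbingOpt := ⟨hopt, h⟩
      rw [hA] at this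
      exact this
    obtain ⟨i, v, hv, hfin⟩ : ∃ i v, ¬ g.Near v (b.2 i) ∧ g.obsResistance i b.1 v ≠ ⊤ := by
      by_contra! hcon
      exact hn (by simpa [noise, iInf_eq_top] using hcon)
    have hcompat : ∀ k, Compat (b.1 k) (g.content b k) := fun k b' w' hb => by
      simp only [content, bench, Option.some.injEq, Prod.mk.injEq] at hb
      exact hb.1
    obtain ⟨c, hc, hp⟩ := g.exists_path_total_lt hcompat (g.content_mem_basin b i) hv
    refine ne_top_of_le_ne_top (ENNReal.mul_ne_top (by norm_num) hfin) (le_trans (distTo_le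
      (hp.mono fun u hu hmem => ?_)) hc)
    exact (ne_of_lt hu) (g.total_of_mem_basin hmem)
  · exact ne_top_of_le_ne_top (by norm_num) (g.escape_le_two hinter hb hopt)

/-! ### Lower bounds on the escape resistance -/

variable [∀ i, Nonempty (A i)]

theorem one_le_res_of_mem_basin (hR : g.NoiseControl) {b : g.Bench} (hb : b ∈ g.strongAligned)
    {y z : g.State} (hy : y ∈ g.basin b) (hz : z ≠ g.content b) : 1 ≤ g.res y z := by
  obtain ⟨a, v, e⟩ := g.exists_res_eq_stepCost y z
  rw [e]
  by_cases ha : ∃ i, a i ≠ b.1 i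
  · obtain ⟨i, hi⟩ := ha
    refine le_trans ?_ (Finset.single_le_sum (fun _ _ => bot_le) (Finset.mem_univ i))
    exact (g.one_le_actRes (hy i) hi).trans (le_add_right le_self_add)
  · have hab : a = b.1 := funext fun i => not_not.1 (not_exists.1 ha i)
    obtain ⟨i, hi⟩ := Function.ne_iff.1 hz
    refine le_trans ?_ (Finset.single_le_sum (fun _ _ => bot_le) (Finset.mem_univ i))
    by_cases hn : g.Near (v i) (b.2 i)
    · have : g.updRes (y i) (a i) (v i) (z i) = ⊤ := by
        by_contra hfin
        rw [hab] at hfin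
        have h1 := g.eq_next_of_updRes_ne_top (hy i) hfin
        rw [next_of_near (hy i) hn] at h1
        exact hi h1
      rw [this, add_top]
      exact le_top
    · rw [hab]
      have := g.one_le_obsResistance hR (i := i) (a := b.1) (v := v i) (by rwa [hb i])
      exact this.trans (le_add_right le_add_self)

theorem bench_next_cont {α : Type*} {m : ℕ} (b : α) (w v : Fin (m + 1)) :
    ((AgentState.cont b w).next v).bench = some (b, w) := by
  simp only [AgentState.next]
  split_ifs <;> rfl

/-- A content agent that plays its benchmark action keeps its benchmark for one step, so an
immediate exit needs an accepted experiment. Besides this cost 1, there is either a second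
experimenter, or an unlikely observation of cost 1, or an observation within one bin of the new
mean, accepted at cost `G`. -/
theorem le_res_content {R : ℝ≥0∞} (hR2 : R ≤ 2) (hR : g.NoiseControl) {b : g.Bench}
    (hG : ∀ i, ∀ c, c ≠ b.1 i → ∀ v : g.Bin, (b.2 i : ℕ) + 2 ≤ v →
      (v : ℕ) ≤ g.N i (Function.update b.1 i c) + 1 →
      R ≤ 1 + ENNReal.ofReal (g.G (g.low (b.2 i)) (g.low v)))
    {z : g.State} (hz : z ∉ g.basin b) : R ≤ g.res (g.content b) z := by
  obtain ⟨a, v, e⟩ := g.exists_res_eq_stepCost (g.content b) z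
  rw [e]
  by_cases htop : g.stepCost (g.content b) a v z = ⊤
  · rw [htop]
    exact le_top
  obtain ⟨i, hi⟩ : ∃ i, (z i).bench ≠ some (b.1 i, b.2 i) := by
    by_contra! hcon
    exact hz hcon
  have hfin : ∀ j, g.actRes (g.content b j) (a j) + g.obsResistance j a (v j) +
      g.updRes (g.content b j) (a j) (v j) (z j) ≠ ⊤ := fun j =>
    (ENNReal.sum_ne_top.1 htop) j (Finset.mem_univ j)
  have hupd : g.updRes (g.content b i) (a i) (v i) (z i) ≠ ⊤ := (ENNReal.add_ne_top.1 (hfin i)).2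
  have hai : a i ≠ b.1 i := fun e => by
    rw [e] at hupd
    have := g.eq_next_of_updRes_ne_top (g.content_mem_basin b i) hupd
    rw [this] at hi
    exact hi (bench_next_cont _ _ _)
  by_cases hj : ∃ j, j ≠ i ∧ a j ≠ b.1 j
  · obtain ⟨j, hji, haj⟩ := hj
    rw [stepCost]
    refine le_trans ?_ (Finset.add_le_sum (fun _ _ => bot_le) (Finset.mem_univ i)
      (Finset.mem_univ j) hji.symm)
    refine hR2.trans ?_
    rw [← one_add_one_eq_two]
    exact add_le_add
      ((g.one_le_actRes (g.content_mem_basin b i) hai).trans (le_add_right le_self_add))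
      ((g.one_le_actRes (g.content_mem_basin b j) haj).trans (le_add_right le_self_add))
  · have hau : a = Function.update b.1 i (a i) := by
      ext j
      by_cases hji : j = i
      · subst hji
        simp
      · rw [Function.update_of_ne hji]
        by_contra hne
        exact hj ⟨j, hji, hne⟩
    refine le_trans ?_ (Finset.single_le_sum (fun _ _ => bot_le) (Finset.mem_univ i))
    rcases g.updRes_experiment hai hupd with h1 | ⟨-, h2, h3⟩
    · exact absurd (by rw [h1]; rfl) hi
    have hact := g.one_le_actRes (g.content_mem_basin b i) hai
    by_cases hn : g.Near (v i) (g.N i a)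
    · refine (hG i (a i) hai (v i) h2 (by rw [← hau]; exact hn.1)).trans ?_
      exact add_le_add (le_add_right hact) h3
    · refine hR2.trans (le_add_right ?_)
      rw [← one_add_one_eq_two]
      exact add_le_add hact (g.one_le_obsResistance hR hn)

theorem le_escape {R : ℝ≥0∞} (hR1 : 1 ≤ R) (hR2 : R ≤ 2) (hR : g.NoiseControl) {b : g.Bench}
    (hb : b ∈ g.strongAligned)
    (hG : ∀ i, ∀ c, c ≠ b.1 i → ∀ v : g.Bin, (b.2 i : ℕ) + 2 ≤ v →
      (v : ℕ) ≤ g.N i (Function.update b.1 i c) + 1 →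
      R ≤ 1 + ENNReal.ofReal (g.G (g.low (b.2 i)) (g.low v))) : R ≤ g.escape b := by
  classical
  -- Dual certificate: a direct exit from `content b` costs at least `R`, and any step inside the
  -- basin that does not return to `content b` costs at least 1, so a detour costs 2 in all.
  let ψ : g.State → ℝ≥0∞ := fun y => if y = g.content b then R else if y ∈ g.basin b then 1 else 0
  have h := le_distTo (r := g.res) (S := (g.basin b)ᶜ) (ψ := ψ) (fun y hy => ?_)
    (fun y hy z => ?_) (g.content b)
  · simpa [ψ, escape] using h
  · have h1 : y ≠ g.content b := fun e => hy (e ▸ g.content_mem_basin b)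
    have h2 : y ∉ g.basin b := hy
    simp [ψ, h1, h2]
  · have hyb : y ∈ g.basin b := not_not.1 hy
    have hψy : ψ y ≤ 2 := by
      simp only [ψ]
      split_ifs
      exacts [hR2, one_le_two]
    by_cases hzb : z = g.content b
    · refine le_trans ?_ le_add_self
      simp only [ψ, hzb, if_true]
      split_ifs
      exacts [le_rfl, hR1]
    · have h1 := g.one_le_res_of_mem_basin hR hb hyb hzb
      by_cases hz : z ∈ g.basin b
      · refine hψy.trans ?_
        simp only [ψ, hzb, hz, if_true, if_false]
        rw [← one_add_one_eq_two]
        gcongr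
      · refine le_trans ?_ le_self_add
        by_cases hy' : y = g.content b
        · simp only [ψ, hy', if_true]
          exact g.le_res_content hR2 hR hG hz
        · simpa [ψ, hy', hyb] using h1

end Ritel

/-! ### Comparison of the potentials of aligned states. -/

namespace Ritel

open AgentState

variable {I : Type*} {A : I → Type*} (g : Ritel I A)

theorem totalPot_content [Fintype I] (b : g.Bench) :
    g.totalPot (g.content b) = ENNReal.ofReal (∑ i, g.F (g.low (b.2 i))) := by
  rw [ENNReal.ofReal_sum_of_nonneg fun i _ => g.F_low_nonneg _]
  rfl

variable [Fintype I] [DecidableEq I] [∀ i, Fintype (A i)]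

open Classical in
/-- The weakly aligned states, as a finite set. -/
noncomputable def aligned : Finset g.Bench := Finset.univ.filter (· ∈ g.weakAligned)

theorem mem_aligned {b : g.Bench} : b ∈ g.aligned ↔ b ∈ g.weakAligned := by
  simp [aligned]

variable [∀ i, DecidableEq (A i)]

theorem res_allDisc_content_le {b : g.Bench} (hb : b ∈ g.strongAligned) :
    g.res g.allDisc (g.content b) ≤ g.totalPot (g.content b) := by
  refine (g.res_le_stepCost _ _ b.1 b.2).trans (Finset.sum_le_sum fun i _ => ?_)
  have h0 : g.obsResistance i b.1 (b.2 i) = 0 := by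
    have := g.obsResistance_N i b.1
    rwa [hb i] at this
  rw [h0]
  simp only [allDisc, content, actRes, updRes, pot, zero_add]
  exact (min_le_left _ _).trans (by simp [ptRes])

variable [∀ i, Nonempty (A i)]

theorem le_potential (x : g.State) (Z : Finset g.Bench) (hx : ∀ b ∈ Z, x ∉ g.basin b) :
    g.totalPot x + ∑ b ∈ Z, g.escape b ≤ potential g.res x := by
  classical
  have := Fintype.ofFinite g.State
  have h := add_sum_distTo_le_potential (r := g.res) x g.allDisc Z
    (fun b => (g.basin b).toFinset) g.content ?_ ?_ g.totalPot ?_ g.totalPot_le_add ?_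
  · simpa [escape] using h
  · intro b _ b' _ hbb
    rw [Function.onFun, Finset.disjoint_left]
    intro y hy hy'
    exact hbb (g.eq_of_mem_basin (by simpa using hy) (by simpa using hy'))
  · intro b hb
    simpa using hx b hb
  · simp [totalPot, allDisc, pot]
  · intro b _ u hu v huv
    exact g.totalPot_le_of_mem_basin (by simpa using hu) huv

theorem res_content_pos {b : g.Bench} (hb : b ∈ g.weakAligned) {z : g.State}
    (hz : z ≠ g.content b) : 0 < g.res (g.content b) z := by
  obtain ⟨a, v, e⟩ := g.exists_res_eq_stepCost (g.content b) z
  rw [e]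
  by_cases ha : ∃ i, a i ≠ b.1 i
  · obtain ⟨i, hi⟩ := ha
    refine lt_of_lt_of_le ?_ (Finset.single_le_sum (fun _ _ => bot_le) (Finset.mem_univ i))
    exact zero_lt_one.trans_le
      ((g.one_le_actRes (g.content_mem_basin b i) hi).trans (le_add_right le_self_add))
  · have hab : a = b.1 := funext fun i => not_not.1 (not_exists.1 ha i)
    obtain ⟨i, hi⟩ := Function.ne_iff.1 hz
    refine lt_of_lt_of_le ?_ (Finset.single_le_sum (fun _ _ => bot_le) (Finset.mem_univ i))
    by_cases hn : g.Near (v i) (b.2 i)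
    · have : g.updRes (g.content b i) (a i) (v i) (z i) = ⊤ := by
        by_contra hfin
        rw [hab] at hfin
        have h1 := g.eq_next_of_updRes_ne_top (g.content_mem_basin b i) hfin
        rw [next_of_near (g.content_mem_basin b i) hn] at h1
        exact hi h1
      rw [this, add_top]
      exact ENNReal.zero_lt_top
    · rw [hab]
      have := g.obsResistance_pos (hb i).1 (hb i).2 hn
      exact this.trans_le (le_add_right le_add_self)

variable [Nontrivial I]

/-- Strong alignment is needed at the root: only then does the direct jump from the all-discontent
state cost no more than `∑ F`, each benchmark bin being the bin of the mean. The term `escape b₀` on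
the left avoids a subtraction in `ℝ≥0∞`. -/
theorem potential_content_le (hinter : g.Interdependent3) (hA : g.absorbingOpt = ∅)
    {b₀ : g.Bench} (hb₀ : b₀ ∈ g.strongAligned) :
    potential g.res (g.content b₀) + g.escape b₀ ≤
      g.totalPot (g.content b₀) + ∑ b ∈ g.aligned, g.escape b := by
  classical
  have := Fintype.ofFinite g.State
  have hmem := g.mem_aligned.2 (g.strongAligned_subset_weakAligned hb₀)
  rw [← Finset.sum_erase_add _ _ hmem, ← add_assoc]
  gcongr
  refine ENNReal.le_of_forall_pos_le_add fun η hη _ => ?_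
  -- The escape is an infimum of path costs; the error `η` is shared among the aligned states.
  set η' : NNReal := η / (g.aligned.card + 1) with hη'
  have hη'0 : (η' : ℝ≥0∞) ≠ 0 := by
    have : 0 < η' := by positivity
    exact_mod_cast this.ne'
  let w : g.State → ℝ≥0∞ := fun y => (if y = g.allDisc then g.totalPot (g.content b₀) else 0) +
    ∑ b ∈ g.aligned.erase b₀, if y = g.content b then g.escape b + η' else 0
  have h := potential_le_sum_of_path (r := g.res) (g.content b₀) g.rank w (fun y hy => ?_)
  · refine h.trans ((Finset.sum_le_sum_of_subset (Finset.erase_subset _ _)).trans ?_)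
    simp only [w]
    rw [Finset.sum_add_distrib, Finset.sum_comm]
    simp only [Finset.sum_ite_eq', Finset.mem_univ, if_true]
    rw [Finset.sum_add_distrib, ← add_assoc]
    gcongr
    rw [Finset.sum_const, nsmul_eq_mul]
    have h1 : ((g.aligned.erase b₀).card : NNReal) * η' ≤ η := by
      calc ((g.aligned.erase b₀).card : NNReal) * η' ≤ (g.aligned.card + 1) * η' := by
            gcongr
            exact (Nat.cast_le.2 (Finset.card_erase_le)).trans le_self_add
        _ = η := by
            rw [hη', mul_div_cancel₀]
            positivity
    exact_mod_cast h1
  · by_cases hD : y = g.allDisc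
    · refine ⟨g.res y (g.content b₀), ?_, .single (Or.inl rfl)⟩
      rw [hD]
      refine (g.res_allDisc_content_le hb₀).trans ?_
      simp [w]
    by_cases hal : ∃ b ∈ g.weakAligned, y = g.content b
    · obtain ⟨b, hb, rfl⟩ := hal
      obtain ⟨c, hc, hp⟩ := exists_pathCost_le (g.escape_ne_top hinter hA hb) hη'0
      have hctop : c ≠ ⊤ := ne_top_of_le_ne_top
        (ENNReal.add_ne_top.2 ⟨g.escape_ne_top hinter hA hb, ENNReal.coe_ne_top⟩) hc
      obtain ⟨c', hc', hp'⟩ := g.exists_path_of_exit hp hctop (g.content_mem_basin b)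
      refine ⟨c', hc'.trans (hc.trans ?_), hp'.mono fun u hu => Or.inr (g.rank_lt_of_total_lt hu)⟩
      have hbe : b ∈ g.aligned.erase b₀ :=
        Finset.mem_erase.2 ⟨fun e => hy (e ▸ rfl), g.mem_aligned.2 hb⟩
      refine le_trans ?_ le_add_self
      refine le_trans ?_ (Finset.single_le_sum (fun _ _ => bot_le) hbe)
      rw [if_pos rfl]
      rfl
    · exact ⟨0, bot_le, (g.exists_path_rank_lt hinter hD hal).mono fun u hu => Or.inr hu⟩

theorem totalPot_add_escape_le (hinter : g.Interdependent3) (hA : g.absorbingOpt = ∅)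
    {b b₀ : g.Bench} (hb : b ∈ g.weakAligned) (hb₀ : b₀ ∈ g.strongAligned)
    (hmin : potential g.res (g.content b) ≤ potential g.res (g.content b₀)) :
    g.totalPot (g.content b) + g.escape b₀ ≤ g.totalPot (g.content b₀) + g.escape b := by
  classical
  have h1 := g.potential_content_le hinter hA hb₀
  have h2 := g.le_potential (g.content b) (g.aligned.erase b) fun b' hb' hmem =>
    (Finset.ne_of_mem_erase hb') (g.eq_of_mem_basin hmem (g.content_mem_basin b))
  have hmem := g.mem_aligned.2 hb
  have hsum : ∑ b ∈ g.aligned.erase b, g.escape b ≠ ⊤ := ENNReal.sum_ne_top.2 fun b' hb' =>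
    g.escape_ne_top hinter hA (g.mem_aligned.1 (Finset.mem_of_mem_erase hb'))
  have h3 := (add_le_add_left (h2.trans hmin) (g.escape b₀)).trans h1
  rw [← Finset.sum_erase_add _ _ hmem] at h3
  refine (ENNReal.add_le_add_iff_right hsum).1 ?_
  calc _ = g.totalPot (g.content b) + ∑ b ∈ g.aligned.erase b, g.escape b + g.escape b₀ := by ring
    _ ≤ _ := h3
    _ = _ := by ring

/-- A state of minimum potential is weakly aligned. -/
theorem exists_weakAligned_of_mem_minPotential (hinter : g.Interdependent3)
    (hA : g.absorbingOpt = ∅) {b₀ : g.Bench} (hb₀ : b₀ ∈ g.strongAligned)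
    (hlt : g.totalPot (g.content b₀) < g.escape b₀) {x : g.State}
    (hx : ∀ y, potential g.res x ≤ potential g.res y) :
    ∃ b ∈ g.weakAligned, x = g.content b := by
  classical
  have := Fintype.ofFinite g.State
  have hsum : ∑ b ∈ g.aligned, g.escape b ≠ ⊤ := ENNReal.sum_ne_top.2 fun b hb =>
    g.escape_ne_top hinter hA (g.mem_aligned.1 hb)
  have h1 := g.potential_content_le hinter hA hb₀
  have hpot : potential g.res (g.content b₀) ≠ ⊤ := by
    refine ne_top_of_le_ne_top ?_ (le_self_add.trans h1)
    exact ENNReal.add_ne_top.2 ⟨hlt.ne_top, hsum⟩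
  by_cases hmem : ∃ b ∈ g.weakAligned, x ∈ g.basin b
  · obtain ⟨b, hb, hxb⟩ := hmem
    refine ⟨b, hb, ?_⟩
    by_contra hne
    -- `x` relaxes to `content b` for free, whereas every edge out of `content b` has positive
    -- resistance; re-rooting gives a strictly smaller potential.
    obtain ⟨q, hq0, hq⟩ : ∃ q : ℝ≥0∞, 0 < q ∧ ∀ w, w ≠ g.content b → q ≤ g.res (g.content b) w := by
      refine ⟨(Finset.univ.erase (g.content b)).inf fun w => g.res (g.content b) w, ?_, ?_⟩
      · rw [Finset.lt_inf_iff ENNReal.zero_lt_top]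
        exact fun w hw => g.res_content_pos hb (Finset.ne_of_mem_erase hw)
      · intro w hw
        exact Finset.inf_le (by simp [hw])
    have h2 := potential_add_le_potential hne (g.res_to_content hb hxb) hq
    have h3 := h2.trans (hx (g.content b))
    have hfin : potential g.res (g.content b) ≠ ⊤ :=
      ne_top_of_le_ne_top hpot (le_self_add.trans (h2.trans (hx _)))
    exact absurd h3 (not_le.2 (ENNReal.lt_add_right hfin hq0.ne'))
  -- If the root lies in no aligned basin, all escapes must be paid, including `escape b₀`, which
  -- exceeds the `∑ F` spent in the upper bound.
  · exfalso
    have h2 := g.le_potential x g.aligned fun b hb hxb => hmem ⟨b, g.mem_aligned.1 hb, hxb⟩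
    have h3 : ∑ b ∈ g.aligned, g.escape b ≤ potential g.res (g.content b₀) :=
      le_add_self.trans (h2.trans (hx _))
    have h4 : g.escape b₀ + ∑ b ∈ g.aligned, g.escape b ≤
        g.totalPot (g.content b₀) + ∑ b ∈ g.aligned, g.escape b := by
      refine le_trans ?_ h1
      rw [add_comm]
      gcongr
    exact absurd ((ENNReal.add_le_add_iff_right hsum).1 h4) (not_le.2 hlt)

end Ritel

/-! ### Bounds from `F` and `G`, and the theorem. -/

namespace Ritel

variable {I : Type*} {A : I → Type*} (g : Ritel I A)

theorem F_sum_nonneg [Fintype I] (b : g.Bench) : 0 ≤ ∑ i, g.F (g.low (b.2 i)) :=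
  Finset.sum_nonneg fun _ _ => g.F_low_nonneg _

theorem BoundsFG.exists_bounds [Fintype I] [Nonempty I] {g : Ritel I A} (h : g.BoundsFG) :
    ∃ F₀ G₀ : ℝ, F₀ + G₀ ≤ 1 ∧ 0 ≤ F₀ ∧ 0 < G₀ ∧
      (∀ b : g.Bench, ∑ i, g.F (g.low (b.2 i)) ≤ F₀) ∧
      ∀ w v : g.Bin, (w : ℕ) < v → g.G (g.low w) (g.low v) < G₀ := by
  obtain ⟨F₀, G₀, hF, hG, hsum⟩ := h
  have hcard : (0 : ℝ) < Fintype.card I := by exact_mod_cast Fintype.card_pos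
  have hF0 : 0 ≤ F₀ := by
    have h1 := hF 0 ⟨le_rfl, zero_le_one⟩
    have h2 := h1.1.trans h1.2
    rwa [le_div_iff₀ hcard, zero_mul] at h2
  have hG0 : 0 < G₀ := by
    have := hG 0 ⟨le_rfl, zero_le_one⟩ 1 ⟨zero_le_one, le_rfl⟩ zero_lt_one
    exact this.1.trans_lt this.2
  refine ⟨F₀, G₀, hsum, hF0, hG0, fun b => ?_, fun w v hwv => ?_⟩
  · calc ∑ i, g.F (g.low (b.2 i)) ≤ ∑ _i : I, F₀ / Fintype.card I :=
          Finset.sum_le_sum fun i _ => (hF _ (g.low_mem_Icc _)).2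
      _ = F₀ := by
          rw [Finset.sum_const, Finset.card_univ, nsmul_eq_mul, mul_div_cancel₀ _ hcard.ne']
  · have h1 := g.low_add_le_low (k := 1) hwv
    push_cast at h1
    exact (hG _ (g.low_mem_Icc w) _ (g.low_mem_Icc v) (by linarith [g.δ_pos])).2

theorem low_add_mem_Icc (v : g.Bin) : g.low v + g.δ ∈ Set.Icc (0 : ℝ) (1 + 1 / g.m) :=
  ⟨add_nonneg (g.low_mem_Icc v).1 g.δ_pos.le, add_le_add (g.low_mem_Icc v).2 le_rfl⟩

theorem strongAligned_nonempty [∀ i, Nonempty (A i)] : g.strongAligned.Nonempty :=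
  ⟨(fun _ => Classical.arbitrary _, fun i => g.N i fun _ => Classical.arbitrary _), fun _ => rfl⟩

theorem one_sub_vSplus_nonneg [DecidableEq I] (b : g.Bench) : 0 ≤ 1 - g.vSplus b := by
  rw [vSplus, sub_sub_cancel]
  refine Real.sInf_nonneg ?_
  rintro t ⟨i, c, -, -, rfl⟩
  exact g.G_nonneg _ (g.low_mem_Icc _) _ (g.low_add_mem_Icc _)

theorem one_sub_vSplus_le [DecidableEq I] (b : g.Bench) {i : I} {c : A i} (hc : c ≠ b.1 i)
    (h : (b.2 i : ℕ) + 1 ≤ g.N i (Function.update b.1 i c)) :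
    1 - g.vSplus b ≤ g.G (g.low (b.2 i)) (g.low (g.N i (Function.update b.1 i c)) + g.δ) := by
  rw [vSplus, sub_sub_cancel]
  refine csInf_le ⟨0, ?_⟩ ⟨i, c, hc, h, rfl⟩
  rintro t ⟨i, c, -, -, rfl⟩
  exact g.G_nonneg _ (g.low_mem_Icc _) _ (g.low_add_mem_Icc _)

variable [Fintype I] [DecidableEq I] [∀ i, Fintype (A i)] [∀ i, DecidableEq (A i)]
  [∀ i, Nonempty (A i)]

theorem two_le_escape (hR : g.NoiseControl) {b : g.Bench} (hb : b ∈ g.strongEq) :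
    2 ≤ g.escape b := by
  refine g.le_escape one_le_two le_rfl hR hb.1 fun i c hc v h1 h2 => ?_
  have := hb.2 i c hc
  omega

theorem one_le_escape (hR : g.NoiseControl) {b : g.Bench} (hb : b ∈ g.strongAligned) :
    1 ≤ g.escape b :=
  g.le_escape le_rfl one_le_two hR hb fun _ _ _ _ _ _ => le_self_add

/-- A bin `v` two above the benchmark and at most one above the new mean bin `N` forces `N` one
above the benchmark. This is the set in `S₊`, and `G` at `N + δ` bounds `G` at `v` from below. -/
theorem one_add_le_escape [Nonempty I] (hFG : g.BoundsFG) (hR : g.NoiseControl) {b : g.Bench}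
    (hb : b ∈ g.strongAligned) (hE : b ∉ g.strongEq) :
    1 + ENNReal.ofReal (1 - g.vSplus b) ≤ g.escape b := by
  obtain ⟨F₀, G₀, h01, hF0, hG0, -, hG⟩ := hFG.exists_bounds
  refine g.le_escape le_self_add ?_ hR hb fun i c hc v h1 h2 => ?_
  · obtain ⟨i, c, hc, hlt⟩ : ∃ i, ∃ c, c ≠ b.1 i ∧
        (b.2 i : ℕ) < g.N i (Function.update b.1 i c) := by
      by_contra! hcon
      exact hE ⟨hb, fun i c hc => hcon i c hc⟩
    have h1 := g.one_sub_vSplus_le b hc hlt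
    have h2 : g.G (g.low (b.2 i)) (g.low (g.N i (Function.update b.1 i c)) + g.δ) ≤
        g.G (g.low (b.2 i)) (g.low (g.N i (Function.update b.1 i c))) :=
      g.G_anti _ (g.low_mem_Icc _) (g.low_mem_Icc' _) (g.low_add_mem_Icc _)
        (le_add_of_nonneg_right g.δ_pos.le)
    have h3 := hG _ _ hlt
    have h4 : ENNReal.ofReal (1 - g.vSplus b) ≤ 1 := by
      rw [← ENNReal.ofReal_one]
      exact ENNReal.ofReal_le_ofReal (by linarith)
    calc 1 + ENNReal.ofReal (1 - g.vSplus b) ≤ 1 + 1 := by gcongr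
      _ = 2 := one_add_one_eq_two
  · gcongr
    refine (g.one_sub_vSplus_le b hc (by omega)).trans ?_
    refine g.G_anti _ (g.low_mem_Icc _) (g.low_mem_Icc' _) (g.low_add_mem_Icc _) ?_
    have := g.low_le_low_add (k := 1) h2
    push_cast at this
    linarith

end Ritel

theorem mainTheorem4 {I : Type*} [Fintype I] [DecidableEq I] [Nontrivial I]
    {A : I → Type*} [∀ i, Fintype (A i)] [∀ i, DecidableEq (A i)] [∀ i, Nonempty (A i)]
    (g : Ritel I A) (hinter : g.Interdependent3) (hFG : g.BoundsFG) (hR : g.NoiseControl)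
    (hA : g.absorbingOpt = ∅) :
    (∀ x y : g.State, AlmostRegular (fun ε => g.transition ε x y)) ∧
    (g.strongEq.Nonempty →
      minPotential g.res ⊆ g.content ''
        (g.weakOpt ∪ {b | b ∈ g.weakEq \ g.weakOpt ∧ ∀ b' ∈ g.strongEq, g.vW b' ≤ g.vW b})) ∧
    (g.strongEq = ∅ →
      minPotential g.res ⊆ g.content ''
        (g.weakEq ∪ {b | b ∈ g.weakAligned \ g.weakEq ∧
          ∀ b' ∈ g.strongAligned, g.vW b' - g.vSplus b' ≤ g.vW b - g.vSminus b})) := by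
  obtain ⟨F₀, G₀, h01, hF0, hG0, hF, hG⟩ := hFG.exists_bounds
  have hFn := g.F_sum_nonneg
  have hGn := g.G_low_nonneg
  have hmin : ∀ x ∈ minPotential g.res, ∀ y, potential g.res x ≤ potential g.res y :=
    fun x hx y => (show potential g.res x = _ from hx).trans_le (iInf_le _ y)
  have hweak : ∀ x ∈ minPotential g.res, ∃ b ∈ g.weakAligned, x = g.content b := by
    intro x hx
    obtain ⟨b₀, hb₀⟩ := g.strongAligned_nonempty
    refine g.exists_weakAligned_of_mem_minPotential hinter hA hb₀ ?_ (hmin x hx)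
    refine lt_of_lt_of_le ?_ (g.one_le_escape hR hb₀)
    rw [g.totalPot_content, ← ENNReal.ofReal_one]
    exact (ENNReal.ofReal_lt_ofReal_iff one_pos).2 (by linarith [hF b₀])
  have key : ∀ b ∈ g.weakAligned, g.content b ∈ minPotential g.res → ∀ b' ∈ g.strongAligned,
      ∀ p q : ℝ, 0 ≤ p → 0 ≤ q → ENNReal.ofReal p ≤ g.escape b' → g.escape b ≤ ENNReal.ofReal q →
      ∑ i, g.F (g.low (b.2 i)) + p ≤ ∑ i, g.F (g.low (b'.2 i)) + q := by
    intro b hb hbmin b' hb' p q hp hq hp' hq'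
    have h := g.totalPot_add_escape_le hinter hA hb hb' (hmin _ hbmin _)
    rw [g.totalPot_content, g.totalPot_content] at h
    have h' := (add_le_add le_rfl hp').trans (h.trans (add_le_add le_rfl hq'))
    rw [← ENNReal.ofReal_add (hFn b) hp, ← ENNReal.ofReal_add (hFn b') hq] at h'
    exact (ENNReal.ofReal_le_ofReal_iff (add_nonneg (hFn b') hq)).1 h'
  have hexit : ∀ b : g.Bench, ∀ i, ∀ c : A i, c ≠ b.1 i →
      (b.2 i : ℕ) + 2 ≤ g.N i (Function.update b.1 i c) →
      g.escape b ≤ ENNReal.ofReal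
        (1 + g.G (g.low (b.2 i)) (g.low (g.N i (Function.update b.1 i c)))) := by
    intro b i c hc h
    rw [ENNReal.ofReal_add zero_le_one (hGn _ _), ENNReal.ofReal_one]
    exact g.escape_le_one_add hc h
  have hne : ∀ b ∈ g.weakAligned, b ∉ g.weakEq → ∃ i, ∃ c : A i, c ≠ b.1 i ∧
      (b.2 i : ℕ) + 2 ≤ g.N i (Function.update b.1 i c) := by
    intro b hb hEq
    by_contra! hcon
    exact hEq ⟨hb, fun i c hc => Nat.lt_succ_iff.1 (hcon i c hc)⟩
  have h2 : ∀ b' ∈ g.strongEq, ENNReal.ofReal 2 ≤ g.escape b' := fun b' hb' => by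
    simpa using g.two_le_escape hR hb'
  refine ⟨fun x y => ⟨_, g.hasResistance_transition x y⟩, fun hE x hx => ?_, fun hE x hx => ?_⟩
  · obtain ⟨b, hb, rfl⟩ := hweak x hx
    refine ⟨b, ?_, rfl⟩
    by_cases hopt : b ∈ g.weakOpt
    · exact Or.inl hopt
    refine Or.inr ⟨⟨?_, hopt⟩, fun b' hb' => ?_⟩
    -- Otherwise `∑ F(b) + 2 ≤ ∑ F(b') + 1 + G < F₀ + 1 + G₀ ≤ 2`.
    · by_contra hEq
      obtain ⟨i, c, hc, hN⟩ := hne b hb hEq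
      obtain ⟨b', hb'⟩ := hE
      have h3 := key b hb hx b' hb'.1 2 _ zero_le_two
        (add_nonneg zero_le_one (hGn _ _)) (h2 b' hb') (hexit b i c hc hN)
      have h4 := hG (b.2 i) (g.N i (Function.update b.1 i c)) (by omega)
      linarith [hF b', hFn b]
    · have h3 := key b hb hx b' hb'.1 2 2 zero_le_two zero_le_two (h2 b' hb')
        (by simpa using g.escape_le_two hinter hb hopt)
      rw [Ritel.vW, Ritel.vW]
      linarith
  · obtain ⟨b, hb, rfl⟩ := hweak x hx
    refine ⟨b, ?_, rfl⟩
    by_cases hEq : b ∈ g.weakEq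
    · exact Or.inl hEq
    refine Or.inr ⟨⟨hb, hEq⟩, fun b' hb' => ?_⟩
    obtain ⟨i, c, hc, hN⟩ := hne b hb hEq
    have hS := g.one_sub_vSplus_nonneg b'
    have hesc := g.one_add_le_escape hFG hR hb' (by simp [hE])
    rw [← ENNReal.ofReal_one, ← ENNReal.ofReal_add zero_le_one hS] at hesc
    suffices h3 : ∑ i, g.F (g.low (b.2 i)) + (1 - g.vSplus b') - ∑ i, g.F (g.low (b'.2 i)) ≤
        1 - g.vSminus b by
      rw [Ritel.vW, Ritel.vW]
      linarith
    rw [Ritel.vSminus, sub_sub_cancel]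
    refine le_csInf ⟨_, i, c, hc, hN, rfl⟩ ?_
    rintro t ⟨j, d, hd, hM, rfl⟩
    have h4 := key b hb hx b' hb' _ _ (add_nonneg zero_le_one hS)
      (add_nonneg zero_le_one (hGn _ _)) hesc (hexit b j d hd hM)
    linarith
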